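/- Let $X=\{1<2<3<\cdots\}$ and $X'=\{1'<1<2'<2<\cdots\}$. The shifted diagram of a strict partition $\lambda_1>\dots>\lambda_l>0$ has $\lambda_i$ cells in row $i$, and row $i$ starts in column $i$ (so it starts on the main diagonal). *Mixed insertion.* Let $w=w_1\cdots w_n$ be a word in the alphabet $X$. Starting from the empty tableau $T_0$, the tableau $T_i$ (a filling of a shifted diagram with letters of $X'$) is obtained from $T_{i-1}$ by inserting $w_i$ into the first row, where a letter $x$ is inserted into a row (or column) as follows. If no entry of the row (column) is strictly greater than $x$, then $x$ is placed at its end and the process stops. Otherwise $x$ replaces the smallest entry $a>x$ (the leftmost, respectively topmost, one if this letter occurs several times). If $a$ was on the main diagonal, it is unprimed; it is then primed and inserted into the next column to the right of the one it was in. If $a$ was off the main diagonal, then it is inserted into the row below the one it was in if it is unprimed, and into the next column to the right if it is primed. The shapes of $T_{i-1}$ and $T_i$ differ by one cell; the mixed recording tableau $Q_{\mathrm{mix}}(w)$ is the filling of the shape of $T_n$ having the entry $i$ in that cell, for $i=1,\dots,n$. *SK insertion.* A hook word is a word $u=y_1\cdots y_s$ in $X$ with $y_1>\cdots>y_k\le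 y_{k+1}\le\cdots\le y_s$ for some $1\le k\le s$; write $u{\downarrow}=y_1\cdots y_k$ and $u{\uparrow}=y_{k+1}\cdots y_s$. To insert $x\in X$ into a hook word $u$: if $ux$ is a hook word, replace $u$ by $ux$ and stop. Otherwise let $y_j$ be the leftmost letter of $u{\uparrow}$ that is strictly greater than $x$, and let $y_i$ be the leftmost (that is, the largest) letter of $u{\downarrow}$ with $y_i\le y_j$; replace $y_j$ by $x$ and $y_i$ by $y_j$, so that $y_i$ is bumped out. To insert $x$ into a tableau with rows $u_1,\dots,u_l$ (hook words, from top to bottom), insert $x$ into $u_1$, insert the bumped letter, if any, into $u_2$, and so on; a letter bumped out of $u_l$ forms a new row. Starting from the empty tableau and inserting $w_1,\dots,w_n$ successively yields tableaux $P_{\mathrm{sk}}(w_1\cdots w_i)$, viewed as fillings of shifted diagrams. The shapes of $P_{\mathrm{sk}}(w_1\cdots w_{i-1})$ and $P_{\mathrm{sk}}(w_1\cdots w_i)$ differ by one cell; the SK recording tableau $Q_{\mathrm{sk}}(w)$ is the filling of the shape of $P_{\mathrm{sk}}(w)$ having the entry $i$ in that cell, for $i=1,\dots,n$. **Proposition.**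 For every word $w$ in the alphabet $X$, $Q_{\mathrm{mix}}(w)=Q_{\mathrm{sk}}(w)$. -/

import Mathlib

namespace ShiftedInsertion

/-! ### Alphabets, cells and fillings -/

/-- The alphabet `X = {1 < 2 < 3 < ⋯}`. -/
abbrev Letter : Type := ℕ+

/-- The alphabet `X' = {1' < 1 < 2' < 2 < ⋯}`, ordered lexicographically: `(k, false)` is the
primed letter `k'` and `(k, true)` is the unprimed letter `k`. -/
abbrev PLetter : Type := ℕ+ ×ₗ Bool

/-- The letter `k` of `X`, as an unprimed letter of `X'`. -/
def PLetter.unprimed (k : Letter) : PLetter := toLex (k, true)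

/-- The letter `k'` of `X'`. -/
def PLetter.primed (k : Letter) : PLetter := toLex (k, false)

/-- The letter `k` of which `k` and `k'` are the two versions. -/
def PLetter.base (a : PLetter) : Letter := (ofLex a).1

/-- Whether a letter of `X'` is primed. -/
def PLetter.IsPrimed (a : PLetter) : Prop := (ofLex a).2 = false

instance (a : PLetter) : Decidable a.IsPrimed :=
  inferInstanceAs (Decidable ((ofLex a).2 = false))

/-- A cell `(r, c)`: row `r` (counted from the top) and column `c` (counted from the left), both
starting from `0`. The `r`-th row of a shifted shape starts on the main diagonal, at `(r, r)`. -/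
abbrev Cell : Type := ℕ × ℕ

/-- A finite array of cells filled with elements of `α`. -/
structure Filling (α : Type) where
  /-- The set of cells that are filled: the shape. -/
  shape : Finset Cell
  /-- The content of each cell, `none` for a cell outside of the shape. -/
  entry : Cell → Option α
  mem_shape : ∀ p, p ∈ shape ↔ entry p ≠ none

namespace Filling

variable {α : Type}

/-- The empty filling. -/
def empty : Filling α where
  shape := ∅
  entry := fun _ => none
  mem_shape := by simp

/-- Write `a` into the cell `p`, replacing what was there or adding the cell to the shape. -/
def write (T : Filling α) (p : Cell) (a : α) : Filling α where
  shape := insert p T.shape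
  entry := Function.update T.entry p (some a)
  mem_shape := by
    intro q
    by_cases h : q = p
    · subst h; simp
    · simp [h, T.mem_shape q]

end Filling

/-! ### Mixed insertion -/

/-- A row or a column of the shifted plane. -/
inductive Line where
  | row (r : ℕ)
  | col (c : ℕ)

/-- The `k`-th cell of a line: rows are read from left to right, starting on the main diagonal,
columns are read from top to bottom. -/
def Line.cell : Line → ℕ → Cell
  | .row r, k => (r, r + k)
  | .col c, k => (k, c)

/-- The cell `p` is empty, or its entry is strictly greater than `a`. -/
def Filling.Accepts (T : Filling PLetter) (a : PLetter) (p : Cell) : Prop :=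
  ∀ b ∈ T.entry p, a < b

instance (T : Filling PLetter) (a : PLetter) (p : Cell) : Decidable (T.Accepts a p) :=
  match h : T.entry p with
  | none => isTrue (by simp [Filling.Accepts, h])
  | some b => decidable_of_iff (a < b) (by simp [Filling.Accepts, h])

theorem Line.cell_injective (L : Line) : Function.Injective L.cell := by
  intro i j h
  cases L <;> simpa [Line.cell] using h

theorem Filling.exists_accepts (T : Filling PLetter) (L : Line) (a : PLetter) :
    ∃ k, T.Accepts a (L.cell k) := by
  obtain ⟨p, ⟨k, rfl⟩, hk⟩ :=
    (Set.infinite_range_of_injective L.cell_injective).exists_notMem_finset T.shape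
  refine ⟨k, ?_⟩
  have h : T.entry (L.cell k) = none := by
    by_contra h
    exact hk ((T.mem_shape _).2 h)
  simp [Filling.Accepts, h]

/-- The cell in which `a` is placed when it is inserted into the line `L` of `T`. Lines of a
shifted Young tableau are weakly increasing, so this is the cell of the smallest entry strictly
greater than `a` (the first such cell if that letter is repeated), or the first empty cell of `L`
if there is no such entry. -/
def Filling.target (T : Filling PLetter) (L : Line) (a : PLetter) : Cell :=
  L.cell (Nat.find (T.exists_accepts L a))

/-- What happens to a letter `b` that gets bumped out of the cell `p`: the line into which it is
inserted, and the letter that is inserted there. On the main diagonal, `b` is primed and goes to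
the next column; off the diagonal, it goes to the next row if it is unprimed and to the next column
if it is primed. -/
def afterBump (p : Cell) (b : PLetter) : Line × PLetter :=
  if p.1 = p.2 then (.col (p.2 + 1), PLetter.primed b.base)
  else if b.IsPrimed then (.col (p.2 + 1), b)
  else (.row (p.1 + 1), b)

theorem le_afterBump {a b : PLetter} (p : Cell) (h : a < b) : a ≤ (afterBump p b).2 := by
  have key : a ≤ PLetter.primed b.base := by
    obtain ⟨a₁, a₂⟩ := a
    obtain ⟨b₁, b₂⟩ := b
    rcases Prod.Lex.lt_iff.1 h with h | ⟨h, h2⟩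
    · exact Prod.Lex.le_iff.2 (Or.inl h)
    · refine Prod.Lex.le_iff.2 (Or.inr ⟨h, ?_⟩)
      have h2 : a₂ < b₂ := h2
      change a₂ ≤ false
      revert h2
      cases a₂ <;> cases b₂ <;> decide
  unfold afterBump
  split_ifs
  · exact key
  · exact h.le
  · exact h.le

/-- The cells whose entry is strictly greater than `a`. -/
def Filling.above (T : Filling PLetter) (a : PLetter) : Finset Cell :=
  T.shape.filter fun p => T.Accepts a p

theorem Filling.mem_above (T : Filling PLetter) (a : PLetter) (p : Cell) :
    p ∈ T.above a ↔ p ∈ T.shape ∧ ∀ b ∈ T.entry p, a < b :=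
  Finset.mem_filter

theorem Filling.above_card_lt (T : Filling PLetter) (L : Line) {a b : PLetter}
    (hb : T.entry (T.target L a) = some b) :
    ((T.write (T.target L a) a).above (afterBump (T.target L a) b).2).card < (T.above a).card := by
  have hab : a < b := Nat.find_spec (T.exists_accepts L a) b hb
  have hle := le_afterBump (T.target L a) hab
  generalize T.target L a = p at hb hle ⊢
  generalize (afterBump p b).2 = b' at hle ⊢
  apply Finset.card_lt_card
  refine (Finset.ssubset_iff_of_subset ?_).2 ⟨p, ?_, ?_⟩
  · intro q hq
    rw [mem_above] at hq ⊢
    by_cases hqp : q = p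
    · subst hqp
      exact absurd (hq.2 a (by simp [write])) (not_lt.2 hle)
    · simp only [write, Function.update_of_ne hqp, Finset.mem_insert] at hq
      exact ⟨hq.1.resolve_left hqp, fun x hx => hle.trans_lt (hq.2 x hx)⟩
  · rw [mem_above, T.mem_shape, hb]
    refine ⟨by simp, fun x hx => ?_⟩
    rw [Option.mem_some_iff] at hx
    exact hx ▸ hab
  · rw [mem_above]
    intro h
    exact absurd (h.2 a (by simp [write])) (not_lt.2 hle)

/-- Insert the letter `a` into the line `L` of `T`, and continue with the bumped letters until a
letter is placed into an empty cell. -/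
def Filling.mixInsertLine (T : Filling PLetter) (L : Line) (a : PLetter) : Filling PLetter :=
  match hb : T.entry (T.target L a) with
  | none => T.write (T.target L a) a
  | some b =>
    (T.write (T.target L a) a).mixInsertLine
      (afterBump (T.target L a) b).1 (afterBump (T.target L a) b).2
termination_by (T.above a).card
decreasing_by exact T.above_card_lt L hb

/-- Mixed insertion of the letter `x` of `X` into `T`, starting with the first row. -/
def mixInsert (T : Filling PLetter) (x : Letter) : Filling PLetter :=
  T.mixInsertLine (.row 0) (PLetter.unprimed x)

/-- The mixed insertion tableau `P_mix(w)`. -/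
def mixTableau (w : List Letter) : Filling PLetter :=
  w.foldl mixInsert Filling.empty

/-! ### SK insertion -/

/-- A hook word `w₁ > w₂ > ⋯ > w_k ≤ w_{k+1} ≤ ⋯ ≤ w_l`, for some `1 ≤ k ≤ l`. -/
def IsHookWord (w : List Letter) : Prop :=
  ∃ k ∈ Finset.Icc 1 w.length,
    (w.take k).Pairwise (· > ·) ∧ (w.drop (k - 1)).Pairwise (· ≤ ·)

instance (w : List Letter) : Decidable (IsHookWord w) := by
  unfold IsHookWord; infer_instance

/-- The decreasing part `w₁ ⋯ w_k` of a hook word: its longest strictly decreasing prefix. -/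
def downPart : List Letter → List Letter
  | [] => []
  | [a] => [a]
  | a :: b :: l => if b < a then a :: downPart (b :: l) else [a]

/-- The increasing part `w_{k+1} ⋯ w_l` of a hook word. -/
def upPart (w : List Letter) : List Letter :=
  w.drop (downPart w).length

/-- The number `k` of a hook word is unique, and `downPart`, `upPart` are the two parts. -/
theorem parts_eq {w : List Letter} {k : ℕ} (hk : k ∈ Finset.Icc 1 w.length)
    (hdown : (w.take k).Pairwise (· > ·)) (hup : (w.drop (k - 1)).Pairwise (· ≤ ·)) :
    downPart w = w.take k ∧ upPart w = w.drop k := by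
  have key : downPart w = w.take k := by
    induction w generalizing k with
    | nil => simp [downPart]
    | cons a l ih =>
      obtain ⟨k, rfl⟩ : ∃ m, k = m + 1 := ⟨k - 1, by have := (Finset.mem_Icc.1 hk).1; omega⟩
      cases l with
      | nil => simp [downPart]
      | cons b l =>
        cases k with
        | zero =>
          have h : a ≤ b := by simp at hup; exact hup.1.1
          simp [downPart, h]
        | succ k =>
          have h : b < a := by simp at hdown; exact hdown.1.1
          have := ih (k := k + 1) (by simp at hk ⊢; omega)
            (by simpa using (List.pairwise_cons.1 hdown).2) (by simpa using hup)
          rw [downPart, if_pos h, this]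
          rfl
  refine ⟨key, ?_⟩
  rw [upPart, key, List.length_take, min_eq_left (Finset.mem_Icc.1 hk).2]

/-- The insertion of the letter `x` into a hook word `u`: the new word, and the letter that gets
bumped, if any. If `ux` is not a hook word, let `y` be the leftmost letter of the increasing part
with `x < y`, and `z` the leftmost letter of the decreasing part with `z ≤ y`; then `x` replaces
`y`, and `y` replaces `z`, which gets bumped. (For a hook word `u` such that `ux` is not a hook
word, both `y` and `z` exist.) -/
def skRowInsert (u : List Letter) (x : Letter) : List Letter × Option Letter :=
  if IsHookWord (u ++ [x]) then (u ++ [x], none)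
  else
    match (upPart u).find? (fun y => x < y) with
    | none => (u ++ [x], none)
    | some y =>
      match (downPart u).find? (fun z => z ≤ y) with
      | none => (u ++ [x], none)
      | some z =>
        ((downPart u).set ((downPart u).findIdx (fun z => z ≤ y)) y ++
          (upPart u).set ((upPart u).findIdx (fun y => x < y)) x, some z)

/-- SK insertion of the letter `x` into an array with rows `u₁, u₂, …, u_l` (from top to bottom): a
letter that gets bumped out of a row is inserted into the next one. -/
def skInsert : List (List Letter) → Letter → List (List Letter)
  | [], x => [[x]]
  | u :: us, x =>
    match skRowInsert u x with
    | (u', none) => u' :: us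
    | (u', some y) => u' :: skInsert us y

/-- The rows of the SK insertion tableau, from top to bottom. -/
def skRows (w : List Letter) : List (List Letter) :=
  w.foldl skInsert []

/-- The shifted filling with given rows: the `r`-th row is written from left to right starting on
the main diagonal. -/
def Filling.ofRows {α : Type} (R : List (List α)) : Filling α where
  shape := (Finset.range R.length).biUnion fun r =>
    (Finset.range (R.getD r []).length).image fun j => (r, r + j)
  entry := fun p => if p.1 ≤ p.2 then (R.getD p.1 [])[p.2 - p.1]? else none
  mem_shape := by
    rintro ⟨r, c⟩
    simp only [Finset.mem_biUnion, Finset.mem_range, Finset.mem_image, Prod.mk.injEq]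
    constructor
    · rintro ⟨r', -, j, hj, rfl, rfl⟩
      simpa using hj
    · intro h
      by_cases hrc : r ≤ c
      · have hlt : c - r < (R.getD r []).length := by simpa [hrc] using h
        refine ⟨r, ?_, c - r, hlt, rfl, by omega⟩
        by_contra hr
        simp [not_lt.1 hr] at hlt
      · simp [hrc] at h

/-- The SK insertion tableau `P_sk(w)`. -/
def skTableau (w : List Letter) : Filling Letter :=
  Filling.ofRows (skRows w)

/-! ### Recording tableaux -/

/-- Records the growth of the shape `sh (w₁ ⋯ w_i)`, for `i = 0, …, n`, where `w = w₁ ⋯ w_n`: the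
cell `p` contains `i` if it belongs to `sh (w₁ ⋯ w_i)` and not to `sh (w₁ ⋯ w_{i-1})`. -/
def recording (sh : List Letter → Finset Cell) (w : List Letter) : Cell → Option ℕ := fun p =>
  (List.range' 1 w.length).find? fun i => p ∈ sh (w.take i) ∧ p ∉ sh (w.take (i - 1))

/-- The mixed recording tableau `Q_mix(w)`. -/
def mixRecording (w : List Letter) : Cell → Option ℕ :=
  recording (fun v => (mixTableau v).shape) w

/-- The SK recording tableau `Q_sk(w)`. -/
def skRecording (w : List Letter) : Cell → Option ℕ :=
  recording (fun v => (skTableau v).shape) w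

end ShiftedInsertion

/-!
A recording tableau lists the shapes of the insertion tableaux of the prefixes of `w`, so it is
enough to show that mixed insertion and SK insertion of `w` lead to the same shape.

The path of cells by which the shape of a mixed insertion tableau grows can be described without its
entries: remove the largest letter of `w`; when it is put back, the smaller letters push it from one
row (or column) to the next, and each of them gets the cell that the largest letter would have left
free. Unshifted insertion of signed words, where letters of one sign are inserted into rows and
letters of the other sign into columns, grows in the same way. In the unshifted case, a Knuth
relation changes three consecutive cells of the path by an elementary dual equivalence and leaves
the others alone, so it preserves the shape. A shifted diagram is half of its double, an unshifted
diagram that grows by two cells, one for the primed and one for the unprimed version of each letter;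
through the double, the shifted plactic relations preserve the shapes of mixed insertion, in any
context.

If SK insertion of `x` into a hook word `u` bumps `z` and turns `u` into `u'`, then `ux` and `zu'`
are shifted plactic equivalent. Hence, if `u` is the first row of the SK tableau of `w` and `v` is
the word of the letters bumped out of it, then mixed insertion of `w` and of `vu` lead to the same
shape. A peak `x ≤ y > z` of a word is a peak of the path of cells, and the hook word `u` has none;
so its cells contain at most one cell of each diagonal beyond the shape of `v`, and the rows of the
shape of `w` below the first one are contained in the shape of `v`, moved along the diagonal. The
first row has at most `|u|` cells, because a letter that bumps makes a peak with the last two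
letters of the row. As the number of cells is `|v| + |u|`, both bounds are attained, and induction
applies to `v`.
-/

namespace ShiftedInsertion

/-! ### Diagrams and paths -/

section Diagrams

/-- The cell `p` can be added to the diagram `A` of the region `P`. The diagrams are the subsets of
`P` closed under going up and to the left within `P`: Young diagrams if `P` is the whole quadrant,
shifted diagrams if `P` is the part of it above the main diagonal. -/
structure Addable (P : Cell → Prop) (A : Set Cell) (p : Cell) : Prop where
  isRelLowerSet : IsRelLowerSet A P
  notMem : p ∉ A
  isRelLowerSet_insert : IsRelLowerSet (insert p A) P

variable {P : Cell → Prop} {A : Set Cell} {p q : Cell}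

theorem Addable.prop (h : Addable P A p) : P p :=
  h.isRelLowerSet_insert.prop_of_mem (Set.mem_insert p A)

theorem Addable.mem_of_lt (h : Addable P A p) (hq : P q) (hqp : q < p) : q ∈ A :=
  (h.isRelLowerSet_insert.mem_of_le (Set.mem_insert p A) hqp.le hq).resolve_left hqp.ne

theorem addable_of_forall_lt (hA : IsRelLowerSet A P) (hp : P p) (hpA : p ∉ A)
    (hlt : ∀ q < p, P q → q ∈ A) : Addable P A p := by
  refine ⟨hA, hpA, ?_⟩
  rintro a (rfl | ha)
  · exact ⟨hp, fun b hb hPb => hb.eq_or_lt.imp_right fun hb => hlt b hb hPb⟩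
  · exact ⟨(hA ha).1, fun b hb hPb => Or.inr ((hA ha).2 hb hPb)⟩

theorem exists_addable_le (hA : IsRelLowerSet A P) (hp : P p) (hpA : p ∉ A) :
    ∃ n ≤ p, Addable P A n := by
  obtain ⟨n, hnp, hn⟩ := exists_minimal_le_of_wellFoundedLT (fun n => P n ∧ n ∉ A) p ⟨hp, hpA⟩
  refine ⟨n, hnp, addable_of_forall_lt hA hn.prop.1 hn.prop.2 fun q hq hPq => ?_⟩
  by_contra hqA
  exact hq.not_ge (hn.le_of_le ⟨hPq, hqA⟩ hq.le)

theorem Addable.not_le_of_mem (h : Addable P A p) (hq : q ∈ A) : ¬ p ≤ q := fun hpq =>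
  h.notMem (h.isRelLowerSet.mem_of_le hq hpq h.prop)

theorem Addable.notMem_of_lt (h : Addable P A p) (hpq : p < q) : q ∉ insert p A := fun hq =>
  hq.elim hpq.ne' fun hq => h.not_le_of_mem hq hpq.le

theorem Addable.fst_lt_iff (h : Addable P A p) (h' : Addable P (insert p A) q)
    (hP : P (p.1, p.2 + 1)) : p.1 < q.1 ↔ q.2 ≤ p.2 := by
  refine ⟨fun hlt => ?_, fun hcol => ?_⟩
  · by_contra! hcol
    exact h.notMem_of_lt (Prod.mk_lt_mk_of_le_of_lt le_rfl (Nat.lt_succ_self _))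
      (h'.mem_of_lt hP (Prod.mk_lt_mk_of_lt_of_le hlt hcol))
  · by_contra! hrow
    exact h'.not_le_of_mem (Set.mem_insert p A) ⟨hrow, hcol⟩

theorem Addable.lt_or_lt (hp : Addable P A p) (hq : Addable P A q) (hne : p ≠ q) :
    p.1 < q.1 ∧ q.2 < p.2 ∨ q.1 < p.1 ∧ p.2 < q.2 := by
  have hpq : ¬ p ≤ q := fun h => hp.notMem (hq.mem_of_lt hp.prop (h.lt_of_ne hne))
  have hqp : ¬ q ≤ p := fun h => hq.notMem (hp.mem_of_lt hq.prop (h.lt_of_ne hne.symm))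
  rw [Prod.le_def] at hpq hqp
  lia

theorem Addable.exists_next_row (h : Addable P A p) (hP : P (p.1 + 1, p.2)) :
    ∃ n, Addable P (insert p A) n ∧ n.1 = p.1 + 1 := by
  obtain ⟨n, hle, hn⟩ := exists_addable_le h.isRelLowerSet_insert hP
    (h.notMem_of_lt (Prod.mk_lt_mk_of_lt_of_le (Nat.lt_succ_self _) le_rfl))
  refine ⟨n, hn, le_antisymm hle.1 (not_lt.1 fun hlt => hn.notMem ?_)⟩
  exact h.isRelLowerSet_insert.mem_of_le (Set.mem_insert p A) ⟨Nat.lt_succ_iff.1 hlt, hle.2⟩ hn.prop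

theorem Addable.exists_next_col (h : Addable P A p) (hP : P (p.1, p.2 + 1)) :
    ∃ n, Addable P (insert p A) n ∧ n.2 = p.2 + 1 := by
  obtain ⟨n, hle, hn⟩ := exists_addable_le h.isRelLowerSet_insert hP
    (h.notMem_of_lt (Prod.mk_lt_mk_of_le_of_lt le_rfl (Nat.lt_succ_self _)))
  refine ⟨n, hn, le_antisymm hle.2 (not_lt.1 fun hlt => hn.notMem ?_)⟩
  exact h.isRelLowerSet_insert.mem_of_le (Set.mem_insert p A) ⟨hle.1, Nat.lt_succ_iff.1 hlt⟩ hn.prop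

theorem exists_addable_row_zero (hA : IsRelLowerSet A P) (hP : ∀ c, P (0, c)) (hfin : A.Finite) :
    ∃ s, Addable P A s ∧ s.1 = 0 := by
  obtain ⟨_, ⟨k, rfl⟩, hk⟩ := (Set.infinite_range_of_injective
    (Prod.mk_right_injective (β := ℕ) (0 : ℕ))).exists_notMem_finite hfin
  obtain ⟨s, hle, hs⟩ := exists_addable_le hA (hP k) hk
  exact ⟨s, hs, Nat.le_zero.1 hle.1⟩

theorem Addable.eq_of_le (hp : Addable P A p) (hq : Addable P A q) (hle : p ≤ q) : p = q :=
  hle.eq_or_lt.resolve_right fun hlt => hp.notMem (hq.mem_of_lt hp.prop hlt)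

theorem Addable.eq_of_fst_eq (hp : Addable P A p) (hq : Addable P A q) (h : p.1 = q.1) : p = q :=
  (le_total p.2 q.2).elim (fun h2 => hp.eq_of_le hq ⟨h.le, h2⟩)
    fun h2 => (hq.eq_of_le hp ⟨h.ge, h2⟩).symm

theorem Addable.eq_of_snd_eq (hp : Addable P A p) (hq : Addable P A q) (h : p.2 = q.2) : p = q :=
  (le_total p.1 q.1).elim (fun h1 => hp.eq_of_le hq ⟨h1, h.le⟩)
    fun h1 => (hq.eq_of_le hp ⟨h1, h.ge⟩).symm

theorem Addable.addable_insert (hp : Addable P A p) (hq : Addable P A q) (hne : p ≠ q) :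
    Addable P (insert p A) q where
  isRelLowerSet := hp.isRelLowerSet_insert
  notMem := by simp [hq.notMem, hne.symm]
  isRelLowerSet_insert := by
    simpa only [Set.union_insert, Set.union_self, Set.insert_union] using
      hp.isRelLowerSet_insert.union hq.isRelLowerSet_insert

variable {β : Type*} {U V W : List (β × Cell)}

/-- The set `A` together with the cells of a list of cells with labels. -/
def addCells (A : Set Cell) (W : List (β × Cell)) : Set Cell := A ∪ {p | p ∈ W.map Prod.snd}

@[simp] theorem addCells_nil (A : Set Cell) : addCells A ([] : List (β × Cell)) = A := by
  simp [addCells]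

@[simp] theorem addCells_cons (A : Set Cell) (e : β × Cell) (W : List (β × Cell)) :
    addCells A (e :: W) = addCells (insert e.2 A) W := by
  ext p
  simp only [addCells, List.map_cons, List.mem_cons, Set.mem_union, Set.mem_ofPred_eq,
    Set.mem_insert_iff]
  tauto

@[simp] theorem addCells_append (A : Set Cell) (U V : List (β × Cell)) :
    addCells A (U ++ V) = addCells (addCells A U) V := by
  simp only [addCells, List.map_append, List.mem_append, Set.union_assoc]
  rfl

theorem finite_addCells_empty (W : List (β × Cell)) : (addCells ∅ W).Finite := by
  simpa only [addCells, Set.empty_union] using List.finite_toSet (W.map Prod.snd)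

/-- The cells of the list can be added to the diagram `A` one after the other. -/
def IsPath (P : Cell → Prop) : Set Cell → List (β × Cell) → Prop
  | _, [] => True
  | A, e :: W => Addable P A e.2 ∧ IsPath P (insert e.2 A) W

theorem isPath_append : IsPath P A (U ++ V) ↔ IsPath P A U ∧ IsPath P (addCells A U) V := by
  induction U generalizing A with
  | nil => simp [IsPath]
  | cons e U ih => simp [IsPath, ih, and_assoc]

theorem IsPath.isRelLowerSet (hA : IsRelLowerSet A P) (h : IsPath P A W) :
    IsRelLowerSet (addCells A W) P := by
  induction W generalizing A with
  | nil => simpa using hA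
  | cons e W ih => simpa using ih h.1.isRelLowerSet_insert h.2

end Diagrams

/-! ### The path of the largest letter -/

/-- The line in which a letter bumped out of the cell `q` is placed: the next row (`t = true`) or
the next column (`t = false`). -/
def NextLine (t : Bool) (q n : Cell) : Prop :=
  if t then n.1 = q.1 + 1 else n.2 = q.2 + 1

/-- A kind of insertion, by the region that holds its tableaux and by the direction
(`true` for rows, `false` for columns) in which a letter travels on when it is bumped out of a
cell, as a function of this cell and of the direction in which the letter was travelling. -/
structure BumpRule where
  /-- The cells that may be filled. -/
  region : Cell → Prop
  /-- The direction of a letter after it has been bumped. -/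
  turn : Cell → Bool → Bool

/-- Insertion into Young tableaux, where no letter ever changes its direction. -/
def BumpRule.young : BumpRule where
  region _ := True
  turn _ t := t

/-- Mixed insertion into shifted tableaux: a letter turns to column insertion when it is bumped
out of the main diagonal. -/
def BumpRule.shifted : BumpRule where
  region p := p.1 ≤ p.2
  turn q t := t && decide (q.1 ≠ q.2)

section Pass

variable {β : Type*}

/-- `Pass ρ A q t V q' t' V'`: the largest letter, initially in the cell `q` and travelling in the
direction `t`, moves while the smaller letters fill the cells of `V` one after the other: whenever
its cell gets filled, it moves to the next line. It ends up in `q'` with direction `t'`, and `V'`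
are the successive new cells. -/
inductive Pass (ρ : BumpRule) :
    Set Cell → Cell → Bool → List (β × Cell) → Cell → Bool → List (β × Cell) → Prop
  | nil (A : Set Cell) (q : Cell) (t : Bool) : Pass ρ A q t [] q t []
  | keep {A : Set Cell} {q c q' : Cell} {t t' : Bool} {x : β} {V V' : List (β × Cell)} (h : c ≠ q)
      (hp : Pass ρ (insert c A) q t V q' t' V') : Pass ρ A q t ((x, c) :: V) q' t' ((x, c) :: V')
  | bump {A : Set Cell} {q n q' : Cell} {t t' : Bool} {x : β} {V V' : List (β × Cell)}
      (hn : Addable ρ.region (insert q A) n) (hl : NextLine (ρ.turn q t) q n)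
      (hp : Pass ρ (insert q A) n (ρ.turn q t) V q' t' V') :
      Pass ρ A q t ((x, q) :: V) q' t' ((x, n) :: V')

variable {ρ : BumpRule} {P : Cell → Prop} {A : Set Cell} {q q₁ q₂ q' n n' : Cell}
  {t t₁ t₂ t' : Bool} {U V V' V₁ V₂ W X Y Z : List (β × Cell)}

theorem NextLine.eq (h : NextLine t q n) (h' : NextLine t q n') (hn : Addable P A n)
    (hn' : Addable P A n') : n = n' := by
  cases t
  · exact hn.eq_of_snd_eq hn' (Eq.trans h (Eq.symm h'))
  · exact hn.eq_of_fst_eq hn' (Eq.trans h (Eq.symm h'))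

theorem Pass.unique (h₁ : Pass ρ A q t V q₁ t₁ V₁) (h₂ : Pass ρ A q t V q₂ t₂ V₂) :
    q₁ = q₂ ∧ t₁ = t₂ ∧ V₁ = V₂ := by
  induction h₁ generalizing q₂ t₂ V₂ with
  | nil => cases h₂; simp
  | keep h _ ih =>
    cases h₂ with
    | keep h' hp => simpa using ih hp
    | bump => exact absurd rfl h
  | bump hn hl _ ih =>
    cases h₂ with
    | keep h' hp => exact absurd rfl h'
    | bump hn' hl' hp =>
      obtain rfl := hl.eq hl' hn hn'
      simpa using ih hp

theorem Pass.map_fst (h : Pass ρ A q t V q' t' V') : V'.map Prod.fst = V.map Prod.fst := by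
  induction h with
  | nil => rfl
  | keep _ _ ih => simp [ih]
  | bump _ _ _ ih => simp [ih]

theorem Pass.isPath (h : Pass ρ A q t V q' t' V') (hq : Addable ρ.region A q)
    (hV : IsPath ρ.region A V) :
    Addable ρ.region (addCells A V) q' ∧ IsPath ρ.region (insert q A) V' ∧
      insert q' (addCells A V) = addCells (insert q A) V' := by
  induction h with
  | nil => simpa [IsPath] using hq
  | keep h _ ih =>
    obtain ⟨hq', hV', heq⟩ := ih (hV.1.addable_insert hq h) hV.2
    rw [Set.insert_comm] at hV' heq
    exact ⟨by simpa using hq', ⟨hq.addable_insert hV.1 h.symm, hV'⟩, by simpa using heq⟩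
  | bump hn _ _ ih =>
    obtain ⟨hq', hV', heq⟩ := ih hn hV.2
    exact ⟨by simpa using hq', ⟨hn, hV'⟩, by simpa using heq⟩

theorem exists_pass_of_nextLine
    (hnext : ∀ ⦃A q⦄ t, Addable ρ.region A q →
      ∃ n, NextLine (ρ.turn q t) q n ∧ Addable ρ.region (insert q A) n)
    (hq : Addable ρ.region A q) (hV : IsPath ρ.region A V) :
    ∃ q' t' V', Pass ρ A q t V q' t' V' := by
  induction V generalizing A q t with
  | nil => exact ⟨q, t, [], .nil _ _ _⟩
  | cons e V ih =>
    by_cases h : e.2 = q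
    · subst h
      obtain ⟨n, hl, hn⟩ := hnext t hq
      obtain ⟨q', t', V', hp⟩ := ih hn hV.2
      exact ⟨q', t', _, .bump hn hl hp⟩
    · obtain ⟨q', t', V', hp⟩ := ih (hV.1.addable_insert hq h) hV.2
      exact ⟨q', t', _, .keep h hp⟩

theorem Pass.append (h₁ : Pass ρ A q t U q₁ t₁ X) (h₂ : Pass ρ (addCells A U) q₁ t₁ V q' t' Y) :
    Pass ρ A q t (U ++ V) q' t' (X ++ Y) := by
  induction h₁ with
  | nil => simpa using h₂
  | keep h _ ih => exact .keep h (ih (by simpa using h₂))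
  | bump hn hl _ ih => exact .bump hn hl (ih (by simpa using h₂))

theorem Pass.exists_of_append_right (h : Pass ρ A q t V q' t' (X ++ Y)) :
    ∃ q₁ t₁ V₁ V₂, Pass ρ A q t V₁ q₁ t₁ X ∧ Pass ρ (addCells A V₁) q₁ t₁ V₂ q' t' Y ∧
      V = V₁ ++ V₂ := by
  induction X generalizing A q t V with
  | nil => exact ⟨q, t, [], V, .nil _ _ _, by simpa using h, rfl⟩
  | cons e X ih =>
    cases h with
    | keep h hp =>
      obtain ⟨q₁, t₁, V₁, V₂, h₁, h₂, rfl⟩ := ih hp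
      exact ⟨q₁, t₁, _, V₂, .keep h h₁, by simpa using h₂, rfl⟩
    | bump hn hl hp =>
      obtain ⟨q₁, t₁, V₁, V₂, h₁, h₂, rfl⟩ := ih hp
      exact ⟨q₁, t₁, _, V₂, .bump hn hl h₁, by simpa using h₂, rfl⟩

theorem Pass.exists_of_append_append (h : Pass ρ A q t W q' t' (X ++ Y ++ Z)) :
    ∃ q₁ t₁ q₂ t₂ U V V', Pass ρ A q t U q₁ t₁ X ∧ Pass ρ (addCells A U) q₁ t₁ V q₂ t₂ Y ∧
      Pass ρ (addCells (addCells A U) V) q₂ t₂ V' q' t' Z ∧ W = U ++ V ++ V' := by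
  obtain ⟨q₂, t₂, W, V', hW, hZ, rfl⟩ := h.exists_of_append_right
  obtain ⟨q₁, t₁, U, V, hX, hY, rfl⟩ := hW.exists_of_append_right
  rw [addCells_append] at hZ
  exact ⟨q₁, t₁, q₂, t₂, U, V, V', hX, hY, hZ, rfl⟩

end Pass

/-! ### Growth along a word -/

section Lists

variable {α β : Type*}

theorem append_cons_inj_of_forall_lt [Preorder β] {f : α → β} {X Y X' Y' : List α} {a a' : α}
    (h : X ++ a :: Y = X' ++ a' :: Y') (ha : ∀ x ∈ X ++ Y, f x < f a)
    (ha' : ∀ x ∈ X' ++ Y', f x < f a') : X = X' ∧ a = a' ∧ Y = Y' := by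
  have hnot : a' ∉ X ++ Y := by
    intro hx
    have hmem : a ∈ a' :: (X' ++ Y') := List.perm_middle.mem_iff.1 (h ▸ List.mem_append_cons_self)
    rcases List.mem_cons.1 hmem with rfl | hx'
    · exact (ha a hx).false
    · exact (ha a' hx).asymm (ha' a hx')
  rw [List.mem_append, not_or] at hnot
  exact (List.append_cons_inj_of_notMem hnot.1 hnot.2).1 h

theorem append_cons_eq_append_append {e : β} {U V P M S : List β}
    (h : U ++ e :: V = P ++ M ++ S) :
    (∃ P₂, P = U ++ e :: P₂ ∧ V = P₂ ++ M ++ S) ∨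
      (∃ M₁ M₂, M = M₁ ++ e :: M₂ ∧ U = P ++ M₁ ∧ V = M₂ ++ S) ∨
        ∃ S₁, S = S₁ ++ e :: V ∧ U = P ++ M ++ S₁ := by
  have split {U V X Y : List β} (h : U ++ e :: V = X ++ Y) :
      (∃ X₂, X = U ++ e :: X₂ ∧ V = X₂ ++ Y) ∨ ∃ Y₁, Y = Y₁ ++ e :: V ∧ U = X ++ Y₁ := by
    rcases List.append_eq_append_iff.1 h with ⟨Z, rfl, hZ⟩ | ⟨Y₁, rfl, rfl⟩
    · rcases List.cons_eq_append_iff.1 hZ with ⟨rfl, rfl⟩ | ⟨X₂, rfl, rfl⟩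
      · exact Or.inr ⟨[], by simp⟩
      · exact Or.inl ⟨X₂, rfl, rfl⟩
    · exact Or.inr ⟨Y₁, rfl, rfl⟩
  rcases split h with ⟨X₂, hX, rfl⟩ | ⟨S₁, rfl, rfl⟩
  · rcases split hX.symm with ⟨P₂, rfl, rfl⟩ | ⟨M₁, rfl, rfl⟩
    · exact Or.inl ⟨P₂, rfl, rfl⟩
    · exact Or.inr (Or.inl ⟨M₁, X₂, rfl, rfl, rfl⟩)
  · exact Or.inr (Or.inr ⟨S₁, rfl, rfl⟩)

theorem exists_eq_append_cons_of_map {f : α → β} {W : List α} {X Y : List β} {m : β}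
    (h : W.map f = X ++ m :: Y) :
    ∃ U e V, W = U ++ e :: V ∧ U.map f = X ∧ f e = m ∧ V.map f = Y := by
  obtain ⟨U, V, rfl, rfl, hV⟩ := List.map_eq_append_iff.1 h
  obtain ⟨e, V, rfl, rfl, rfl⟩ := List.map_eq_cons_iff.1 hV
  exact ⟨U, e, V, rfl, rfl, rfl, rfl⟩

theorem exists_pair_of_map_eq {f : α → β} {W : List α} {x y : β} (h : W.map f = [x, y]) :
    ∃ a b, W = [a, b] ∧ f a = x ∧ f b = y := by
  simpa [List.map_eq_cons_iff, and_assoc, and_left_comm] using h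

theorem exists_triple_of_map_eq {f : α → β} {W : List α} {x y z : β} (h : W.map f = [x, y, z]) :
    ∃ a b c, W = [a, b, c] ∧ f a = x ∧ f b = y ∧ f c = z := by
  simpa [List.map_eq_cons_iff, and_assoc, and_left_comm] using h

theorem exists_eq_append_cons_of_nodup [LinearOrder β] {l : List β} (hl : l.Nodup)
    (hne : l ≠ []) : ∃ U m V, l = U ++ m :: V ∧ ∀ x ∈ U ++ V, x < m := by
  obtain ⟨m, hm, hmax⟩ := l.toFinset.exists_max_image id
    ((List.toFinset_nonempty_iff l).2 hne)
  obtain ⟨U, V, rfl⟩ := List.append_of_mem (List.mem_toFinset.1 hm)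
  rw [List.nodup_middle, List.nodup_cons] at hl
  refine ⟨U, m, V, rfl, fun x hx => (hmax x ?_).lt_of_ne ?_⟩
  · simp only [List.mem_append, List.mem_toFinset, List.mem_cons] at hx ⊢
    tauto
  · rintro rfl
    exact hl.1 hx

end Lists

section Growth

variable {β : Type*}

/-- The letters of a word, each with the cell by which the recording tableau grows when the letter
is inserted. A letter `x` starts to travel by rows if `sign x` holds, and by columns otherwise.
The definition removes the largest letter `m`, inserted in the cell `s`: the cells of the letters
that come before `m` do not change, the ones of the letters that come after it are those obtained
when `m` gets out of their way. -/
inductive Growth [Preorder β] (ρ : BumpRule) (sign : β → Bool) : List (β × Cell) → Prop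
  | nil : Growth ρ sign []
  | ins {U V V' : List (β × Cell)} {m : β} {s q : Cell} {t : Bool} (hm : ∀ e ∈ U ++ V, e.1 < m)
      (hg : Growth ρ sign (U ++ V)) (hs : Addable ρ.region (addCells ∅ U) s)
      (h0 : if sign m then s.1 = 0 else s.2 = 0)
      (hp : Pass ρ (addCells ∅ U) s (sign m) V q t V') : Growth ρ sign (U ++ (m, s) :: V')

variable {ρ : BumpRule} {sign : β → Bool} {A : Set Cell} {q s q' : Cell} {t t' : Bool} {m : β}
  {D U V V' W P M S : List (β × Cell)}

theorem forall_mem_fst_iff_of_perm {p : β → Prop}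
    (h : (V.map Prod.fst).Perm (W.map Prod.fst)) : (∀ e ∈ V, p e.1) ↔ ∀ e ∈ W, p e.1 := by
  have key (Z : List (β × Cell)) : (∀ e ∈ Z, p e.1) ↔ ∀ x ∈ Z.map Prod.fst, p x := by simp
  rw [key, key]
  exact forall_congr' fun x => imp_congr_left h.mem_iff

theorem Pass.forall_fst_iff {p : β → Prop} (h : Pass ρ A q t V q' t' V') :
    (∀ e ∈ V', p e.1) ↔ ∀ e ∈ V, p e.1 :=
  forall_mem_fst_iff_of_perm (.of_eq h.map_fst)

theorem isRelLowerSet_empty (P : Cell → Prop) : IsRelLowerSet ∅ P :=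
  fun _ h => h.elim

variable [Preorder β]

theorem Growth.ins_row (hsign : sign m = true) (hm : ∀ e ∈ U ++ V, e.1 < m)
    (hg : Growth ρ sign (U ++ V)) (hs : Addable ρ.region (addCells ∅ U) s) (h0 : s.1 = 0)
    (hp : Pass ρ (addCells ∅ U) s true V q t V') : Growth ρ sign (U ++ (m, s) :: V') :=
  .ins hm hg hs (by simpa only [hsign, if_true]) (by rwa [hsign])

theorem Growth.isPath (h : Growth ρ sign W) : IsPath ρ.region ∅ W := by
  induction h with
  | nil => trivial
  | ins hm hg hs h0 hp ih =>
    rw [isPath_append] at ih ⊢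
    exact ⟨ih.1, hs, (hp.isPath hs ih.2).2.1⟩

theorem Growth.isRelLowerSet (h : Growth ρ sign W) : IsRelLowerSet (addCells ∅ W) ρ.region :=
  h.isPath.isRelLowerSet (isRelLowerSet_empty _)

theorem Growth.erase_max (h : Growth ρ sign (U ++ (m, s) :: V'))
    (hm : ∀ e ∈ U ++ V', e.1 < m) :
    ∃ V q t, Growth ρ sign (U ++ V) ∧ Addable ρ.region (addCells ∅ U) s ∧
      (if sign m then s.1 = 0 else s.2 = 0) ∧ Pass ρ (addCells ∅ U) s (sign m) V q t V' := by
  generalize hW : U ++ (m, s) :: V' = W at h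
  cases h with
  | nil => simp at hW
  | @ins U₁ V V₁' m₁ s₁ q t hm₁ hg hs h0 hp =>
    have hm₁' : ∀ e ∈ U₁ ++ V₁', e.1 < m₁ := by
      rw [List.forall_mem_append] at hm₁ ⊢
      exact ⟨hm₁.1, (hp.forall_fst_iff (p := (· < m₁))).2 hm₁.2⟩
    obtain ⟨rfl, heq, rfl⟩ := append_cons_inj_of_forall_lt (f := Prod.fst) hW hm hm₁'
    obtain ⟨rfl, rfl⟩ := Prod.mk.inj heq
    exact ⟨V, q, t, hg, hs, h0, hp⟩

theorem Growth.unique (h : Growth ρ sign W) (h' : Growth ρ sign D)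
    (hD : D.map Prod.fst = W.map Prod.fst) : D = W := by
  induction h generalizing D with
  | nil => simpa using hD
  | @ins U V V' m s q t hm _ hs h0 hp ih =>
    rw [List.map_append, List.map_cons, hp.map_fst] at hD
    obtain ⟨U₂, ⟨m₂, s₂⟩, V₂', rfl, hU, hm₂, hV'⟩ := exists_eq_append_cons_of_map hD
    obtain rfl : m = m₂ := hm₂.symm
    have hm₂ : ∀ e ∈ U₂ ++ V₂', e.1 < m := by
      rw [← List.forall_mem_map (f := Prod.fst) (P := (· < m)), List.map_append, hU, hV',
        ← List.map_append, List.forall_mem_map]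
      exact hm
    obtain ⟨V₂, q₂, t₂, hg₂, hs₂, h0₂, hp₂⟩ := h'.erase_max hm₂
    obtain ⟨rfl, rfl⟩ := List.append_inj (ih hg₂ (by simp [hU, ← hV', hp₂.map_fst]))
      (by simpa using congrArg List.length hU)
    obtain rfl : s₂ = s := by
      split_ifs at h0 h0₂ with hsign
      · exact hs₂.eq_of_fst_eq hs (h0₂.trans h0.symm)
      · exact hs₂.eq_of_snd_eq hs (h0₂.trans h0.symm)
    rw [(hp.unique hp₂).2.2]

theorem Growth.nodup (h : Growth ρ sign W) : (W.map Prod.fst).Nodup := by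
  induction h with
  | nil => simp
  | @ins U V V' m s q t hm _ _ _ hp ih =>
    rw [List.map_append, List.map_cons, hp.map_fst, List.nodup_middle, ← List.map_append]
    refine List.nodup_cons.2 ⟨fun hmem => ?_, ih⟩
    obtain ⟨e, he, rfl⟩ := List.mem_map.1 hmem
    exact (hm e he).false

theorem Growth.isPath_mid (h : Growth ρ sign (P ++ M ++ S)) :
    IsPath ρ.region (addCells ∅ P) M :=
  (isPath_append.1 (isPath_append.1 h.isPath).1).2

end Growth

/-! ### Growth of Young diagrams -/

section Young

variable {β : Type*} {A : Set Cell} {p p' q q' a b c a' : Cell} {t t' : Bool} {r : ℕ}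
  {R : Cell → Prop} {M M' U V V' W : List (β × Cell)}

theorem young_region (p : Cell) : BumpRule.young.region p :=
  trivial

theorem Pass.turn_eq (h : Pass .young A q t V q' t' V') : t' = t := by
  induction h with
  | nil => rfl
  | keep _ _ ih => exact ih
  | bump _ _ _ ih => exact ih

theorem Addable.exists_young_nextLine (hq : Addable BumpRule.young.region A q) :
    ∃ n, NextLine t q n ∧ Addable BumpRule.young.region (insert q A) n := by
  cases t
  · obtain ⟨n, hn, hl⟩ := hq.exists_next_col (young_region _)
    exact ⟨n, hl, hn⟩
  · obtain ⟨n, hn, hl⟩ := hq.exists_next_row (young_region _)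
    exact ⟨n, hl, hn⟩

theorem exists_pass (hq : Addable BumpRule.young.region A q)
    (hV : IsPath BumpRule.young.region A V) : ∃ q' V', Pass .young A q true V q' true V' := by
  obtain ⟨q', t', V', hp⟩ := exists_pass_of_nextLine (fun _ _ _ h => h.exists_young_nextLine) hq hV
  obtain rfl := hp.turn_eq
  exact ⟨q', V', hp⟩

/-! #### Elementary dual equivalence -/

/-- The rows of the cells of a path. -/
def rows (W : List (β × Cell)) : List ℕ := W.map fun e => e.2.1

/-- The effect of `Pass` on the rows of the cells, for a letter that travels by rows. -/
def rowPass : ℕ → List ℕ → ℕ × List ℕ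
  | q, [] => (q, [])
  | q, r :: rs =>
    if r = q then ((rowPass (q + 1) rs).1, (q + 1) :: (rowPass (q + 1) rs).2)
    else ((rowPass q rs).1, r :: (rowPass q rs).2)

theorem Pass.rowPass_eq (h : Pass .young A q true V q' t' V')
    (hq : Addable BumpRule.young.region A q) (hV : IsPath BumpRule.young.region A V) :
    rowPass q.1 (rows V) = (q'.1, rows V') := by
  generalize ht : true = t at h
  induction h with
  | nil => rfl
  | keep h _ ih =>
    have ih := ih (hV.1.addable_insert hq h) hV.2 ht
    have hne : _ ≠ _ := fun he => h (hV.1.eq_of_fst_eq hq he)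
    simp only [rows, List.map_cons, rowPass, hne, if_false] at ih ⊢
    rw [ih]
  | bump hn hl _ ih =>
    subst ht
    have ih := ih hn hV.2 rfl
    rw [show _ = _ from hl] at ih
    simp only [rows, List.map_cons, rowPass, if_true, show _ = _ from hl] at ih ⊢
    rw [ih]

/-- Elementary dual equivalence of two paths with three cells, in terms of the rows of the cells:
the paths differ by the order of two cells next to each other, and the third cell lies between
them if the cells are read by rows from bottom to top. -/
inductive DualEquiv : List ℕ → List ℕ → Prop
  | swap_right {a b c : ℕ} (h : b ≤ a ∧ a < c ∨ c ≤ a ∧ a < b) : DualEquiv [a, b, c] [a, c, b]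
  | swap_left {a b c : ℕ} (h : a < c ∧ c ≤ b ∨ b < c ∧ c ≤ a) : DualEquiv [a, b, c] [b, a, c]

theorem DualEquiv.symm {x y : List ℕ} (h : DualEquiv x y) : DualEquiv y x := by
  cases h with
  | swap_right h => exact .swap_right h.symm
  | swap_left h => exact .swap_left h.symm

theorem DualEquiv.rowPass {x y : List ℕ} (h : DualEquiv x y) (q : ℕ) :
    (rowPass q x).1 = (rowPass q y).1 ∧ DualEquiv (rowPass q x).2 (rowPass q y).2 := by
  cases h with
  | swap_right h =>
    simp only [ShiftedInsertion.rowPass]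
    split_ifs <;> first | omega | exact ⟨by omega, .swap_right (by omega)⟩
  | swap_left h =>
    simp only [ShiftedInsertion.rowPass]
    split_ifs <;> subst_vars <;>
      first
      | omega
      | exact ⟨by omega, .swap_left (by omega)⟩
      | exact ⟨by omega, .swap_right (by omega)⟩

theorem Addable.eq_of_addable_insert (ha : Addable R A a) (ha' : Addable R (insert b A) a')
    (hrow : a.1 = a'.1) (hne : a.1 ≠ b.1) : a = a' := by
  rcases le_total a.2 a'.2 with hcol | hcol
  · refine (show a ≤ a' from ⟨hrow.le, hcol⟩).eq_or_lt.resolve_right fun hlt => ?_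
    rcases ha'.mem_of_lt ha.prop hlt with rfl | hmem
    · exact hne rfl
    · exact ha.notMem hmem
  · refine ((show a' ≤ a from ⟨hrow.ge, hcol⟩).eq_or_lt.resolve_right fun hlt => ?_).symm
    exact ha'.notMem (Or.inr (ha.mem_of_lt ha'.prop hlt))

theorem DualEquiv.exists_cells (h : DualEquiv (rows M) (rows M')) (hM : IsPath R A M)
    (hM' : IsPath R A M') :
    (∃ a b c, M.map Prod.snd = [a, b, c] ∧ M'.map Prod.snd = [a, c, b] ∧
      (b.1 ≤ a.1 ∧ a.1 < c.1 ∨ c.1 ≤ a.1 ∧ a.1 < b.1)) ∨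
    ∃ a b c, M.map Prod.snd = [a, b, c] ∧ M'.map Prod.snd = [b, a, c] ∧
      (a.1 < c.1 ∧ c.1 ≤ b.1 ∨ b.1 < c.1 ∧ c.1 ≤ a.1) := by
  generalize hx : rows M = x at h
  generalize hy : rows M' = y at h
  rcases h with @⟨r₁, r₂, r₃, h⟩ | @⟨r₁, r₂, r₃, h⟩ <;>
    obtain ⟨⟨x, a⟩, ⟨y, b⟩, ⟨z, c⟩, rfl, rfl, rfl, rfl⟩ := exists_triple_of_map_eq hx <;>
    obtain ⟨⟨x', a'⟩, ⟨y', b'⟩, ⟨z', c'⟩, rfl, h₁, h₂, h₃⟩ := exists_triple_of_map_eq hy <;>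
    obtain ⟨ha, hb, hc, -⟩ := hM <;> obtain ⟨ha', hb', hc', -⟩ := hM' <;>
    dsimp only at h ha hb hc ha' hb' hc' h₁ h₂ h₃
  · obtain rfl := ha'.eq_of_fst_eq ha h₁
    obtain rfl := hb.eq_of_addable_insert hc' h₃.symm (by lia)
    obtain rfl := hb'.eq_of_addable_insert hc h₂ (by lia)
    exact Or.inl ⟨_, _, _, rfl, rfl, h⟩
  · obtain rfl := ha.eq_of_addable_insert hb' h₂.symm (by lia)
    obtain rfl := ha'.eq_of_addable_insert hb h₁ (by lia)
    rw [Set.insert_comm] at hc'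
    obtain rfl := hc'.eq_of_fst_eq hc h₃
    exact Or.inr ⟨_, _, _, rfl, rfl, h⟩

theorem DualEquiv.addCells_eq (h : DualEquiv (rows M) (rows M')) (hM : IsPath R A M)
    (hM' : IsPath R A M') : addCells A M = addCells A M' := by
  rcases h.exists_cells hM hM' with ⟨a, b, c, h₁, h₂, -⟩ | ⟨a, b, c, h₁, h₂, -⟩ <;> ext p <;>
    simp only [addCells, h₁, h₂, Set.mem_union, Set.mem_ofPred_eq, List.mem_cons] <;> tauto

theorem DualEquiv.exists_pass (h : DualEquiv (rows M) (rows M'))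
    (hM : IsPath BumpRule.young.region A M) (hM' : IsPath BumpRule.young.region A M')
    (hq : Addable BumpRule.young.region A q) (hp : Pass .young A q true M q' true V) :
    ∃ V', Pass .young A q true M' q' true V' ∧ DualEquiv (rows V) (rows V') := by
  obtain ⟨q₁, V', hp'⟩ := ShiftedInsertion.exists_pass hq hM'
  obtain ⟨hfst, hsnd⟩ := h.rowPass q.1
  rw [hp.rowPass_eq hq hM, hp'.rowPass_eq hq hM'] at hfst hsnd
  have heq := (hp.isPath hq hM).1
  rw [h.addCells_eq hM hM'] at heq
  obtain rfl := (hp'.isPath hq hM').1.eq_of_fst_eq heq hfst.symm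
  exact ⟨V', hp', hsnd⟩

theorem DualEquiv.snd (h : DualEquiv (rows M) (rows M'))
    (hM : IsPath BumpRule.young.region A M) (hM' : IsPath BumpRule.young.region A M') :
    DualEquiv (M.map fun e => e.2.2) (M'.map fun e => e.2.2) := by
  rcases h.exists_cells hM hM' with ⟨a, b, c, h₁, h₂, h⟩ | ⟨a, b, c, h₁, h₂, h⟩ <;>
    obtain ⟨⟨x, _⟩, ⟨y, _⟩, ⟨z, _⟩, rfl, rfl, rfl, rfl⟩ := exists_triple_of_map_eq h₁ <;>
    obtain ⟨⟨x', _⟩, ⟨y', _⟩, ⟨z', _⟩, rfl, rfl, rfl, rfl⟩ := exists_triple_of_map_eq h₂ <;>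
    obtain ⟨ha, hb, hc, -⟩ := hM <;> obtain ⟨ha', hb', hc', -⟩ := hM' <;>
    have h₁ := ha.fst_lt_iff hb (young_region _) <;>
    have h₂ := hb.fst_lt_iff hc (young_region _) <;>
    have h₁' := ha'.fst_lt_iff hb' (young_region _) <;>
    have h₂' := hb'.fst_lt_iff hc' (young_region _)
  · exact .swap_right (by lia)
  · exact .swap_left (by lia)

end Young

/-! #### Transposition -/

section Transpose

variable {β : Type*} {A : Set Cell} {q q' : Cell} {t t' : Bool} {sign : β → Bool}
  {M M' U V V' W : List (β × Cell)}

/-- The labelled cells of the transposed diagram. -/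
def transposePath (W : List (β × Cell)) : List (β × Cell) := W.map fun e => (e.1, e.2.swap)

@[simp] theorem transposePath_append (U V : List (β × Cell)) :
    transposePath (U ++ V) = transposePath U ++ transposePath V :=
  List.map_append

@[simp] theorem transposePath_cons (e : β × Cell) (W : List (β × Cell)) :
    transposePath (e :: W) = (e.1, e.2.swap) :: transposePath W :=
  rfl

@[simp] theorem map_fst_transposePath (W : List (β × Cell)) :
    (transposePath W).map Prod.fst = W.map Prod.fst := by
  simp [transposePath]

@[simp] theorem transposePath_transposePath (W : List (β × Cell)) :
    transposePath (transposePath W) = W := by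
  simp [transposePath, Function.comp_def]

theorem forall_mem_transposePath {p : β → Prop} :
    (∀ e ∈ transposePath W, p e.1) ↔ ∀ e ∈ W, p e.1 := by
  simp only [transposePath, List.forall_mem_map]

theorem swap_preimage_insert (A : Set Cell) (q : Cell) :
    Prod.swap ⁻¹' (insert q A) = insert q.swap (Prod.swap ⁻¹' A) := by
  ext p
  simp [Prod.swap_eq_iff_eq_swap]

theorem addCells_transposePath (A : Set Cell) (W : List (β × Cell)) :
    addCells (Prod.swap ⁻¹' A) (transposePath W) = Prod.swap ⁻¹' addCells A W := by
  induction W generalizing A with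
  | nil => simp [transposePath]
  | cons e W ih => simp [← ih, swap_preimage_insert]

theorem isRelLowerSet_young_swap (h : IsRelLowerSet A BumpRule.young.region) :
    IsRelLowerSet (Prod.swap ⁻¹' A) BumpRule.young.region :=
  fun _ hp => ⟨young_region _, fun _ hle _ => (h hp).2 (Prod.swap_le_swap.2 hle) (young_region _)⟩

theorem Addable.swap (h : Addable BumpRule.young.region A q) :
    Addable BumpRule.young.region (Prod.swap ⁻¹' A) q.swap where
  isRelLowerSet := isRelLowerSet_young_swap h.isRelLowerSet
  notMem := by simpa using h.notMem
  isRelLowerSet_insert := by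
    simpa only [swap_preimage_insert] using isRelLowerSet_young_swap h.isRelLowerSet_insert

theorem nextLine_not : NextLine (!t) q.swap q'.swap ↔ NextLine t q q' := by
  cases t <;> simp [NextLine]

theorem Pass.transpose (h : Pass .young A q t V q' t' V') :
    Pass .young (Prod.swap ⁻¹' A) q.swap (!t) (transposePath V) q'.swap (!t')
      (transposePath V') := by
  induction h with
  | nil => exact .nil _ _ _
  | keep h _ ih =>
    rw [swap_preimage_insert] at ih
    exact .keep (Prod.swap_injective.ne h) ih
  | bump hn hl _ ih =>
    rw [swap_preimage_insert] at ih
    exact .bump (by simpa only [swap_preimage_insert] using hn.swap) (nextLine_not.2 hl) ih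

theorem DualEquiv.transpose (h : DualEquiv (rows M) (rows M'))
    (hM : IsPath BumpRule.young.region A M) (hM' : IsPath BumpRule.young.region A M') :
    DualEquiv (rows (transposePath M)) (rows (transposePath M')) := by
  simpa only [rows, transposePath, List.map_map, Function.comp_def,
    Prod.fst_swap] using h.snd hM hM'

theorem Growth.transpose [Preorder β] (h : Growth .young sign W) :
    Growth .young (fun x => !sign x) (transposePath W) := by
  induction h with
  | nil => exact .nil
  | @ins U V V' m s q t hm _ hs h0 hp ih =>
    have hs' := hs.swap
    have hp' := hp.transpose
    rw [← addCells_transposePath, Set.preimage_empty] at hs' hp'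
    rw [transposePath_append] at ih ⊢
    refine .ins ?_ ih hs' ?_ hp'
    · rw [← transposePath_append]
      exact (forall_mem_transposePath (p := (· < m))).2 hm
    · cases hsign : sign m <;> simpa [hsign] using h0

/-- By transposition, a statement about the growth of Young diagrams may be proved under the
assumption that the largest letter travels by rows. -/
theorem Growth.rowInduction [Preorder β]
    {motive : ∀ (sign : β → Bool) (W : List (β × Cell)), Growth .young sign W → Prop}
    (swap : ∀ {sign W} (h : Growth .young sign W),
      motive (fun x => !sign x) (transposePath W) h.transpose → motive sign W h)
    (nil : ∀ {sign}, motive sign [] .nil)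
    (row : ∀ {sign} {U V V' : List (β × Cell)} {m : β} {s q : Cell},
      sign m = true → (∀ e ∈ U ++ V, e.1 < m) → ∀ hg : Growth .young sign (U ++ V),
      Addable BumpRule.young.region (addCells ∅ U) s → s.1 = 0 →
      Pass .young (addCells ∅ U) s true V q true V' →
      motive sign (U ++ V) hg → ∀ h, motive sign (U ++ (m, s) :: V') h)
    {sign : β → Bool} {W : List (β × Cell)} (h : Growth .young sign W) : motive sign W h := by
  induction h with
  | nil => exact nil
  | @ins U V V' m s q t hm hg hs h0 hp ih =>
    obtain rfl := hp.turn_eq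
    have h := Growth.ins hm hg hs h0 hp
    suffices motive sign _ h from this
    cases hsign : sign m with
    | true =>
      rw [hsign] at hp
      exact row hsign hm hg hs (by simpa [hsign] using h0) hp ih h
    | false =>
      have hs' := hs.swap
      have hp' := hp.transpose
      have hg' := hg.transpose
      have h' := h.transpose
      have ih' := swap hg' (by simpa only [Bool.not_not, transposePath_transposePath] using ih)
      rw [← addCells_transposePath, Set.preimage_empty] at hs' hp'
      rw [hsign] at hp'
      rw [← forall_mem_transposePath (p := (· < m))] at hm
      refine swap h ?_
      simp only [transposePath_append, transposePath_cons] at hm hg' ih' h' ⊢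
      exact row (by simp [hsign]) hm hg' hs' (by simpa [hsign] using h0) hp' ih' h'

end Transpose

/-! ### Knuth relations -/

section Knuth

variable {β : Type*} {A : Set Cell} {q q' : Cell} {sign : β → Bool} {m : β} {L L' X Y : List β}
  {M N N' U V V' P S T W : List (β × Cell)}

/-- The order of signed letters: the letters with `sign` come after those without it, and the order
of the latter is reversed. -/
def SignedLT [LT β] (sign : β → Bool) (x y : β) : Prop :=
  if sign x then sign y ∧ x < y else sign y ∨ y < x

/-- The letter `z` lies strictly between `x` and `y` in the order of signed letters. -/
def Between [LT β] (sign : β → Bool) (z x y : β) : Prop :=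
  SignedLT sign x z ∧ SignedLT sign z y ∨ SignedLT sign y z ∧ SignedLT sign z x

/-- Knuth relations between words with three letters, for the order of signed letters. -/
inductive KnuthRel [LT β] (sign : β → Bool) : List β → List β → Prop
  | swap_left {x y z : β} (h : Between sign z x y) : KnuthRel sign [x, y, z] [y, x, z]
  | swap_right {x y z : β} (h : Between sign x y z) : KnuthRel sign [x, y, z] [x, z, y]

section LinearOrder

variable [LinearOrder β] {x y z : β}

theorem signedLT_not : SignedLT (fun x => !sign x) x y ↔ SignedLT sign y x := by
  unfold SignedLT
  cases hx : sign x <;> cases hy : sign y <;> simp [hx, hy]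

theorem signedLT_iff_not (h : x ≠ y) : SignedLT sign x y ↔ ¬ SignedLT sign y x := by
  unfold SignedLT
  cases sign x <;> cases sign y <;> simp [h.le_iff_lt, h.symm.le_iff_lt]

theorem SignedLT.asymm (h : SignedLT sign x y) : ¬ SignedLT sign y x := by
  refine (signedLT_iff_not ?_).1 h
  rintro rfl
  unfold SignedLT at h
  cases hx : sign x <;> simp [hx] at h

theorem signedLT_of_lt (hm : sign m = true) (h : x < m) : SignedLT sign x m := by
  unfold SignedLT
  simp [hm, h]

theorem Between.symm (h : Between sign z x y) : Between sign z y x :=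
  Or.symm h

theorem Between.signedLT_of_signedLT (h : Between sign z x y) (hzy : SignedLT sign z y) :
    SignedLT sign x z :=
  h.elim And.left fun h => absurd h.1 hzy.asymm

theorem not_between_of_signedLT (hx : SignedLT sign x m) (hy : SignedLT sign y m) :
    ¬ Between sign m x y
  | .inl h => hy.asymm h.2
  | .inr h => hx.asymm h.2

theorem between_not : Between (fun x => !sign x) z x y ↔ Between sign z x y := by
  simp only [Between, signedLT_not]
  tauto

theorem KnuthRel.not (h : KnuthRel sign L L') : KnuthRel (fun x => !sign x) L L' := by
  cases h with
  | swap_left h => exact .swap_left (between_not.2 h)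
  | swap_right h => exact .swap_right (between_not.2 h)

theorem KnuthRel.length_eq (h : KnuthRel sign L L') : L.length = 3 := by
  cases h <;> rfl

theorem KnuthRel.perm (h : KnuthRel sign L L') : L.Perm L' := by
  cases h with
  | swap_left => exact .swap _ _ _
  | swap_right => exact .cons _ (.swap _ _ _)

end LinearOrder

/-! #### Descents -/

theorem Pass.row_le_row_iff {d₁ d₂ e₁ e₂ : β × Cell}
    (h : Pass .young A q true [d₁, d₂] q' true [e₁, e₂]) (hq : Addable BumpRule.young.region A q)
    (hV : IsPath BumpRule.young.region A [d₁, d₂]) : e₂.2.1 ≤ e₁.2.1 ↔ d₂.2.1 ≤ d₁.2.1 := by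
  have hrow := h.rowPass_eq hq hV
  simp only [rows, List.map_cons, List.map_nil, rowPass] at hrow
  split_ifs at hrow <;> simp only [Prod.mk.injEq, List.cons.injEq] at hrow <;> lia

theorem Pass.row_pos {e : β × Cell} (h : Pass .young A q true V q' true (e :: V'))
    (hq : Addable BumpRule.young.region A q) (hV : IsPath BumpRule.young.region A V)
    (h0 : q.1 = 0) : 0 < e.2.1 := by
  cases h with
  | keep hne _ => exact Nat.pos_of_ne_zero fun he => hne (hV.1.eq_of_fst_eq hq (he.trans h0.symm))
  | bump _ hl _ => exact Nat.lt_of_lt_of_eq (Nat.succ_pos _) (Eq.symm hl)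

variable [LinearOrder β]

theorem Growth.isPath_right {ρ : BumpRule} (h : Growth ρ sign (U ++ V)) :
    IsPath ρ.region (addCells ∅ U) V :=
  (isPath_append.1 h.isPath).2

theorem Growth.isPath_mid_left {ρ : BumpRule} (h : Growth ρ sign (P ++ U ++ V ++ S)) :
    IsPath ρ.region (addCells ∅ P) U := by
  rw [List.append_assoc] at h
  exact h.isPath_mid

theorem Growth.ne {ρ : BumpRule} {e₁ e₂ : β × Cell} (h : Growth ρ sign (P ++ [e₁, e₂] ++ S)) :
    e₁.1 ≠ e₂.1 := by
  have hnd := h.nodup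
  rw [List.map_append, List.map_append] at hnd
  simpa using hnd.of_append_left.of_append_right

theorem Growth.signedLT_iff {e₁ e₂ : β × Cell}
    (h : Growth .young sign (P ++ [e₁, e₂] ++ S)) : SignedLT sign e₁.1 e₂.1 ↔ e₂.2.1 ≤ e₁.2.1 := by
  generalize hW : P ++ [e₁, e₂] ++ S = W at h
  induction h using Growth.rowInduction generalizing P S e₁ e₂ with
  | swap h ih =>
    subst hW
    have hrow := h.isPath_mid.1.fst_lt_iff h.isPath_mid.2.1 (young_region _)
    have ih := ih (P := transposePath P) (e₁ := (e₁.1, e₁.2.swap)) (e₂ := (e₂.1, e₂.2.swap))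
      (S := transposePath S) (by simp [transposePath])
    rw [signedLT_not, Prod.fst_swap, Prod.fst_swap, ← hrow] at ih
    rw [signedLT_iff_not h.ne, ih, not_lt]
  | nil => simp at hW
  | @row sign U V V' m s q hsign hm hg hs h0 hp ih h =>
    rcases append_cons_eq_append_append hW.symm with
      ⟨P₂, rfl, rfl⟩ | ⟨M₁, M₂, hM, rfl, rfl⟩ | ⟨S₁, rfl, rfl⟩
    · obtain ⟨q₁, t₁, q₂, t₂, V₁, M, V₂, hp₁, hp₂, hp₃, rfl⟩ := hp.exists_of_append_append
      obtain rfl := hp₁.turn_eq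
      obtain rfl := hp₂.turn_eq
      obtain ⟨e₁', e₂', rfl, h₁, h₂⟩ := exists_pair_of_map_eq hp₂.map_fst.symm
      simp only [← List.append_assoc] at hg ih
      have hq := (hp₁.isPath hs hg.isPath_mid_left).1
      rw [← h₁, ← h₂, ih rfl, hp₂.row_le_row_iff hq (by simpa using hg.isPath_mid)]
    · rcases List.append_eq_cons_iff.1 hM.symm with ⟨rfl, he⟩ | ⟨M₁, rfl, he⟩
      · obtain ⟨rfl, rfl⟩ := List.cons.inj he
        have hlt : e₂.1 < m :=
          (hp.forall_fst_iff (p := (· < m))).2 (fun e he => hm e (by simp [he])) e₂ (by simp)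
        have hpos := hp.row_pos hs hg.isPath_right h0
        exact iff_of_false (signedLT_of_lt hsign hlt).asymm (by lia)
      · obtain ⟨rfl, rfl, rfl⟩ : M₁ = [] ∧ (m, s) = e₂ ∧ M₂ = [] := by
          simpa [List.cons_eq_append_iff] using he
        exact iff_of_true (signedLT_of_lt hsign (hm e₁ (by simp))) (by lia)
    · exact ih (P := P) (S := S₁ ++ V) (by simp)

/-! #### Knuth relations and dual equivalence -/

theorem dualEquiv_rowPass_zero {r₁ r₂ : ℕ} (h : r₂ ≤ r₁) :
    (rowPass 0 [r₁, r₂]).1 = (rowPass 0 [r₂]).1 ∧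
      DualEquiv (r₁ :: 0 :: (rowPass 0 [r₂]).2) (0 :: (rowPass 0 [r₁, r₂]).2) := by
  rcases r₁.eq_zero_or_pos with rfl | hr
  · obtain rfl := Nat.le_zero.1 h
    exact ⟨rfl, .swap_right (by lia)⟩
  · simp only [rowPass, hr.ne', if_false]
    split_ifs <;> exact ⟨trivial, .swap_left (by lia)⟩

/-- The words `P ++ L ++ T` and `P ++ L' ++ T` have the same path of cells, except that the cells
of `L` and `L'` form dual equivalent paths. Here the prefix `P` is given with its cells. -/
def DualWindows (sign : β → Bool) (P : List (β × Cell)) (L L' T : List β) : Prop :=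
  ∃ M M' S, M.map Prod.fst = L ∧ M'.map Prod.fst = L' ∧ S.map Prod.fst = T ∧
    Growth .young sign (P ++ M ++ S) ∧ Growth .young sign (P ++ M' ++ S) ∧
      DualEquiv (rows M) (rows M')

theorem DualWindows.symm {T : List β} (h : DualWindows sign P L L' T) :
    DualWindows sign P L' L T := by
  obtain ⟨M, M', S, hM, hM', hS, hg, hg', hd⟩ := h
  exact ⟨M', M, S, hM', hM, hS, hg', hg, hd.symm⟩

theorem DualWindows.exists_of_growth
    (hd : DualWindows sign P (M.map Prod.fst) L (S.map Prod.fst))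
    (h : Growth .young sign (P ++ M ++ S)) :
    ∃ M', M'.map Prod.fst = L ∧ Growth .young sign (P ++ M' ++ S) ∧
      DualEquiv (rows M) (rows M') := by
  obtain ⟨M₁, M', S₁, hM, hM', hS, hg, hg', hd⟩ := hd
  have heq := h.unique hg (by simp [hM, hS])
  obtain ⟨hPM, rfl⟩ := List.append_inj' heq (by simpa using congrArg List.length hS)
  obtain rfl := List.append_cancel_left hPM
  exact ⟨M', hM', hg', hd⟩

variable {d₁ d₂ : β × Cell}

theorem Growth.dualWindows_of_ascent (h : Growth .young sign (P ++ [d₁, d₂] ++ T))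
    (hm : ∀ e ∈ P ++ [d₁, d₂] ++ T, e.1 < m) (hsign : sign m = true)
    (hlt : SignedLT sign d₁.1 d₂.1) :
    DualWindows sign P [d₁.1, m, d₂.1] [m, d₁.1, d₂.1] (T.map Prod.fst) := by
  have hd := h.isPath_mid
  obtain ⟨s₀, hs₀, h₀⟩ := exists_addable_row_zero hd.1.isRelLowerSet (fun _ => trivial)
    (finite_addCells_empty P)
  obtain ⟨s₁, hs₁, h₁⟩ := exists_addable_row_zero hd.2.1.isRelLowerSet (fun _ => trivial)
    ((finite_addCells_empty P).insert d₁.2)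
  obtain ⟨q, M₀, hp₀⟩ := exists_pass hs₀ hd
  obtain ⟨q₁, M₁, hp₁⟩ := exists_pass hs₁ hd.2
  have hq := (hp₀.isPath hs₀ hd).1
  have hq₁ := (hp₁.isPath hs₁ hd.2).1
  obtain ⟨hfst, hdual⟩ := dualEquiv_rowPass_zero (h.signedLT_iff.1 hlt)
  have hr₀ : rowPass 0 [d₁.2.1, d₂.2.1] = (q.1, rows M₀) := h₀ ▸ hp₀.rowPass_eq hs₀ hd
  have hr₁ : rowPass 0 [d₂.2.1] = (q₁.1, rows M₁) := h₁ ▸ hp₁.rowPass_eq hs₁ hd.2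
  rw [hr₀, hr₁] at hfst hdual
  obtain rfl : q = q₁ := hq.eq_of_fst_eq (by simpa using hq₁) hfst
  obtain ⟨q', S, hp⟩ := exists_pass hq (V := T) (by simpa using h.isPath_right)
  refine ⟨d₁ :: (m, s₁) :: M₁, (m, s₀) :: M₀, S, by simp [hp₁.map_fst], by simp [hp₀.map_fst],
    hp.map_fst, ?_, ?_, by simpa [rows, h₀, h₁] using hdual⟩
  · have hp' : Pass .young (addCells ∅ (P ++ [d₁])) s₁ true ([d₂] ++ T) q' true (M₁ ++ S) := by
      simpa using hp₁.append (by simpa using hp)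
    simpa using Growth.ins_row hsign (by simpa using hm) (by simpa using h) (by simpa using hs₁)
      h₁ hp'
  · simpa using Growth.ins_row (U := P) (V := [d₁, d₂] ++ T) hsign (by simpa using hm)
      (by simpa using h) hs₀ h₀ (hp₀.append hp)

theorem Growth.dualWindows_of_descent (h : Growth .young sign (P ++ [d₁, d₂] ++ T))
    (hm : ∀ e ∈ P ++ [d₁, d₂] ++ T, e.1 < m) (hsign : sign m = true)
    (hlt : SignedLT sign d₂.1 d₁.1) :
    DualWindows sign P [d₁.1, m, d₂.1] [d₁.1, d₂.1, m] (T.map Prod.fst) := by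
  have hd := h.isPath_mid
  have hrow := mt h.signedLT_iff.2 hlt.asymm
  obtain ⟨s, hs, h₀⟩ := exists_addable_row_zero hd.2.1.isRelLowerSet (fun _ => trivial)
    ((finite_addCells_empty P).insert d₁.2)
  have hne : d₂.2 ≠ s := by
    rintro rfl
    lia
  have hs' : Addable BumpRule.young.region (addCells ∅ (P ++ [d₁, d₂])) s := by
    simpa using hd.2.1.addable_insert hs hne
  obtain ⟨q', S, hp⟩ := exists_pass hs' h.isPath_right
  refine ⟨[d₁, (m, s), d₂], [d₁, d₂, (m, s)], S, rfl, rfl, hp.map_fst, ?_, ?_,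
    .swap_right (by lia)⟩
  · have hp' : Pass .young (addCells ∅ (P ++ [d₁])) s true (d₂ :: T) q' true (d₂ :: S) :=
      .keep hne (by simpa using hp)
    simpa using Growth.ins_row hsign (by simpa using hm) (by simpa using h) (by simpa using hs)
      h₀ hp'
  · simpa using Growth.ins_row hsign hm h hs' h₀ hp

theorem Growth.dualWindows_of_knuthRel (h : Growth .young sign (P ++ N ++ T))
    (hm : ∀ e ∈ P ++ N ++ T, e.1 < m) (hsign : sign m = true) (hN : N.map Prod.fst = X ++ Y)
    (hk : KnuthRel sign (X ++ m :: Y) L) :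
    DualWindows sign P (X ++ m :: Y) L (T.map Prod.fst) := by
  have hlen : N.length = 2 := by
    have h₁ := congrArg List.length hN
    have h₂ := hk.length_eq
    simp only [List.length_map, List.length_append, List.length_cons] at h₁ h₂
    lia
  obtain ⟨d₁, d₂, rfl⟩ := List.length_eq_two.1 hlen
  have h₁ : SignedLT sign d₁.1 m := signedLT_of_lt hsign (hm d₁ (by simp))
  have h₂ : SignedLT sign d₂.1 m := signedLT_of_lt hsign (hm d₂ (by simp))
  rcases List.append_eq_cons_iff.1 hN.symm with ⟨rfl, rfl⟩ | ⟨X, rfl, hN⟩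
  · cases hk with
    | swap_left hb =>
      exact (h.dualWindows_of_ascent hm hsign (hb.symm.signedLT_of_signedLT h₂)).symm
    | swap_right hb => exact absurd hb (not_between_of_signedLT h₁ h₂)
  rcases List.append_eq_singleton_iff.1 (List.cons.inj hN).2.symm with ⟨rfl, rfl⟩ | ⟨rfl, rfl⟩
  · cases hk with
    | swap_left hb => exact h.dualWindows_of_ascent hm hsign (hb.signedLT_of_signedLT h₂)
    | swap_right hb => exact h.dualWindows_of_descent hm hsign (hb.symm.signedLT_of_signedLT h₁)
  · cases hk with
    | swap_left hb => exact absurd hb (not_between_of_signedLT h₁ h₂)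
    | swap_right hb =>
      exact (h.dualWindows_of_descent hm hsign (hb.signedLT_of_signedLT h₁)).symm

theorem Growth.exists_of_knuthRel_of_max {U V : List (β × Cell)} {s : Cell}
    (h : Growth .young sign (P ++ (U ++ (m, s) :: V) ++ S))
    (hm : ∀ e ∈ (P ++ U) ++ (V ++ S), e.1 < m) (hsign : sign m = true)
    (hk : KnuthRel sign ((U ++ (m, s) :: V).map Prod.fst) L) :
    ∃ M', M'.map Prod.fst = L ∧ Growth .young sign (P ++ M' ++ S) ∧
      DualEquiv (rows (U ++ (m, s) :: V)) (rows M') := by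
  obtain ⟨W, q, t, hg, -, -, hp⟩ := Growth.erase_max (by simpa using h) hm
  have hm' : ∀ e ∈ (P ++ U) ++ W, e.1 < m := by
    rw [List.forall_mem_append] at hm ⊢
    exact ⟨hm.1, (hp.forall_fst_iff (p := (· < m))).1 hm.2⟩
  obtain ⟨q₁, t₁, V₁, V₂, hp₁, hp₂, rfl⟩ := hp.exists_of_append_right
  rw [← List.append_assoc, List.append_assoc P] at hm' hg
  refine DualWindows.exists_of_growth ?_ h
  rw [hp₂.map_fst]
  simpa using hg.dualWindows_of_knuthRel (X := U.map Prod.fst) (Y := V.map Prod.fst) hm' hsign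
    (by simp [hp₁.map_fst]) (by simpa using hk)

theorem Growth.exists_of_dualEquiv_of_pass {X V : List (β × Cell)} {s : Cell}
    (hsign : sign m = true) (hm : ∀ e ∈ P ++ V, e.1 < m) (hg : Growth .young sign (P ++ V))
    (hs : Addable BumpRule.young.region (addCells ∅ P) s) (h0 : s.1 = 0)
    (hp : Pass .young (addCells ∅ P) s true V q true (X ++ M ++ S))
    (hperm : (M.map Prod.fst).Perm L)
    (hdual : ∀ P' N S', P' ++ N ++ S' = P ++ V → N.map Prod.fst = M.map Prod.fst →
      ∃ N', N'.map Prod.fst = L ∧ Growth .young sign (P' ++ N' ++ S') ∧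
        DualEquiv (rows N) (rows N')) :
    ∃ M', M'.map Prod.fst = L ∧ Growth .young sign (P ++ (m, s) :: X ++ M' ++ S) ∧
      DualEquiv (rows M) (rows M') := by
  obtain ⟨q₁, t₁, q₂, t₂, V₁, N, V₂, hp₁, hp₂, hp₃, rfl⟩ := hp.exists_of_append_append
  obtain rfl := hp₁.turn_eq
  obtain rfl := hp₂.turn_eq
  obtain ⟨N', hN', hg', hd⟩ := hdual (P ++ V₁) N V₂ (by simp) hp₂.map_fst.symm
  simp only [← List.append_assoc] at hg hm
  have hN := hg.isPath_mid
  have hN₁ := hg'.isPath_mid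
  rw [addCells_append] at hN hN₁
  obtain ⟨M', hp₂', hd'⟩ := hd.exists_pass hN hN₁ (hp₁.isPath hs hg.isPath_mid_left).1 hp₂
  rw [hd.addCells_eq hN hN₁] at hp₃
  have hp' := (hp₁.append hp₂').append (addCells_append _ V₁ N' ▸ hp₃)
  refine ⟨M', by rw [hp₂'.map_fst, hN'], ?_, hd'⟩
  rw [hp₂.map_fst, ← hN'] at hperm
  simp only [List.forall_mem_append, and_assoc,
    forall_mem_fst_iff_of_perm (p := (· < m)) hperm] at hm
  simpa using Growth.ins_row hsign (by simpa only [List.forall_mem_append, and_assoc] using hm)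
    (by simpa using hg') hs h0 hp'

theorem Growth.exists_of_knuthRel (h : Growth .young sign (P ++ M ++ S))
    (hk : KnuthRel sign (M.map Prod.fst) L) :
    ∃ M', M'.map Prod.fst = L ∧ Growth .young sign (P ++ M' ++ S) ∧
      DualEquiv (rows M) (rows M') := by
  generalize hW : P ++ M ++ S = W at h
  induction h using Growth.rowInduction generalizing P M S L with
  | swap h ih =>
    subst hW
    obtain ⟨M', hM', hg, hd⟩ := ih (P := transposePath P) (M := transposePath M)
      (S := transposePath S) (by simpa using hk.not) (by simp)
    have hM := h.transpose
    simp only [transposePath_append] at hM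
    refine ⟨transposePath M', by simpa using hM', ?_, ?_⟩
    · simpa using hg.transpose
    · simpa using hd.transpose hM.isPath_mid hg.isPath_mid
  | nil =>
    obtain ⟨rfl, rfl, rfl⟩ : P = [] ∧ M = [] ∧ S = [] := by simpa [and_assoc] using hW
    cases hk
  | @row sign U V V' m s q hsign hm hg hs h0 hp ih h =>
    rcases append_cons_eq_append_append hW.symm with
      ⟨P₂, rfl, rfl⟩ | ⟨M₁, M₂, rfl, rfl, rfl⟩ | ⟨S₁, rfl, rfl⟩
    · exact Growth.exists_of_dualEquiv_of_pass hsign hm hg hs h0 hp hk.perm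
        fun P' N S' hV hN => ih (P := P') (M := N) (S := S') (hN ▸ hk) hV
    · rw [List.forall_mem_append, ← hp.forall_fst_iff (p := (· < m)),
        ← List.forall_mem_append] at hm
      exact Growth.exists_of_knuthRel_of_max (by simpa using h) hm hsign hk
    · obtain ⟨M', hM', hg', hd⟩ := ih (P := P) (M := M) (S := S₁ ++ V) hk (by simp)
      have hcells := hd.addCells_eq h.isPath_mid_left hg'.isPath_mid
      simp only [addCells_append, hcells] at hs hp
      simp only [List.forall_mem_append, forall_mem_fst_iff_of_perm (p := (· < m)) (hM' ▸ hk.perm)]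
        at hm
      refine ⟨M', hM', ?_, hd⟩
      simpa using Growth.ins_row (U := P ++ M' ++ S₁) hsign
        (by simpa only [List.forall_mem_append] using hm) (by simpa using hg') (by simpa using hs)
        h0 (by simpa using hp)

end Knuth

/-! ### Doubling -/

section Double

/-- The map that folds the quadrant along the main diagonal, onto the cells `c` with `c.1 ≤ c.2`.
Each of them is the image of two cells, its reflection and its right neighbour. -/
def fold (p : Cell) : Cell := if p.2 ≤ p.1 then p.swap else (p.1, p.2 - 1)

/-- The double of a shifted diagram: the diagram moved one step to the right, together with its
reflection in the main diagonal. -/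
def double (A : Set Cell) : Set Cell := fold ⁻¹' A

/-- The two cells of the double that correspond to a cell of a shifted diagram: its reflection
(`u = false`) and its right neighbour (`u = true`). -/
def doubleCell (c : Cell) (u : Bool) : Cell := if u then (c.1, c.2 + 1) else c.swap

variable {A : Set Cell} {c n p q q' : Cell} {t u u' v b : Bool} {P : Cell → Prop}

theorem fold_mono : Monotone fold := by
  rintro ⟨i, j⟩ ⟨i', j'⟩ ⟨hi, hj⟩
  simp only at hi hj
  unfold fold
  split_ifs <;> simp only [Prod.swap_prod_mk, Prod.mk_le_mk] at * <;> omega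

theorem shifted_region_fold (p : Cell) : BumpRule.shifted.region (fold p) := by
  simp only [BumpRule.shifted, fold]
  split_ifs <;> simp only [Prod.fst_swap, Prod.snd_swap] <;> omega

theorem fold_eq_iff (hc : BumpRule.shifted.region c) :
    fold p = c ↔ ∃ u, p = doubleCell c u := by
  simp only [BumpRule.shifted] at hc
  simp only [fold, doubleCell, Bool.exists_bool, Bool.false_eq_true, reduceIte, Prod.ext_iff,
    Prod.fst_swap, Prod.snd_swap]
  split_ifs <;> simp only [Prod.fst_swap, Prod.snd_swap] <;> omega

theorem fold_doubleCell (hc : BumpRule.shifted.region c) (u : Bool) : fold (doubleCell c u) = c :=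
  (fold_eq_iff hc).2 ⟨u, rfl⟩

theorem doubleCell_inj (hc : BumpRule.shifted.region c) (hn : BumpRule.shifted.region n) :
    doubleCell c u = doubleCell n v ↔ c = n ∧ u = v := by
  refine ⟨fun h => ?_, fun ⟨hcn, huv⟩ => by rw [hcn, huv]⟩
  obtain rfl : c = n := by rw [← fold_doubleCell hc u, h, fold_doubleCell hn]
  simp only [BumpRule.shifted] at hc
  refine ⟨rfl, ?_⟩
  cases u <;> cases v <;> simp [doubleCell, Prod.ext_iff] at h ⊢ <;> omega

theorem doubleCell_true_ne_false (hc : BumpRule.shifted.region c) :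
    doubleCell c true ≠ doubleCell c false := fun he => by
  simpa using ((doubleCell_inj hc hc).1 he).2

theorem double_insert (hc : BumpRule.shifted.region c) (u : Bool) :
    double (insert c A) = insert (doubleCell c u) (insert (doubleCell c !u) (double A)) := by
  ext p
  simp only [double, Set.mem_preimage, Set.mem_insert_iff, fold_eq_iff hc, Bool.exists_bool]
  cases u <;> simp only [Bool.not_false, Bool.not_true] <;> tauto

theorem double_injOn : Set.InjOn double {A | IsRelLowerSet A BumpRule.shifted.region} := by
  have hsub {A B : Set Cell} (hA : IsRelLowerSet A BumpRule.shifted.region)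
      (h : double A = double B) : A ⊆ B := fun p hp => by
    have hp' : doubleCell p true ∈ double B := by
      rwa [← h, double, Set.mem_preimage, fold_doubleCell (hA.prop_of_mem hp)]
    rwa [double, Set.mem_preimage, fold_doubleCell (hA.prop_of_mem hp)] at hp'
  exact fun A hA B hB h => (hsub hA h).antisymm (hsub hB h.symm)

theorem isRelLowerSet_double (hA : IsRelLowerSet A BumpRule.shifted.region) :
    IsRelLowerSet (double A) BumpRule.young.region :=
  fun _ ha => ⟨young_region _, fun _ hb _ => hA.mem_of_le ha (fold_mono hb) (shifted_region_fold _)⟩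

theorem Addable.double (h : Addable BumpRule.shifted.region A c)
    (hu : u = false → c.1 < c.2) :
    Addable BumpRule.young.region (double A) (doubleCell c !u) ∧
      Addable BumpRule.young.region (insert (doubleCell c !u) (double A)) (doubleCell c u) := by
  have hlow := isRelLowerSet_double h.isRelLowerSet
  have hnot (v : Bool) : doubleCell c v ∉ ShiftedInsertion.double A := by
    rw [ShiftedInsertion.double, Set.mem_preimage, fold_doubleCell h.prop]
    exact h.notMem
  have hmem (v : Bool) (q : Cell) (hq : q < doubleCell c v) :
      q ∈ insert (doubleCell c !v) (ShiftedInsertion.double A) := by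
    by_cases hqc : fold q = c
    · obtain ⟨w, rfl⟩ := (fold_eq_iff h.prop).1 hqc
      obtain rfl : w = !v := by
        by_contra hwv
        obtain rfl : w = v := by simpa using hwv
        exact hq.false
      exact Or.inl rfl
    · refine Or.inr (h.mem_of_lt (shifted_region_fold q) (lt_of_le_of_ne ?_ hqc))
      simpa only [fold_doubleCell h.prop] using fold_mono hq.le
  have hfirst : Addable BumpRule.young.region (ShiftedInsertion.double A) (doubleCell c !u) := by
    refine addable_of_forall_lt hlow (young_region _) (hnot _) fun q hq _ =>
      (hmem _ q hq).resolve_left ?_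
    rintro rfl
    have := h.prop
    cases u <;> simp [doubleCell, BumpRule.shifted, Prod.lt_iff] at * <;> omega
  refine ⟨hfirst, addable_of_forall_lt hfirst.isRelLowerSet_insert (young_region _) ?_
    fun q hq _ => hmem u q hq⟩
  rintro (he | he)
  · simpa using ((doubleCell_inj h.prop h.prop).1 he).2
  · exact hnot u he

theorem Addable.of_insert (h : Addable P (insert q A) n) (hA : IsRelLowerSet A P)
    (hqn : ¬ q ≤ n) : Addable P A n :=
  addable_of_forall_lt hA h.prop (fun hn => h.notMem (Or.inr hn)) fun _ hp hPp =>
    (h.mem_of_lt hPp hp).resolve_left fun he => hqn (he ▸ hp.le)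

theorem Addable.exists_shifted_nextLine (h : Addable BumpRule.shifted.region A q)
    (hu : u = true → q.1 ≠ q.2) :
    ∃ n, NextLine u q n ∧ Addable BumpRule.shifted.region (insert q A) n := by
  have hq : q.1 ≤ q.2 := h.prop
  cases u
  · obtain ⟨n, hn, hl⟩ := h.exists_next_col (hq.trans (Nat.le_succ _))
    exact ⟨n, hl, hn⟩
  · obtain ⟨n, hn, hl⟩ := h.exists_next_row (hq.lt_of_ne (hu rfl))
    exact ⟨n, hl, hn⟩

theorem NextLine.fst_lt_snd (hl : NextLine false q n) (hq : Addable BumpRule.shifted.region A q)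
    (hn : Addable BumpRule.shifted.region (insert q A) n) : n.1 < n.2 := by
  have hqr : q.1 ≤ q.2 := hq.prop
  have hnr : n.1 ≤ n.2 := hn.prop
  obtain ⟨i, j⟩ := n
  obtain rfl : j = q.2 + 1 := hl
  refine hnr.lt_of_ne fun hij => ?_
  obtain rfl : i = q.2 + 1 := hij
  have hlt : (q.2, q.2 + 1) < (q.2 + 1, q.2 + 1) := Prod.mk_lt_mk.2 (Or.inl ⟨by omega, le_rfl⟩)
  rcases hn.mem_of_lt (q := (q.2, q.2 + 1)) (Nat.le_succ _) hlt with he | hmem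
  · have := congrArg Prod.snd he
    simp at this
  · exact hq.notMem (hq.isRelLowerSet.mem_of_le hmem
      (Prod.le_def.2 ⟨hqr, Nat.le_succ _⟩) hq.prop)

variable {β : Type*} {x : β} {V V' U W : List (β × Cell)}

/-- The double of a path: a letter is replaced by its primed version (`false`) and its unprimed
version (`true`). -/
def doublePath (W : List (β × Cell)) : List ((β ×ₗ Bool) × Cell) :=
  W.flatMap fun e => [(toLex (e.1, false), doubleCell e.2 false),
    (toLex (e.1, true), doubleCell e.2 true)]

/-- The unprimed letters of a double. -/
def isUnprimed (x : β ×ₗ Bool) : Bool := (ofLex x).2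

theorem doublePath_append (U V : List (β × Cell)) :
    doublePath (U ++ V) = doublePath U ++ doublePath V :=
  List.flatMap_append

theorem addCells_doublePath (hW : IsPath BumpRule.shifted.region A W) :
    addCells (double A) (doublePath W) = double (addCells A W) := by
  induction W generalizing A with
  | nil => simp [doublePath]
  | cons e W ih =>
    rw [addCells_cons, ← ih hW.2, double_insert hW.1.prop true]
    simp [doublePath]

theorem IsPath.doublePath (hW : IsPath BumpRule.shifted.region A W) :
    IsPath BumpRule.young.region (double A) (doublePath W) := by
  induction W generalizing A with
  | nil => trivial
  | cons e W ih =>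
    have he := hW.1.double (u := true) (by simp)
    refine ⟨he.1, he.2, ?_⟩
    have h := ih hW.2
    rwa [double_insert hW.1.prop true] at h

theorem exists_doublePass_bump_row (hq : Addable BumpRule.shifted.region A q)
    (hn : Addable BumpRule.shifted.region (insert q A) n) (hl : n.1 = q.1 + 1)
    (hd : q.1 ≠ q.2) :
    ∃ M, Pass .young (double A) (doubleCell q false) false (doublePath [(x, q)])
        (doubleCell n false) false M ∧
      Pass .young (insert (doubleCell q false) (double A)) (doubleCell q true) true M
        (doubleCell n true) true (doublePath [(x, n)]) := by
  have hne (v w : Bool) : doubleCell n v ≠ doubleCell q w := fun he =>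
    hn.notMem (Or.inl ((doubleCell_inj hn.prop hq.prop).1 he).1)
  have hq₁ := hq.double (u := true) (by simp)
  have hn₁ := hn.double (u := true) (by simp)
  simp only [double_insert hq.prop true, Bool.not_true] at hq₁ hn₁
  have hqr : q.1 ≤ q.2 := hq.prop
  have hnot : ¬ doubleCell q true ≤ doubleCell n false := by
    simp only [doubleCell, if_true, Bool.false_eq_true, if_false, Prod.le_def, Prod.fst_swap,
      Prod.snd_swap]
    omega
  refine ⟨[(_, doubleCell n false), (_, doubleCell q true)],
    .bump (hn₁.1.of_insert hq₁.1.isRelLowerSet_insert hnot) ?_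
      (.keep (hne _ _).symm (.nil _ _ _)),
    .keep (hne _ _) (.bump ?_ ?_ (.nil _ _ _))⟩
  · simpa [NextLine, BumpRule.young, doubleCell] using hl
  · rw [Set.insert_comm]
    exact hn₁.2
  · simpa [NextLine, BumpRule.young, doubleCell] using hl

theorem exists_doublePass_bump (hq : Addable BumpRule.shifted.region A q)
    (hn : Addable BumpRule.shifted.region (insert q A) n)
    (hl : NextLine (BumpRule.shifted.turn q u) q n) (hu : u = false → q.1 < q.2) :
    ∃ M, Pass .young (double A) (doubleCell q !u) false (doublePath [(x, q)])
        (doubleCell n !BumpRule.shifted.turn q u) false M ∧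
      Pass .young (insert (doubleCell q !u) (double A)) (doubleCell q u) true M
        (doubleCell n (BumpRule.shifted.turn q u)) true (doublePath [(x, n)]) := by
  have hqq := doubleCell_true_ne_false hq.prop
  have hnn := doubleCell_true_ne_false hn.prop
  have hq₁ := hq.double (u := true) (by simp)
  have hn₁ := hn.double (u := true) (by simp)
  have hn₂ (hv : n.1 < n.2) := hn.double (u := false) fun _ => hv
  simp only [double_insert hq.prop true, Bool.not_true, Bool.not_false] at hq₁ hn₁ hn₂
  cases u with
  | true =>
    by_cases hd : q.1 = q.2
    · simp only [BumpRule.shifted, hd, ne_eq, not_true_eq_false, decide_false,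
        Bool.and_false] at hl ⊢
      refine ⟨[(_, doubleCell q true), (_, doubleCell n true)],
        .bump hq₁.2 ?_ (.bump (hn₂ (hl.fst_lt_snd hq hn)).1 ?_ (.nil _ _ _)),
        .bump hn₁.1 ?_ (.keep hnn (.nil _ _ _))⟩ <;>
        simp_all [NextLine, BumpRule.young, doubleCell]
    · simp only [BumpRule.shifted, hd, ne_eq, not_false_eq_true, decide_true,
        Bool.and_true] at hl ⊢
      exact exists_doublePass_bump_row hq hn hl hd
  | false =>
    simp only [BumpRule.shifted, Bool.false_and] at hl ⊢
    have hn₂ := hn₂ (hl.fst_lt_snd hq hn)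
    refine ⟨[(_, doubleCell q false), (_, doubleCell n true)],
      .keep hqq.symm (.bump hn₂.1 ?_ (.nil _ _ _)), .bump ?_ ?_ (.keep hnn (.nil _ _ _))⟩
    · simpa [NextLine, BumpRule.young, doubleCell] using hl
    · rw [Set.insert_comm]
      exact hn₁.1
    · simpa [NextLine, BumpRule.young, doubleCell] using hl

theorem Pass.double (h : Pass .shifted A q u V q' u' V') (hq : Addable BumpRule.shifted.region A q)
    (hV : IsPath BumpRule.shifted.region A V) (hu : u = false → q.1 < q.2) :
    ∃ M, Pass .young (double A) (doubleCell q !u) false (doublePath V) (doubleCell q' !u') false M ∧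
      Pass .young (insert (doubleCell q !u) (ShiftedInsertion.double A)) (doubleCell q u) true M
        (doubleCell q' u') true (doublePath V') := by
  induction h with
  | nil => exact ⟨[], .nil _ _ _, .nil _ _ _⟩
  | @keep A q c q' u u' x V V' h _ ih =>
    obtain ⟨M, h₁, h₂⟩ := ih (hV.1.addable_insert hq h) hV.2 hu
    rw [double_insert hV.1.prop true] at h₁ h₂
    have hne (v w : Bool) : doubleCell c v ≠ doubleCell q w := fun he =>
      h ((doubleCell_inj hV.1.prop hq.prop).1 he).1
    refine ⟨(_, doubleCell c false) :: (_, doubleCell c true) :: M,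
      .keep (hne _ _) (.keep (hne _ _) h₁), .keep (hne _ _) (.keep (hne _ _) ?_)⟩
    rwa [Set.insert_comm (doubleCell c false), Set.insert_comm (doubleCell c true)]
  | @bump A q n q' u u' x V V' hn hl _ ih =>
    have hv (hv : BumpRule.shifted.turn q u = false) : n.1 < n.2 :=
      NextLine.fst_lt_snd (hv ▸ hl) hq hn
    obtain ⟨M, h₁, h₂⟩ := ih hn hV.2 hv
    obtain ⟨M₀, h₁', h₂'⟩ := exists_doublePass_bump (x := x) hq hn hl hu
    have hcells := addCells_doublePath (W := [(x, q)]) ⟨hq, trivial⟩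
    have hfill := (h₁'.isPath (hq.double hu).1 (IsPath.doublePath ⟨hq, trivial⟩)).2.2
    rw [addCells_cons, addCells_nil] at hcells
    exact ⟨M₀ ++ M, h₁'.append (by rwa [hcells]), h₂'.append (by rwa [← hfill, hcells])⟩

variable [LinearOrder β]

theorem Growth.double (h : Growth .shifted (fun _ => true) W) :
    Growth .young isUnprimed (doublePath W) := by
  induction h with
  | nil => exact .nil
  | @ins U V V' m s q u hm hg hs h0 hp ih =>
    obtain ⟨M, h₁, h₂⟩ := hp.double hs (isPath_append.1 hg.isPath).2 (by simp)
    have hU := (isPath_append.1 hg.isPath).1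
    have hs₂ := hs.double (u := true) (by simp)
    have hcells : addCells ∅ (doublePath U) = ShiftedInsertion.double (addCells ∅ U) :=
      addCells_doublePath hU
    rw [← hcells] at h₁ h₂ hs₂
    have hlt (v : Bool) : ∀ e ∈ doublePath U ++ doublePath V, e.1 < toLex (m, v) := by
      rw [← doublePath_append]
      simp only [doublePath, List.mem_flatMap, List.mem_cons, List.not_mem_nil, or_false]
      rintro _ ⟨e, he, rfl | rfl⟩ <;> exact Prod.Lex.lt_iff.2 (Or.inl (hm e he))
    rw [doublePath_append] at ih
    have hprimed := Growth.ins (hlt false) ih hs₂.1 (by simpa [isUnprimed, doubleCell] using h0)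
      (by simpa [isUnprimed] using h₁)
    have hpair : doublePath (U ++ (m, s) :: V') =
        (doublePath U ++ [(toLex (m, false), doubleCell s false)]) ++
          (toLex (m, true), doubleCell s true) :: doublePath V' := by
      simp [doublePath]
    rw [hpair]
    refine .ins_row rfl ?_ (by simpa using hprimed) (by simpa using hs₂.2) h0 (by simpa using h₂)
    have htrue := hlt true
    rw [List.forall_mem_append, ← h₁.forall_fst_iff (p := (· < toLex (m, true)))] at htrue
    simp only [List.forall_mem_append, List.forall_mem_singleton]
    exact ⟨⟨htrue.1, Prod.Lex.lt_iff.2 (Or.inr ⟨rfl, Bool.false_lt_true⟩)⟩, htrue.2⟩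

theorem exists_shifted_growth {w : List β} (hw : w.Nodup) :
    ∃ W : List (β × Cell), W.map Prod.fst = w ∧ Growth .shifted (fun _ => true) W := by
  induction hn : w.length generalizing w with
  | zero => exact ⟨[], (List.length_eq_zero_iff.1 hn).symm, .nil⟩
  | succ n ih =>
    obtain ⟨u, m, v, rfl, hm⟩ := exists_eq_append_cons_of_nodup hw (by rintro rfl; simp at hn)
    obtain ⟨W, hW, hg⟩ := ih (w := u ++ v) (hw.sublist (by simp)) (by simpa [← add_assoc] using hn)
    obtain ⟨U, V, rfl, rfl, rfl⟩ := List.map_eq_append_iff.1 hW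
    have hpath := isPath_append.1 hg.isPath
    obtain ⟨s, hs, hs0⟩ := exists_addable_row_zero (hpath.1.isRelLowerSet (isRelLowerSet_empty _))
      (fun c => c.zero_le) (finite_addCells_empty U)
    obtain ⟨q, t, V', hp⟩ := exists_pass_of_nextLine (t := true)
      (fun _ _ _ h => h.exists_shifted_nextLine fun ht =>
        of_decide_eq_true (Bool.and_eq_true_iff.1 ht).2) hs hpath.2
    refine ⟨U ++ (m, s) :: V', by simp [hp.map_fst], .ins_row rfl ?_ hg hs hs0 hp⟩
    simpa only [← List.map_append, List.forall_mem_map] using hm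

end Double

/-! ### The shifted plactic relations -/

section Plactic

variable {α β γ : Type*}

section GrowthEquiv

variable [LinearOrder β] {ρ : BumpRule} {sign : β → Bool} {w w' w'' : List β}

/-- Growth along `w` and along `w'` leads to the same diagram, in any context. -/
def GrowthEquiv (ρ : BumpRule) (sign : β → Bool) (w w' : List β) : Prop :=
  ∀ ⦃P S : List β⦄ ⦃W : List (β × Cell)⦄, W.map Prod.fst = P ++ w ++ S → Growth ρ sign W →
    ∃ W', W'.map Prod.fst = P ++ w' ++ S ∧ Growth ρ sign W' ∧ addCells ∅ W' = addCells ∅ W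

theorem GrowthEquiv.refl (w : List β) : GrowthEquiv ρ sign w w :=
  fun _ _ W hW hg => ⟨W, hW, hg, rfl⟩

theorem GrowthEquiv.trans (h : GrowthEquiv ρ sign w w') (h' : GrowthEquiv ρ sign w' w'') :
    GrowthEquiv ρ sign w w'' := fun _ _ _ hW hg => by
  obtain ⟨W', hW', hg', he⟩ := h hW hg
  obtain ⟨W'', hW'', hg'', he'⟩ := h' hW' hg'
  exact ⟨W'', hW'', hg'', he'.trans he⟩

theorem GrowthEquiv.append_left (h : GrowthEquiv ρ sign w w') (T : List β) :
    GrowthEquiv ρ sign (T ++ w) (T ++ w') := fun P S _ hW hg => by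
  simpa using h (P := P ++ T) (S := S) (by simpa using hW) hg

theorem GrowthEquiv.append_right (h : GrowthEquiv ρ sign w w') (T : List β) :
    GrowthEquiv ρ sign (w ++ T) (w' ++ T) := fun P S _ hW hg => by
  simpa using h (P := P) (S := T ++ S) (by simpa using hW) hg

theorem GrowthEquiv.cons (h : GrowthEquiv ρ sign w w') (x : β) :
    GrowthEquiv ρ sign (x :: w) (x :: w') :=
  h.append_left [x]

theorem GrowthEquiv.of_nodup (h : w.Nodup → GrowthEquiv ρ sign w w') : GrowthEquiv ρ sign w w' :=
  fun P S _ hW hg =>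
  h ((hW ▸ hg.nodup).sublist ((List.sublist_append_right P w).trans
    (List.sublist_append_left _ S))) hW hg

theorem KnuthRel.growthEquiv (h : KnuthRel sign w w') : GrowthEquiv .young sign w w' :=
  fun _ _ _ hW hg => by
  obtain ⟨V, N, rfl, hV, rfl⟩ := List.map_eq_append_iff.1 hW
  obtain ⟨P, M, rfl, rfl, rfl⟩ := List.map_eq_append_iff.1 hV
  obtain ⟨M', rfl, hg', hd⟩ := hg.exists_of_knuthRel h
  refine ⟨_, by simp, hg', ?_⟩
  simp only [addCells_append, hd.addCells_eq hg.isPath_mid hg'.isPath_mid]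

end GrowthEquiv

section KnuthMove

variable [LinearOrder γ]

/-- Apply a Knuth relation to the three letters that follow the first `i` ones, if this is
possible. -/
def knuthMove : ℕ → List γ → List γ
  | 0, x :: y :: z :: S =>
    if x < z ∧ z < y ∨ y < z ∧ z < x then y :: x :: z :: S
    else if y < x ∧ x < z ∨ z < x ∧ x < y then x :: z :: y :: S
    else x :: y :: z :: S
  | i + 1, x :: S => x :: knuthMove i S
  | _, S => S

variable [LinearOrder β] {sign : β → Bool} {g : γ → β}

theorem growthEquiv_knuthMove (hg : ∀ x y, x < y → SignedLT sign (g x) (g y)) (i : ℕ)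
    (w : List γ) : GrowthEquiv .young sign (w.map g) ((knuthMove i w).map g) := by
  have hbetween {x y z : γ} (h : x < z ∧ z < y ∨ y < z ∧ z < x) : Between sign (g z) (g x) (g y) :=
    h.imp (.imp (hg _ _) (hg _ _)) (.imp (hg _ _) (hg _ _))
  fun_induction knuthMove i w with
  | case1 x y z S h => exact (KnuthRel.swap_left (hbetween h)).growthEquiv.append_right (S.map g)
  | case2 x y z S _ h => exact (KnuthRel.swap_right (hbetween h)).growthEquiv.append_right (S.map g)
  | case4 i x S ih => exact ih.cons _
  | _ => exact .refl _

theorem growthEquiv_foldl_knuthMove (hg : ∀ x y, x < y → SignedLT sign (g x) (g y))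
    (is : List ℕ) (w : List γ) :
    GrowthEquiv .young sign (w.map g) ((is.foldl (fun v i => knuthMove i v) w).map g) := by
  induction is generalizing w with
  | nil => exact .refl _
  | cons i is ih => exact (growthEquiv_knuthMove hg i w).trans (ih _)

end KnuthMove

/-- The double of a word: a letter is replaced by its primed version (`false`) and its unprimed
version (`true`). -/
def doubleWord (w : List α) : List (α ×ₗ Bool) :=
  w.flatMap fun a => [toLex (a, false), toLex (a, true)]

theorem map_fst_doublePath (W : List (α × Cell)) :
    (doublePath W).map Prod.fst = doubleWord (W.map Prod.fst) := by
  simp [doublePath, doubleWord, List.map_flatMap, List.flatMap_map]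

variable [LinearOrder α] {a b c d : α} {w w' P S : List α} {W W' : List (α × Cell)}

/-- The order isomorphism from `{0, …, 7}` to the signed letters with values in `{a, b, c, d}`. -/
def signedLetter (a b c d : α) : Fin 8 → α ×ₗ Bool :=
  ![toLex (d, false), toLex (c, false), toLex (b, false), toLex (a, false),
    toLex (a, true), toLex (b, true), toLex (c, true), toLex (d, true)]

theorem signedLT_signedLetter (hab : a < b) (hbc : b < c) (hcd : c < d) (x y : Fin 8)
    (hxy : x < y) : SignedLT isUnprimed (signedLetter a b c d x) (signedLetter a b c d y) := by
  have hac := hab.trans hbc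
  have hbd := hbc.trans hcd
  have had := hab.trans hbd
  fin_cases x <;> fin_cases y <;>
    simp_all [SignedLT, isUnprimed, signedLetter, Prod.Lex.toLex_lt_toLex]

/-- The shifted plactic relations between words with four distinct letters. -/
inductive ShiftedPlactic : List α → List α → Prop
  | abdc {a b c d : α} (hab : a < b) (hbc : b < c) (hcd : c < d) :
      ShiftedPlactic [a, b, d, c] [a, d, b, c]
  | acdb {a b c d : α} (hab : a < b) (hbc : b < c) (hcd : c < d) :
      ShiftedPlactic [a, c, d, b] [a, c, b, d]
  | dacb {a b c d : α} (hab : a < b) (hbc : b < c) (hcd : c < d) :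
      ShiftedPlactic [d, a, c, b] [a, d, c, b]
  | badc {a b c d : α} (hab : a < b) (hbc : b < c) (hcd : c < d) :
      ShiftedPlactic [b, a, d, c] [b, d, a, c]
  | cbda {a b c d : α} (hab : a < b) (hbc : b < c) (hcd : c < d) :
      ShiftedPlactic [c, b, d, a] [c, d, b, a]
  | dbca {a b c d : α} (hab : a < b) (hbc : b < c) (hcd : c < d) :
      ShiftedPlactic [d, b, c, a] [b, d, c, a]
  | bcda {a b c d : α} (hab : a < b) (hbc : b < c) (hcd : c < d) :
      ShiftedPlactic [b, c, d, a] [b, c, a, d]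
  | cadb {a b c d : α} (hab : a < b) (hbc : b < c) (hcd : c < d) :
      ShiftedPlactic [c, a, d, b] [c, d, a, b]

theorem ShiftedPlactic.growthEquiv_doubleWord (h : ShiftedPlactic w w') :
    GrowthEquiv .young isUnprimed (doubleWord w) (doubleWord w') := by
  -- A sequence of positions that serves all eight relations, found by a search.
  have key {a b c d : α} (hab : a < b) (hbc : b < c) (hcd : c < d) (v : List (Fin 8)) :=
    growthEquiv_foldl_knuthMove (signedLT_signedLetter hab hbc hcd)
      [1, 5, 3, 1, 0, 2, 3, 5, 3, 2, 0, 4] v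
  cases h with
  | abdc hab hbc hcd => exact key hab hbc hcd [3, 4, 2, 5, 0, 7, 1, 6]
  | acdb hab hbc hcd => exact key hab hbc hcd [3, 4, 1, 6, 0, 7, 2, 5]
  | dacb hab hbc hcd => exact key hab hbc hcd [0, 7, 3, 4, 1, 6, 2, 5]
  | badc hab hbc hcd => exact key hab hbc hcd [2, 5, 3, 4, 0, 7, 1, 6]
  | cbda hab hbc hcd => exact key hab hbc hcd [1, 6, 2, 5, 0, 7, 3, 4]
  | dbca hab hbc hcd => exact key hab hbc hcd [0, 7, 2, 5, 1, 6, 3, 4]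
  | bcda hab hbc hcd => exact key hab hbc hcd [2, 5, 1, 6, 0, 7, 3, 4]
  | cadb hab hbc hcd => exact key hab hbc hcd [1, 6, 3, 4, 0, 7, 2, 5]

theorem ShiftedPlactic.addCells_eq (h : ShiftedPlactic w w')
    (hW : Growth .shifted (fun _ => true) W) (hW' : Growth .shifted (fun _ => true) W')
    (hw : W.map Prod.fst = P ++ w ++ S) (hw' : W'.map Prod.fst = P ++ w' ++ S) :
    addCells ∅ W = addCells ∅ W' := by
  have hcells {V : List (α × Cell)} (hV : Growth .shifted (fun _ => true) V) :
      addCells ∅ (doublePath V) = double (addCells ∅ V) := addCells_doublePath hV.isPath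
  have hmap {v : List α} {V : List (α × Cell)} (hv : V.map Prod.fst = P ++ v ++ S) :
      (doublePath V).map Prod.fst = doubleWord P ++ doubleWord v ++ doubleWord S := by
    simp [map_fst_doublePath, hv, doubleWord]
  obtain ⟨D, hD, hgD, he⟩ := h.growthEquiv_doubleWord (hmap hw) hW.double
  refine double_injOn hW.isRelLowerSet hW'.isRelLowerSet ?_
  rw [← hcells hW, ← hcells hW', hgD.unique hW'.double ((hmap hw').trans hD.symm), he]

theorem ShiftedPlactic.perm (h : ShiftedPlactic w w') : w.Perm w' := by
  cases h <;> grind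

theorem ShiftedPlactic.growthEquiv (h : ShiftedPlactic w w') :
    GrowthEquiv .shifted (fun _ => true) w w' := fun P S W hW hg => by
  have hnodup : (P ++ w' ++ S).Nodup :=
    ((h.perm.append_left P).append_right S).nodup_iff.1 (hW ▸ hg.nodup)
  obtain ⟨W', hW', hg'⟩ := exists_shifted_growth hnodup
  exact ⟨W', hW', hg', (h.addCells_eq hg hg' hW hW').symm⟩

end Plactic

/-! ### Mixed insertion and growth -/

section MixedInsertion

namespace Filling

section Write

variable {α : Type} {T T' : Filling α} {p q : Cell} {a b : α}

theorem ext_entry (h : ∀ p, T.entry p = T'.entry p) : T = T' := by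
  obtain ⟨s, e, hm⟩ := T
  obtain ⟨s', e', hm'⟩ := T'
  obtain rfl : e = e' := funext h
  obtain rfl : s = s' := by ext p; rw [hm, hm']
  rfl

theorem entry_write (T : Filling α) (p q : Cell) (a : α) :
    (T.write p a).entry q = if q = p then some a else T.entry q := by
  simp [write, Function.update_apply]

theorem entry_write_self (T : Filling α) (p : Cell) (a : α) : (T.write p a).entry p = some a := by
  simp [entry_write]

theorem entry_write_of_ne (T : Filling α) (h : q ≠ p) (a : α) :
    (T.write p a).entry q = T.entry q := by
  simp [entry_write, h]

theorem entry_write_eq_some :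
    (T.write p a).entry q = some b ↔ q = p ∧ a = b ∨ q ≠ p ∧ T.entry q = some b := by
  by_cases h : q = p <;> simp [entry_write, h]

theorem write_comm (T : Filling α) (h : p ≠ q) (a b : α) :
    (T.write p a).write q b = (T.write q b).write p a := by
  refine ext_entry fun x => ?_
  simp only [entry_write]
  split_ifs with h1 h2
  · exact absurd (h2.symm.trans h1) h
  all_goals rfl

theorem write_write (T : Filling α) (p : Cell) (a b : α) :
    (T.write p a).write p b = T.write p b := by
  refine ext_entry fun x => ?_
  simp only [entry_write]
  split_ifs <;> rfl

theorem coe_shape_write (T : Filling α) (p : Cell) (a : α) :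
    ((T.write p a).shape : Set Cell) = insert p (T.shape : Set Cell) := by
  simp [write]

theorem entry_eq_none : T.entry p = none ↔ p ∉ (T.shape : Set Cell) := by
  rw [Finset.mem_coe, T.mem_shape, not_not]

theorem mem_of_entry (h : T.entry p = some b) : p ∈ (T.shape : Set Cell) := by
  simp [T.mem_shape, h]

theorem exists_entry (h : p ∈ (T.shape : Set Cell)) : ∃ b, T.entry p = some b :=
  Option.ne_none_iff_exists'.1 ((T.mem_shape p).1 (Finset.mem_coe.1 h))

end Write

variable {T : Filling PLetter} {L : Line} {a b m : PLetter} {p q : Cell} {k : ℕ}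

theorem mixInsertLine_of_none (h : T.entry (T.target L a) = none) :
    T.mixInsertLine L a = T.write (T.target L a) a := by
  rw [mixInsertLine]
  split
  · rfl
  · simp_all

theorem mixInsertLine_of_some (h : T.entry (T.target L a) = some b) : T.mixInsertLine L a =
    (T.write (T.target L a) a).mixInsertLine (afterBump (T.target L a) b).1
      (afterBump (T.target L a) b).2 := by
  rw [mixInsertLine]
  split <;> simp_all

theorem lt_of_target (h : T.entry (T.target L a) = some b) : a < b :=
  Nat.find_spec (T.exists_accepts L a) b h

theorem target_eq_iff : T.target L a = L.cell k ↔
    T.Accepts a (L.cell k) ∧ ∀ j < k, ¬ T.Accepts a (L.cell j) := by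
  rw [target, L.cell_injective.eq_iff, Nat.find_eq_iff]

theorem exists_target_le (h : T.entry (L.cell k) = none) : ∃ j ≤ k, T.target L a = L.cell j :=
  ⟨_, Nat.find_min' (T.exists_accepts L a) (by simp [Accepts, h]), rfl⟩

theorem target_write (hq : T.entry q = none) (h : T.target L a = q → a < m) :
    (T.write q m).target L a = T.target L a := by
  obtain ⟨k, hk⟩ : ∃ k, T.target L a = L.cell k := ⟨_, rfl⟩
  obtain ⟨hacc, hlt⟩ := target_eq_iff.1 hk
  rw [hk] at h ⊢
  refine target_eq_iff.2 ⟨fun b hb => ?_, fun j hj hj' => hlt j hj fun b hb => hj' b ?_⟩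
  · rcases entry_write_eq_some.1 hb with ⟨hkq, rfl⟩ | ⟨-, hb⟩
    · exact h hkq
    · exact hacc b hb
  · rwa [entry_write_of_ne]
    rintro rfl
    simp [hq] at hb

/-- The largest letter `m` gets out of the way of the smaller ones: this is where `Pass` comes
from. -/
theorem mixInsertLine_write (m : PLetter) (hq : T.entry q = none) :
    ((T.mixInsertLine L a).entry q = none →
      (T.write q m).mixInsertLine L a = (T.mixInsertLine L a).write q m) ∧
    (∀ b, (T.mixInsertLine L a).entry q = some b → b < m → (T.write q m).mixInsertLine L a =
      (T.mixInsertLine L a).mixInsertLine (afterBump q m).1 (afterBump q m).2) := by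
  induction T, L, a using Filling.mixInsertLine.induct with
  | case1 T L a ha =>
    rw [mixInsertLine_of_none ha]
    by_cases h : T.target L a = q
    · subst h
      simp only [entry_write_self, reduceCtorEq, false_implies, true_and, Option.some.injEq]
      rintro _ rfl hlt
      have ht : (T.write (T.target L a) m).target L a = T.target L a :=
        target_write hq fun _ => hlt
      rw [mixInsertLine_of_some (b := m) (by rw [ht, entry_write_self]), ht, write_write]
    · have ht : (T.write q m).target L a = T.target L a := target_write hq (absurd · h)
      rw [entry_write_of_ne _ (Ne.symm h), hq]
      refine ⟨fun _ => ?_, by simp⟩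
      rw [mixInsertLine_of_none (by rw [ht, entry_write_of_ne _ h, ha]), ht,
        write_comm _ (Ne.symm h)]
  | case2 T L a b hb ih =>
    have h : T.target L a ≠ q := fun h => by simp [h, hq] at hb
    have ht : (T.write q m).target L a = T.target L a := target_write hq (absurd · h)
    rw [mixInsertLine_of_some hb,
      mixInsertLine_of_some (T := T.write q m) (b := b) (by rw [ht, entry_write_of_ne _ h, hb]),
      ht, write_comm _ (Ne.symm h)]
    exact ih (by rw [entry_write_of_ne _ (Ne.symm h), hq])

/-- No entry of `T` is greater than `m`. -/
def EntriesLE (T : Filling PLetter) (m : PLetter) : Prop :=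
  ∀ p, ∀ b ∈ T.entry p, b ≤ m

theorem EntriesLE.write (h : T.EntriesLE m) (ha : a ≤ m) : (T.write p a).EntriesLE m := by
  intro q b hb
  rcases entry_write_eq_some.1 hb with ⟨-, rfl⟩ | ⟨-, hb⟩
  · exact ha
  · exact h q b hb

theorem EntriesLE.entry_target (h : T.EntriesLE m) (L : Line) : T.entry (T.target L m) = none := by
  by_contra hne
  obtain ⟨b, hb⟩ := Option.ne_none_iff_exists'.1 hne
  exact (h _ b hb).not_gt (lt_of_target hb)

end Filling

open Filling

variable {T : Filling PLetter} {L : Line} {a b m : PLetter} {p q n : Cell} {k x : Letter} {u : Bool}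

/-- The letter `k`, primed unless `u` holds. -/
def mark (k : Letter) (u : Bool) : PLetter := toLex (k, u)

theorem isPrimed_mark : (mark k u).IsPrimed ↔ u = false := Iff.rfl

theorem unprimed_lt_mark (h : x < k) (u : Bool) : PLetter.unprimed x < mark k u :=
  Prod.Lex.lt_iff.2 (Or.inl h)

theorem lt_mark_true_iff : b < mark k true ↔ b ≤ mark k false := by
  refine Prod.Lex.lt_iff.trans (Iff.trans ?_ Prod.Lex.le_iff.symm)
  have hbool : ∀ t : Bool, t < true ↔ t ≤ false := by decide
  exact or_congr_right (and_congr_right fun _ => hbool _)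

theorem afterBump_mark (q : Cell) (k : Letter) (u : Bool) : afterBump q (mark k u) =
    (if BumpRule.shifted.turn q u then .row (q.1 + 1) else .col (q.2 + 1),
      mark k (BumpRule.shifted.turn q u)) := by
  cases u <;> by_cases h : q.1 = q.2 <;>
    simp [afterBump, BumpRule.shifted, h, mark, PLetter.primed, PLetter.base, PLetter.IsPrimed]

theorem afterBump_le (p : Cell) (b : PLetter) : (afterBump p b).2 ≤ b := by
  change (afterBump p (mark (ofLex b).1 (ofLex b).2)).2 ≤ mark (ofLex b).1 (ofLex b).2
  rw [afterBump_mark]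
  refine Prod.Lex.le_iff.2 (Or.inr ⟨rfl, ?_⟩)
  exact Bool.and_le_left _ _

theorem Filling.EntriesLE.mixInsertLine (h : T.EntriesLE m) (ha : a ≤ m) :
    (T.mixInsertLine L a).EntriesLE m := by
  induction T, L, a using Filling.mixInsertLine.induct with
  | case1 T L a hb =>
    rw [mixInsertLine_of_none hb]
    exact h.write ha
  | case2 T L a b hb ih =>
    rw [mixInsertLine_of_some hb]
    exact ih (h.write ha) ((afterBump_le _ b).trans (h _ b hb))

theorem Filling.EntriesLE.foldl_mixInsert {w : List Letter} (h : T.EntriesLE (mark k true))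
    (hw : ∀ x ∈ w, x ≤ k) : (w.foldl mixInsert T).EntriesLE (mark k true) := by
  induction w generalizing T with
  | nil => exact h
  | cons x w ih =>
    have hx : PLetter.unprimed x ≤ mark k true :=
      Prod.Lex.le_iff.2 ((hw x (by simp)).lt_or_eq.imp id fun h => ⟨h, le_rfl⟩)
    exact ih (h.mixInsertLine hx) fun y hy => hw y (by simp [hy])

theorem Filling.EntriesLE.mixInsertLine_eq_write {j : ℕ} (h : T.EntriesLE m)
    (hn : Addable BumpRule.shifted.region T.shape n) (hj : n = L.cell j) :
    T.mixInsertLine L m = T.write n m := by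
  have hnone : T.entry n = none := entry_eq_none.2 hn.notMem
  suffices ht : T.target L m = n by
    rw [mixInsertLine_of_none (by rwa [ht]), ht]
  subst hj
  refine target_eq_iff.2 ⟨by simp [Accepts, hnone], fun i hi hacc => ?_⟩
  have hlt : L.cell i < L.cell j := by
    cases L <;> simpa [Line.cell, Prod.mk_lt_mk] using hi
  have hreg : BumpRule.shifted.region (L.cell i) := by
    have := hn.prop
    cases L <;> simp only [BumpRule.shifted, Line.cell] at this ⊢ <;> lia
  obtain ⟨b, hb⟩ := exists_entry (hn.mem_of_lt hreg hlt)
  exact (h _ b hb).not_gt (hacc b hb)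

/-- Every entry of `T` is at most `m`, and the last copy of `m` can be in the cell `q`: copies of a
primed letter occupy different rows, from top to bottom, copies of an unprimed letter different
columns, from left to right. -/
structure IsLast (T : Filling PLetter) (q : Cell) (m : PLetter) : Prop where
  le : T.EntriesLE m
  primed : m.IsPrimed → ∀ p, T.entry p = some m → p.1 < q.1
  unprimed : ¬ m.IsPrimed → ∀ p, T.entry p = some m → p.2 < q.2

theorem IsLast.write (h : IsLast T q m) (ha : a ≤ m)
    (hp : a = m → (m.IsPrimed → p.1 < q.1) ∧ (¬ m.IsPrimed → p.2 < q.2)) :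
    IsLast (T.write p a) q m where
  le := h.le.write ha
  primed hm x hx := by
    rcases entry_write_eq_some.1 hx with ⟨rfl, ham⟩ | ⟨-, hx⟩
    · exact (hp ham).1 hm
    · exact h.primed hm x hx
  unprimed hm x hx := by
    rcases entry_write_eq_some.1 hx with ⟨rfl, ham⟩ | ⟨-, hx⟩
    · exact (hp ham).2 hm
    · exact h.unprimed hm x hx

theorem IsLast.entry_ne (h : IsLast T q m) : T.entry q ≠ some m := fun hq =>
  (em m.IsPrimed).elim (fun hm => (h.primed hm q hq).false) fun hm => (h.unprimed hm q hq).false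

/-- The copies of the letter `m` in `T` can be bumped without meeting another entry in the line
where they go. -/
structure CopiesAtEnds (T : Filling PLetter) (m : PLetter) : Prop where
  fst_le_snd : ∀ p, T.entry p = some m → p.1 ≤ p.2
  fst_ne_snd : m.IsPrimed → ∀ p, T.entry p = some m → p.1 ≠ p.2
  entry_below : ¬ m.IsPrimed → ∀ p, T.entry p = some m → T.entry (p.1 + 1, p.2) = none
  entry_right : m.IsPrimed → ∀ p, T.entry p = some m → T.entry (p.1, p.2 + 1) = none

theorem CopiesAtEnds.write (h : CopiesAtEnds T m) (hp : T.entry p ≠ none) (ha : a < m) :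
    CopiesAtEnds (T.write p a) m := by
  have hcopy (q : Cell) (hq : (T.write p a).entry q = some m) : T.entry q = some m :=
    (entry_write_eq_some.1 hq).elim (fun hq => absurd hq.2 ha.ne) And.right
  have hnone (q : Cell) (hq : T.entry q = none) : (T.write p a).entry q = none := by
    rwa [entry_write_of_ne]
    rintro rfl
    exact hp hq
  exact ⟨fun q hq => h.fst_le_snd q (hcopy q hq), fun hm q hq => h.fst_ne_snd hm q (hcopy q hq),
    fun hm q hq => hnone _ (h.entry_below hm q (hcopy q hq)),
    fun hm q hq => hnone _ (h.entry_right hm q (hcopy q hq))⟩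

theorem CopiesAtEnds.target_le (h : CopiesAtEnds T m) (hp : T.entry p = some m) (ha : a < m)
    (hm : (afterBump p m).2 = m) :
    (m.IsPrimed → ((T.write p a).target (afterBump p m).1 m).1 ≤ p.1) ∧
      (¬ m.IsPrimed → ((T.write p a).target (afterBump p m).1 m).2 ≤ p.2) := by
  have hw := h.write (p := p) (by simp [hp]) ha
  have hnone {q : Cell} (hq : T.entry q = none) : (T.write p a).entry q = none := by
    rwa [entry_write_of_ne]
    rintro rfl
    simp [hp] at hq
  constructor
  · intro hprimed
    have hL : (afterBump p m).1 = .col (p.2 + 1) := by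
      simp [afterBump, h.fst_ne_snd hprimed p hp, hprimed]
    obtain ⟨j, hj, ht⟩ := exists_target_le (L := .col (p.2 + 1)) (k := p.1) (a := m)
      (hnone (h.entry_right hprimed p hp))
    rwa [hL, ht]
  · intro hprimed
    have hdiag : p.1 ≠ p.2 := fun hdiag => hprimed (by
      rw [← hm]
      simp [afterBump, hdiag, PLetter.IsPrimed, PLetter.primed])
    have hL : (afterBump p m).1 = .row (p.1 + 1) := by simp [afterBump, hdiag, hprimed]
    have hle := h.fst_le_snd p hp
    have hcell : (Line.row (p.1 + 1)).cell (p.2 - (p.1 + 1)) = (p.1 + 1, p.2) := by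
      simp only [Line.cell, Prod.mk.injEq, true_and]
      lia
    obtain ⟨j, hj, ht⟩ := exists_target_le (a := m)
      (hcell ▸ hnone (h.entry_below hprimed p hp))
    rw [hL, ht]
    simp only [Line.cell]
    lia

theorem IsLast.mixInsertLine (h : IsLast T q m) (hT : CopiesAtEnds T m) (ha : a < m) :
    IsLast (T.mixInsertLine L a) q m := by
  induction T, L, a using Filling.mixInsertLine.induct with
  | case1 T L a hb =>
    rw [mixInsertLine_of_none hb]
    exact h.write ha.le (absurd · ha.ne)
  | case2 T L a b hb ih =>
    have hw := h.write (p := T.target L a) ha.le (absurd · ha.ne)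
    rw [mixInsertLine_of_some hb]
    rcases ((afterBump_le (T.target L a) b).trans (h.le _ b hb)).lt_or_eq with hlt | heq
    · exact ih hw (hT.write (by simp [hb]) ha) hlt
    · obtain rfl : b = m := le_antisymm (h.le _ b hb) (heq ▸ afterBump_le _ b)
      have ht := hT.target_le hb ha heq
      rw [heq, mixInsertLine_of_none (hw.le.entry_target _)]
      exact hw.write le_rfl fun _ => ⟨fun hm => (ht.1 hm).trans_lt (h.primed hm _ hb),
        fun hm => (ht.2 hm).trans_lt (h.unprimed hm _ hb)⟩

/-- Semistandard shifted tableaux: shifted shape, weakly increasing rows and columns, no repeated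
primed letter in a row, no repeated unprimed letter in a column, no primed letter on the main
diagonal. -/
structure IsTableau (T : Filling PLetter) : Prop where
  isRelLowerSet : IsRelLowerSet (T.shape : Set Cell) BumpRule.shifted.region
  row : ∀ {r c c' a b}, c < c' → T.entry (r, c) = some a → T.entry (r, c') = some b →
    a ≤ b ∧ (a = b → ¬ a.IsPrimed)
  col : ∀ {r r' c a b}, r < r' → T.entry (r, c) = some a → T.entry (r', c) = some b →
    a ≤ b ∧ (a = b → a.IsPrimed)
  diag : ∀ {r a}, T.entry (r, r) = some a → ¬ a.IsPrimed

theorem isTableau_empty : IsTableau Filling.empty :=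
  ⟨by simp [Filling.empty], by simp [Filling.empty],
    by simp [Filling.empty], by simp [Filling.empty]⟩

theorem IsTableau.fst_le_snd (h : IsTableau T) (hp : T.entry p = some b) : p.1 ≤ p.2 :=
  h.isRelLowerSet.prop_of_mem (mem_of_entry hp)

theorem IsTableau.copiesAtEnds (hT : IsTableau T) (h : T.EntriesLE m) : CopiesAtEnds T m where
  fst_le_snd _ hp := hT.fst_le_snd hp
  fst_ne_snd := by
    rintro hm ⟨i, j⟩ hp (rfl : i = j)
    exact hT.diag hp hm
  entry_below := by
    rintro hm ⟨i, j⟩ hp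
    by_contra hne
    obtain ⟨b, hb⟩ := Option.ne_none_iff_exists'.1 hne
    obtain ⟨hle, heq⟩ := hT.col (Nat.lt_succ_self i) hp hb
    exact hm (heq (le_antisymm hle (h _ b hb)))
  entry_right := by
    rintro hm ⟨i, j⟩ hp
    by_contra hne
    obtain ⟨b, hb⟩ := Option.ne_none_iff_exists'.1 hne
    obtain ⟨hle, heq⟩ := hT.row (Nat.lt_succ_self j) hp hb
    exact heq (le_antisymm hle (h _ b hb)) hm

theorem IsTableau.write (hT : IsTableau T) (h : IsLast T q m)
    (hq : Addable BumpRule.shifted.region T.shape q) (hd : m.IsPrimed → q.1 ≠ q.2) :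
    IsTableau (T.write q m) := by
  have hnot {p : Cell} {b : PLetter} (hb : T.entry p = some b) : ¬ q ≤ p :=
    hq.not_le_of_mem (mem_of_entry hb)
  refine ⟨by rw [coe_shape_write]; exact hq.isRelLowerSet_insert, ?_, ?_, ?_⟩
  · intro r c c' a b hlt ha hb
    rcases entry_write_eq_some.1 ha with ⟨rfl, rfl⟩ | ⟨-, ha'⟩ <;>
      rcases entry_write_eq_some.1 hb with ⟨heq, rfl⟩ | ⟨-, hb'⟩
    · exact absurd (congrArg Prod.snd heq) hlt.ne'
    · exact absurd (Prod.mk_le_mk.2 ⟨le_rfl, hlt.le⟩) (hnot hb')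
    · refine ⟨h.le _ _ ha', ?_⟩
      rintro rfl hm
      exact (h.primed hm _ ha').ne (congrArg Prod.fst heq :)
    · exact hT.row hlt ha' hb'
  · intro r r' c a b hlt ha hb
    rcases entry_write_eq_some.1 ha with ⟨rfl, rfl⟩ | ⟨-, ha'⟩ <;>
      rcases entry_write_eq_some.1 hb with ⟨heq, rfl⟩ | ⟨-, hb'⟩
    · exact absurd (congrArg Prod.fst heq) hlt.ne'
    · exact absurd (Prod.mk_le_mk.2 ⟨hlt.le, le_rfl⟩) (hnot hb')
    · refine ⟨h.le _ _ ha', ?_⟩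
      rintro rfl
      by_contra hm
      exact (h.unprimed hm _ ha').ne (congrArg Prod.snd heq :)
    · exact hT.col hlt ha' hb'
  · intro r a ha hp
    rcases entry_write_eq_some.1 ha with ⟨rfl, rfl⟩ | ⟨-, ha⟩
    · exact hd hp rfl
    · exact hT.diag ha hp

end MixedInsertion

section MixedGrowth

open Filling

variable {T : Filling PLetter} {b m : PLetter} {A : Set Cell} {p q n : Cell} {k : Letter}
  {t u : Bool}

theorem IsLast.fst_lt_of_bump (hT : IsTableau T) (h : IsLast T q m) (hm : ¬ m.IsPrimed)
    (hb : T.entry q = some b) (hp : T.entry p = some m) : q.1 < p.1 := by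
  have hpq : p.2 < q.2 := h.unprimed hm p hp
  by_contra! hle
  obtain ⟨e, he⟩ := exists_entry (T := T) (p := (p.1, q.2)) (hT.isRelLowerSet.mem_of_le
    (mem_of_entry hb) (Prod.mk_le_mk.2 ⟨hle, le_rfl⟩) ((hT.fst_le_snd hp).trans hpq.le))
  obtain rfl : m = e := le_antisymm (hT.row hpq hp he).1 (h.le _ e he)
  exact lt_irrefl q.2 (h.unprimed hm (p.1, q.2) he)

theorem IsTableau.snd_lt_of_primed (hT : IsTableau T) (hle : T.EntriesLE m) (hm : m.IsPrimed)
    (hb : T.entry q = some b) (hlt : b < m) (hp : T.entry p = some m) (hpq : p.1 ≤ q.1) :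
    q.2 < p.2 := by
  by_contra! hpq'
  rcases hpq'.lt_or_eq with hpq' | hpq'
  · obtain ⟨e, he⟩ := exists_entry (T := T) (p := (p.1, q.2)) (hT.isRelLowerSet.mem_of_le
      (mem_of_entry hb) (Prod.mk_le_mk.2 ⟨hpq, le_rfl⟩) ((hT.fst_le_snd hp).trans hpq'.le))
    obtain ⟨hme, heq⟩ := hT.row hpq' hp he
    exact heq (le_antisymm hme (hle _ e he)) hm
  · obtain ⟨i, j⟩ := p
    obtain rfl : j = q.2 := hpq'
    rcases hpq.lt_or_eq with hpq | hpq
    · exact (hT.col hpq hp hb).1.not_gt hlt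
    · obtain rfl : i = q.1 := hpq
      exact hlt.ne (Option.some_injective _ (hb.symm.trans hp))

theorem IsLast.entriesLE_primed (hT : IsTableau T) (h : IsLast T q (mark k true))
    (hb : T.entry q = some b) (hq : q.1 = q.2) : T.EntriesLE (mark k false) := by
  intro p c hc
  refine lt_mark_true_iff.1 ((h.le p c hc).lt_of_ne ?_)
  rintro rfl
  have hfst := h.fst_lt_of_bump hT (by simp [isPrimed_mark]) hb hc
  have hsnd := h.unprimed (by simp [isPrimed_mark]) p hc
  have hprop := hT.fst_le_snd hc
  lia

theorem IsLast.next (hT : IsTableau T) (h : IsLast T q (mark k t)) (hb : T.entry q = some b)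
    (hlt : b < mark k t) (hl : NextLine (BumpRule.shifted.turn q t) q n)
    (hn : Addable BumpRule.shifted.region T.shape n) :
    IsLast T n (mark k (BumpRule.shifted.turn q t)) := by
  cases hu : BumpRule.shifted.turn q t <;> rw [hu] at hl
  · suffices hprimed : T.EntriesLE (mark k false) ∧ b < mark k false ∧
        ∀ p, T.entry p = some (mark k false) → p.2 ≤ q.2 → p.1 ≤ q.1 by
      obtain ⟨hle, hlt, hfst⟩ := hprimed
      refine ⟨hle, fun hm p hp => ?_, fun hm => absurd rfl hm⟩
      by_contra! hnp
      have hsnd : p.2 ≤ q.2 := by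
        by_contra! hqp
        exact hn.not_le_of_mem (mem_of_entry hp) ⟨hnp, (Eq.le hl).trans hqp⟩
      exact (hT.snd_lt_of_primed hle hm hb hlt hp (hfst p hp hsnd)).not_ge hsnd
    cases t with
    | false => exact ⟨h.le, hlt, fun p hp _ => (h.primed rfl p hp).le⟩
    | true =>
      have hdiag : q.1 = q.2 := by simpa [BumpRule.shifted] using hu
      have hle := h.entriesLE_primed hT hb hdiag
      refine ⟨hle, (hle q b hb).lt_of_ne ?_, fun p hp hpq =>
        ((hT.fst_le_snd hp).trans hpq).trans hdiag.ge⟩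
      rintro rfl
      obtain ⟨i, j⟩ := q
      obtain rfl : i = j := hdiag
      exact hT.diag hb rfl
  · obtain rfl : t = true := (Bool.and_eq_true_iff.1 hu).1
    refine ⟨h.le, fun hm => by simp [isPrimed_mark] at hm, fun hm p hp => ?_⟩
    by_contra! hnp
    exact hn.not_le_of_mem (mem_of_entry hp)
      ⟨(Eq.le hl).trans (h.fst_lt_of_bump hT hm hb hp), hnp⟩

theorem IsLast.exists_bump (hT : IsTableau T) (h : IsLast T q (mark k t))
    (hq : Addable BumpRule.shifted.region A q) (hA : (T.shape : Set Cell) = insert q A) :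
    ∃ b n, T.entry q = some b ∧ b < mark k t ∧ NextLine (BumpRule.shifted.turn q t) q n ∧
      Addable BumpRule.shifted.region T.shape n ∧
      IsLast T n (mark k (BumpRule.shifted.turn q t)) ∧
      T.mixInsertLine (afterBump q (mark k t)).1 (afterBump q (mark k t)).2 =
        T.write n (mark k (BumpRule.shifted.turn q t)) := by
  obtain ⟨b, hb⟩ := exists_entry (T := T) (p := q) (by simp [hA])
  have hlt : b < mark k t := (h.le q b hb).lt_of_ne fun hbm => h.entry_ne (hbm ▸ hb)
  obtain ⟨n, hl, hn⟩ := hq.exists_shifted_nextLine (u := BumpRule.shifted.turn q t)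
    fun hu => of_decide_eq_true (Bool.and_eq_true_iff.1 hu).2
  rw [← hA] at hn
  have hlast := h.next hT hb hlt hl hn
  refine ⟨b, n, hb, hlt, hl, hn, hlast, ?_⟩
  have hprop : n.1 ≤ n.2 := hn.prop
  rw [afterBump_mark]
  cases hu : BumpRule.shifted.turn q t <;> rw [hu] at hl hlast
  · exact hlast.le.mixInsertLine_eq_write hn (j := n.1) (Prod.ext rfl hl)
  · exact hlast.le.mixInsertLine_eq_write hn (j := n.2 - n.1)
      (Prod.ext hl (by have : n.1 = q.1 + 1 := hl; simp only [Line.cell, if_true]; lia))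

variable {β : Type*} {f : β → Letter} {U V W : List (β × Cell)}

/-- In the successive mixed insertion of the labels of the list into `T`, where the label `x` stands
for the letter `f x`, all tableaux are shifted tableaux and the cells of the list are the new
cells. -/
inductive MixRun (f : β → Letter) : Filling PLetter → List (β × Cell) → Prop
  | nil (T : Filling PLetter) : MixRun f T []
  | cons {T : Filling PLetter} {x : β} {c : Cell} {W : List (β × Cell)}
      (hs : ((mixInsert T (f x)).shape : Set Cell) = insert c (T.shape : Set Cell))
      (hc : Addable BumpRule.shifted.region T.shape c) (hT : IsTableau (mixInsert T (f x)))
      (h : MixRun f (mixInsert T (f x)) W) : MixRun f T ((x, c) :: W)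

theorem mixRun_append : MixRun f T (U ++ V) ↔
    MixRun f T U ∧ MixRun f ((U.map fun e => f e.1).foldl mixInsert T) V := by
  induction U generalizing T with
  | nil => simp [MixRun.nil]
  | cons e U ih =>
    constructor
    · rintro (_ | ⟨hs, hc, hT, h⟩)
      exact ⟨.cons hs hc hT (ih.1 h).1, (ih.1 h).2⟩
    · rintro ⟨_ | ⟨hs, hc, hT, h⟩, hV⟩
      exact .cons hs hc hT (ih.2 ⟨h, hV⟩)

theorem MixRun.isTableau (h : MixRun f T W) (hT : IsTableau T) :
    IsTableau ((W.map fun e => f e.1).foldl mixInsert T) := by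
  induction h with
  | nil => exact hT
  | cons _ _ hT' _ ih => exact ih hT'

theorem MixRun.shape_eq (h : MixRun f T W) :
    (((W.map fun e => f e.1).foldl mixInsert T).shape : Set Cell) = addCells T.shape W := by
  induction h with
  | nil => simp
  | cons hs _ _ _ ih => simpa [← hs] using ih

theorem MixRun.exists_pass (h : MixRun f T V) (hT : IsTableau T)
    (hq : Addable BumpRule.shifted.region T.shape q) (ht : t = false → q.1 ≠ q.2)
    (hl : IsLast T q (mark k t)) (hV : ∀ e ∈ V, f e.1 < k) :
    ∃ q' t' V', Pass .shifted T.shape q t V q' t' V' ∧ MixRun f (T.write q (mark k t)) V' := by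
  induction h generalizing q t with
  | nil => exact ⟨q, t, [], .nil _ _ _, .nil _⟩
  | @cons T x c V hs hc hT' _ ih =>
    obtain ⟨hx, hV⟩ := List.forall_mem_cons.1 hV
    have hxk := unprimed_lt_mark hx t
    have hl' : IsLast (mixInsert T (f x)) q (mark k t) :=
      hl.mixInsertLine (hT.copiesAtEnds hl.le) hxk
    have hwrite := mixInsertLine_write (L := .row 0) (a := .unprimed (f x)) (mark k t)
      (entry_eq_none.2 hq.notMem)
    by_cases hcq : c = q
    · subst hcq
      obtain ⟨b, n, hb, hlt, hnext, hn, hlast, hbump⟩ := hl'.exists_bump hT' hc hs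
      have hn' := hs ▸ hn
      have hdiag (hu : BumpRule.shifted.turn c t = false) : n.1 ≠ n.2 :=
        (NextLine.fst_lt_snd (hu ▸ hnext) hq hn').ne
      obtain ⟨q', t', V', hp, hr⟩ := ih hT' hn hdiag hlast hV
      have hmix : mixInsert (T.write c (mark k t)) (f x) =
          (mixInsert T (f x)).write n (mark k (BumpRule.shifted.turn c t)) :=
        (hwrite.2 b hb hlt).trans hbump
      refine ⟨q', t', (x, n) :: V', .bump hn' hnext (hs ▸ hp), .cons ?_ ?_ ?_ ?_⟩
      · rw [hmix, coe_shape_write, coe_shape_write, hs]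
      · rwa [coe_shape_write]
      · exact hmix ▸ hT'.write hlast hn hdiag
      · exact hmix ▸ hr
    · have hq' : Addable BumpRule.shifted.region (mixInsert T (f x)).shape q :=
        hs ▸ hc.addable_insert hq hcq
      obtain ⟨q', t', V', hp, hr⟩ := ih hT' hq' ht hl' hV
      have hmix : mixInsert (T.write q (mark k t)) (f x) =
          (mixInsert T (f x)).write q (mark k t) :=
        hwrite.1 (entry_eq_none.2 hq'.notMem)
      refine ⟨q', t', (x, c) :: V', .keep hcq (hs ▸ hp), .cons ?_ ?_ ?_ ?_⟩
      · rw [hmix, coe_shape_write, coe_shape_write, Set.insert_comm]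
        exact congrArg _ hs
      · rw [coe_shape_write]
        exact hq.addable_insert hc (Ne.symm hcq)
      · exact hmix ▸ hT'.write hl' hq' ht
      · exact hmix ▸ hr

theorem IsTableau.exists_mixInsert_eq_write (hT : IsTableau T) (hle : T.EntriesLE (mark k true)) :
    ∃ s : Cell, s.1 = 0 ∧ Addable BumpRule.shifted.region T.shape s ∧ IsLast T s (mark k true) ∧
      mixInsert T k = T.write s (mark k true) := by
  obtain ⟨s, hs, h0⟩ := exists_addable_row_zero hT.isRelLowerSet (fun c => c.zero_le)
    T.shape.finite_toSet
  refine ⟨s, h0, hs, ⟨hle, fun hm => by simp [isPrimed_mark] at hm, fun _ p hp => ?_⟩,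
    hle.mixInsertLine_eq_write hs (j := s.2) (Prod.ext h0 (Nat.zero_add _).symm)⟩
  by_contra! hsp
  exact hs.not_le_of_mem (mem_of_entry hp) ⟨h0.le.trans (Nat.zero_le _), hsp⟩

/-- The letter of an indexed letter. -/
abbrev letter (a : Letter ×ₗ ℕ) : Letter := (ofLex a).1

/-- In the word `W`, equal letters carry increasing indices. -/
def IsIndexed (W : List (Letter ×ₗ ℕ)) : Prop :=
  W.Pairwise fun a b => letter a = letter b → (ofLex a).2 < (ofLex b).2

theorem IsIndexed.nodup {W : List (Letter ×ₗ ℕ)} (h : IsIndexed W) : W.Nodup :=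
  h.imp (by rintro a _ hab rfl; exact lt_irrefl _ (hab rfl))

theorem MixRun.insert_max {U V V' : List ((Letter ×ₗ ℕ) × Cell)} {m : Letter ×ₗ ℕ} {s : Cell}
    (h : MixRun letter .empty (U ++ V)) (hm : ∀ e ∈ U ++ V, e.1 < m)
    (hV : ∀ e ∈ V, letter e.1 < letter m)
    (hs : Addable BumpRule.shifted.region (addCells ∅ U) s) (hs0 : s.1 = 0)
    (hp : Pass .shifted (addCells ∅ U) s true V q t V') :
    MixRun letter .empty (U ++ (m, s) :: V') := by
  obtain ⟨hU, hr⟩ := mixRun_append.1 h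
  have hT := hU.isTableau isTableau_empty
  have hle : ((U.map fun e => letter e.1).foldl mixInsert .empty).EntriesLE
      (mark (letter m) true) := by
    refine EntriesLE.foldl_mixInsert (fun p b hb => by simp [Filling.empty] at hb) ?_
    refine List.forall_mem_map.2 fun e he => ?_
    exact (Prod.Lex.lt_iff.1 (hm e (List.mem_append_left V he))).elim le_of_lt fun h => h.1.le
  obtain ⟨s', hs0', hs', hlast, hmix⟩ := hT.exists_mixInsert_eq_write hle
  obtain ⟨q', t', W, hp', hr'⟩ := hr.exists_pass hT hs' (by simp) hlast hV
  have hshape := hU.shape_eq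
  rw [Filling.empty, Finset.coe_empty] at hshape
  obtain rfl : s' = s := (hshape ▸ hs').eq_of_fst_eq hs (hs0'.trans hs0.symm)
  obtain ⟨-, -, rfl⟩ := Pass.unique (hshape ▸ hp') hp
  refine mixRun_append.2 ⟨hU, .cons ?_ hs' ?_ ?_⟩
  · rw [hmix, coe_shape_write]
  · exact hmix ▸ hT.write hlast hs' (by simp [isPrimed_mark])
  · exact hmix ▸ hr'

theorem Growth.mixRun {W : List ((Letter ×ₗ ℕ) × Cell)} (hg : Growth .shifted (fun _ => true) W)
    (hW : IsIndexed (W.map Prod.fst)) : MixRun letter .empty W := by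
  induction hg with
  | nil => exact .nil _
  | @ins U V V' m s q t hm _ hs hs0 hp ih =>
    rw [List.map_append, List.map_cons, hp.map_fst] at hW
    have hV (e) (he : e ∈ V) : letter e.1 < letter m := by
      rcases Prod.Lex.lt_iff.1 (hm e (List.mem_append_right U he)) with hlt | hlt
      · exact hlt
      · have hpair := (List.pairwise_cons.1 (List.pairwise_append.1 hW).2.1).1
        exact absurd (hpair e.1 (List.mem_map_of_mem he) hlt.1.symm) hlt.2.not_gt
    have hUV : IsIndexed ((U ++ V).map Prod.fst) := by
      rw [List.map_append]
      exact List.Pairwise.sublist (by simp) hW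
    exact (ih hUV).insert_max hm hV hs hs0 hp

end MixedGrowth

/-! ### Peaks -/

section Peaks

open BumpRule (shifted)

variable {β : Type*} {A : Set Cell} {c d q q' s : Cell} {t t' : Bool}
  {e f e' f' x y z x' y' z' : β × Cell} {P S U V V' : List (β × Cell)}

theorem Addable.fst_lt_iff_of_shifted (hc : Addable shifted.region A c)
    (hd : Addable shifted.region (insert c A) d) : c.1 < d.1 ↔ d.2 ≤ c.2 :=
  hc.fst_lt_iff hd (Nat.le_succ_of_le hc.prop)

theorem Pass.snd_lt_snd_iff (h : Pass shifted A q t [e, f] q' t' [e', f'])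
    (hq : Addable shifted.region A q) (hV : IsPath shifted.region A [e, f])
    (ht : ¬ (t = true ∧ t' = false ∧ q.1 ≠ q.2)) : e.2.2 < f.2.2 ↔ e'.2.2 < f'.2.2 := by
  have hV' := (h.isPath hq hV).2.1
  have hef := hV.1.fst_lt_iff_of_shifted hV.2.1
  have hef' := hV'.1.fst_lt_iff_of_shifted hV'.2.1
  cases h with
  | keep hne hp =>
    have hqe := hV.1.lt_or_lt hq hne
    cases hp with
    | keep _ hp =>
      cases hp
      rfl
    | bump _ hl hp =>
      cases hp
      simp only [NextLine] at hl
      split_ifs at hl <;> lia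
  | bump hn hl hp =>
    cases hp with
    | keep hne hp =>
      cases hp
      have hfn := hV.2.1.lt_or_lt hn hne
      simp only [NextLine] at hl
      split_ifs at hl <;> lia
    | bump hn' hl' hp =>
      cases hp
      simp only [NextLine, shifted, Bool.and_eq_true, decide_eq_true_eq] at hl hl' ht
      split_ifs at hl hl' <;> grind

theorem Pass.eq_of_turn (h : Pass shifted A q true [e, f] q' false [e', f']) (hq : q.1 ≠ q.2) :
    e.2 = q ∧ f.2 = (q.1 + 1, q.1 + 1) ∧ e'.2 = f.2 ∧ f'.2 = q' ∧ q'.2 = q.1 + 2 := by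
  have hturn : shifted.turn q true = true := by simp [shifted, hq]
  cases h with
  | keep _ hp =>
    cases hp with
    | keep _ hp => cases hp
    | bump _ _ hp =>
      rw [hturn] at hp
      cases hp
  | @bump _ _ n _ _ _ _ _ _ _ hl hp =>
    rw [hturn] at hl hp
    cases hp with
    | keep _ hp => cases hp
    | bump _ hl' hp =>
      generalize ht : shifted.turn n true = t at hp hl'
      cases hp
      have hdiag : n.1 = n.2 := by simpa [shifted] using ht
      replace hl : n.1 = q.1 + 1 := hl
      exact ⟨rfl, Prod.ext hl (hdiag ▸ hl), rfl, rfl, Eq.trans hl' (by rw [← hdiag, hl])⟩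

theorem Pass.fst_le_of_diag_mem (h : Pass shifted A q false [z] q' t' [z'])
    (hq : Addable shifted.region A q) (hz : Addable shifted.region A z.2) {k : ℕ}
    (hk : (k, k) ∈ A) (hqk : q.2 = k + 1) : z'.2.1 ≤ q.1 := by
  obtain ⟨_, c'⟩ := z'
  cases h with
  | keep hne hp =>
    cases hp
    by_contra! hlt
    have hzq := hz.lt_or_lt hq hne
    have hprop : c'.1 ≤ c'.2 := hz.prop
    exact hz.not_le_of_mem hk (Prod.le_def.2 (by lia))
  | bump hn hl hp =>
    cases hp
    have hqn := hq.fst_lt_iff_of_shifted hn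
    replace hl : _ = q.2 + 1 := hl
    lia

theorem Pass.snd_le_of_not_diag_le (h : Pass shifted A q t [x] q' true [x'])
    (hq : Addable shifted.region A q) (hx : Addable shifted.region A x.2)
    (hdiag : ¬ (q'.1 + 1, q'.1 + 1) ≤ x.2) : q'.2 ≤ x.2.2 := by
  obtain ⟨_, c⟩ := x
  cases h with
  | keep hne hp =>
    cases hp
    have hxq := hx.lt_or_lt hq hne
    have hprop : c.1 ≤ c.2 := hx.prop
    rw [Prod.le_def] at hdiag
    lia
  | bump hn hl hp =>
    generalize ht : shifted.turn q t = u at hp hl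
    cases hp
    exact (hq.fst_lt_iff_of_shifted hn).1 (Eq.symm hl ▸ Nat.lt_succ_self _)

theorem Pass.exists_of_cons {ρ : BumpRule} (h : Pass ρ A q t (e :: V) q' t' (e' :: V')) :
    ∃ q₁ t₁, Pass ρ A q t [e] q₁ t₁ [e'] ∧ Pass ρ (insert e.2 A) q₁ t₁ V q' t' V' := by
  cases h with
  | keep h hp => exact ⟨_, _, .keep h (.nil _ _ _), hp⟩
  | bump hn hl hp => exact ⟨_, _, .bump hn hl (.nil _ _ _), hp⟩

theorem Pass.peak_iff (h : Pass shifted A q t [x, y, z] q' t' [x', y', z'])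
    (hq : Addable shifted.region A q) (hV : IsPath shifted.region A [x, y, z]) :
    x.2.2 < y.2.2 ∧ y.2.1 < z.2.1 ↔ x'.2.2 < y'.2.2 ∧ y'.2.1 < z'.2.1 := by
  obtain ⟨-, hy', hz', -⟩ := (h.isPath hq hV).2.1
  obtain ⟨hx, hy, hz, -⟩ := hV
  have hyz := hy.fst_lt_iff_of_shifted hz
  have hyz' := hy'.fst_lt_iff_of_shifted hz'
  obtain ⟨q₁, t₁, hp₁, hp₂₃⟩ := h.exists_of_cons
  obtain ⟨q₂, t₂, hp₂, hp₃⟩ := hp₂₃.exists_of_cons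
  have hp₁₂ : Pass shifted A q t [x, y] q₂ t₂ [x', y'] := hp₁.append (by simpa using hp₂)
  have hq₁ : Addable shifted.region (insert x.2 A) q₁ := by
    simpa using (hp₁.isPath hq ⟨hx, trivial⟩).1
  have hq₂ := (hp₂.isPath hq₁ ⟨hy, trivial⟩).1
  rw [addCells_cons, addCells_nil] at hq₂
  by_cases hturn₁ : t = true ∧ t₂ = false ∧ q.1 ≠ q.2
  · obtain ⟨rfl, rfl, hne⟩ := hturn₁
    obtain ⟨rfl, hyd, -, rfl, hq₂d⟩ := hp₁₂.eq_of_turn hne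
    have hprop : x.2.1 ≤ x.2.2 := hx.prop
    have hle := hp₃.fst_le_of_diag_mem hq₂ hz (hyd ▸ Set.mem_insert _ _) hq₂d
    grind
  by_cases hturn₂ : t₁ = true ∧ t' = false ∧ q₁.1 ≠ q₁.2
  · obtain ⟨rfl, rfl, hne⟩ := hturn₂
    obtain ⟨rfl, hzd, hy', rfl, hq'd⟩ := hp₂₃.eq_of_turn hne
    have hle := hp₁.snd_le_of_not_diag_le hq hx
      (hzd ▸ hz.not_le_of_mem (Set.mem_insert_of_mem _ (Set.mem_insert _ _)))
    grind
  have hxy_iff := hp₁₂.snd_lt_snd_iff hq ⟨hx, hy, trivial⟩ hturn₁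
  have hyz_iff := hp₂₃.snd_lt_snd_iff hq₁ ⟨hy, hz, trivial⟩ hturn₂
  lia

theorem Pass.not_peak (h : Pass shifted A s true V q t (y :: z :: S))
    (hs : Addable shifted.region A s) (h0 : s.1 = 0) (hV : IsPath shifted.region A V) :
    ¬ (s.2 < y.2.2 ∧ y.2.1 < z.2.1) := by
  rintro ⟨hsy, hyz⟩
  obtain ⟨_, d⟩ := z
  cases h with
  | keep hne _ =>
    have hlt := hV.1.lt_or_lt hs hne
    lia
  | @bump _ _ n _ _ _ _ _ _ hn hl hp =>
    have hsn := hs.fst_lt_iff_of_shifted hn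
    have hdiag : s.2 = 0 := by
      by_contra! hne
      rw [show shifted.turn s true = true by simp [shifted, h0, hne.symm]] at hl
      simp only [NextLine, if_true] at hl
      lia
    rw [show shifted.turn s true = false by simp [shifted, h0, hdiag]] at hl hp
    replace hl : n.2 = s.2 + 1 := hl
    cases hp with
    | keep hne _ =>
      have hlt := hV.2.1.lt_or_lt hn hne
      have hprop : d.1 ≤ d.2 := hV.2.1.prop
      lia
    | bump hn' hl' _ =>
      have hnd := hn.fst_lt_iff_of_shifted hn'
      replace hl' : d.2 = n.2 + 1 := hl'
      lia

theorem Pass.fst_lt_fst_of_snd_ne_zero (h : Pass shifted A s true V q t (z :: S))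
    (hs : Addable shifted.region A s) (h0 : s.1 = 0) (hV : IsPath shifted.region A V)
    (hne : s.2 ≠ 0) : s.1 < z.2.1 := by
  cases h with
  | keep hne _ =>
    have hlt := hV.1.lt_or_lt hs hne
    lia
  | bump hn hl _ =>
    rw [show shifted.turn s true = true by simp [shifted, h0, hne.symm]] at hl
    exact Eq.symm hl ▸ Nat.lt_succ_self _

theorem Growth.peak_iff [LinearOrder β]
    (h : Growth shifted (fun _ => true) (P ++ [x, y, z] ++ S)) :
    x.1 < y.1 ∧ z.1 < y.1 ↔ x.2.2 < y.2.2 ∧ y.2.1 < z.2.1 := by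
  generalize hW : P ++ [x, y, z] ++ S = W at h
  induction h generalizing P x y z S with
  | nil => simp at hW
  | @ins U V V' m s q t hm hg hs h0 hp ih =>
    have hm' : ∀ e ∈ U ++ V', e.1 < m := by
      rw [List.forall_mem_append] at hm ⊢
      exact ⟨hm.1, (hp.forall_fst_iff (p := (· < m))).2 hm.2⟩
    replace h0 : s.1 = 0 := h0
    rcases append_cons_eq_append_append hW.symm with
      ⟨P₂, rfl, rfl⟩ | ⟨M₁, M₂, hM, rfl, rfl⟩ | ⟨S₁, rfl, rfl⟩
    · obtain ⟨q₁, t₁, q₂, t₂, V₁, N, V₂, hp₁, hp₂, -, rfl⟩ := hp.exists_of_append_append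
      obtain ⟨x₀, y₀, z₀, rfl, hx, hy, hz⟩ := exists_triple_of_map_eq hp₂.map_fst.symm
      simp only [← List.append_assoc] at hg ih
      have hq₁ := (hp₁.isPath hs hg.isPath_mid_left).1
      rw [← hx, ← hy, ← hz, ih rfl,
        hp₂.peak_iff hq₁ (addCells_append ∅ U V₁ ▸ hg.isPath_mid)]
    · have hV := (isPath_append.1 hg.isPath).2
      obtain ⟨rfl, rfl, rfl⟩ | ⟨rfl, rfl, rfl⟩ | ⟨rfl, rfl, rfl⟩ :
          M₁ = [] ∧ x = (m, s) ∧ M₂ = [y, z] ∨ M₁ = [x] ∧ y = (m, s) ∧ M₂ = [z] ∨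
            M₁ = [x, y] ∧ z = (m, s) ∧ M₂ = [] := by
        rcases M₁ with - | ⟨_, - | ⟨_, - | ⟨_, M₁⟩⟩⟩ <;> simp_all
      · have hlt := hm' y (by simp)
        exact iff_of_false (fun h => h.1.asymm hlt) (hp.not_peak hs h0 hV)
      · have hlt := hg.isPath_mid.1.fst_lt_iff_of_shifted (by simpa using hs)
        have hsnd : x.2.2 < s.2 := by grind
        exact iff_of_true ⟨hm' x (by simp), hm' z (by simp)⟩
          ⟨hsnd, hp.fst_lt_fst_of_snd_ne_zero hs h0 hV (by lia)⟩
      · have hlt := hm' y (by simp)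
        refine iff_of_false (fun h => h.2.asymm hlt) (by grind)
    · exact ih (P := P) (S := S₁ ++ V) (by simp)

end Peaks

/-! ### Bumping a letter out of a hook word -/

section HookWords

variable {β : Type*} [LinearOrder β] {b e e' f g h p q x z : β} {D₀ D₁ D₂ U₁ U₂ V : List β}

/-- Growth of shifted diagrams along `w` and along `w'` leads to the same diagram, in any
context. -/
abbrev ShiftedGrowthEquiv (w w' : List β) : Prop :=
  GrowthEquiv .shifted (fun _ => true) w w'

theorem shiftedGrowthEquiv_swap_last (hf : f < e) (he : e < e') (hx : x < e) :
    ShiftedGrowthEquiv [f, e, e', x] [f, e, x, e'] := by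
  refine .of_nodup fun hnodup => ?_
  have hne : f ≠ x := by grind
  rcases hne.lt_or_gt with hfx | hxf
  · exact (ShiftedPlactic.acdb hfx hx he).growthEquiv
  · exact (ShiftedPlactic.bcda hxf hf he).growthEquiv

theorem shiftedGrowthEquiv_swap_up (hf : f < g) (hg : g < h) (hh : h < b) :
    ShiftedGrowthEquiv [f, g, b, h] [f, b, g, h] :=
  (ShiftedPlactic.abdc hf hg hh).growthEquiv

theorem shiftedGrowthEquiv_swap_down (hq : q < p) (hp : p < b) (hh : h < b) :
    ShiftedGrowthEquiv [p, q, b, h] [p, b, q, h] := by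
  refine .of_nodup fun hnodup => ?_
  have hpne : p ≠ h := by grind
  have hqne : q ≠ h := by grind
  rcases hpne.lt_or_gt with hph | hhp
  · exact (ShiftedPlactic.badc hq hph hh).growthEquiv
  rcases hqne.lt_or_gt with hqh | hhq
  · exact (ShiftedPlactic.cadb hqh hhp hp).growthEquiv
  · exact (ShiftedPlactic.cbda hhq hq hp).growthEquiv

theorem shiftedGrowthEquiv_swap_first (hz : z < b) (hb : b < e) (hh : h < b) :
    ShiftedGrowthEquiv [e, z, b, h] [z, e, b, h] := by
  refine .of_nodup fun hnodup => ?_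
  have hne : z ≠ h := by grind
  rcases hne.lt_or_gt with hzh | hhz
  · exact (ShiftedPlactic.dacb hzh hh hb).growthEquiv
  · exact (ShiftedPlactic.dbca hhz hz hb).growthEquiv

theorem shiftedGrowthEquiv_move_last (hV : (f :: e :: V).Pairwise (· < ·)) (hx : x < e) :
    ShiftedGrowthEquiv (f :: e :: (V ++ [x])) (f :: e :: x :: V) := by
  induction V generalizing f e with
  | nil => exact .refl _
  | cons e' V ih =>
    have hlt : f < e ∧ e < e' := by grind
    have htail : ShiftedGrowthEquiv (f :: e :: e' :: (V ++ [x])) (f :: e :: e' :: x :: V) :=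
      (ih (List.pairwise_cons.1 hV).2 (hx.trans hlt.2)).cons f
    exact htail.trans ((shiftedGrowthEquiv_swap_last hlt.1 hlt.2 hx).append_right V)

theorem shiftedGrowthEquiv_move_up (hV : (f :: V).Pairwise (· < ·)) (hh : ∀ g ∈ V, g < h)
    (hb : h < b) : ShiftedGrowthEquiv (f :: (V ++ [b, h])) (f :: b :: (V ++ [h])) := by
  induction V generalizing f with
  | nil => exact .refl _
  | cons g V ih =>
    obtain ⟨hfg, hVg⟩ := List.pairwise_cons.1 hV
    obtain ⟨hgh, hVh⟩ := List.forall_mem_cons.1 hh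
    have htail : ShiftedGrowthEquiv (f :: g :: (V ++ [b, h])) (f :: g :: b :: (V ++ [h])) :=
      (ih hVg hVh).cons f
    refine htail.trans ?_
    cases V with
    | nil => exact shiftedGrowthEquiv_swap_up (hfg g (by simp)) hgh hb
    | cons g' V =>
      have hg' : g < g' ∧ g' < b := by grind
      simpa using (shiftedGrowthEquiv_swap_up (hfg g (by simp)) hg'.1 hg'.2).append_right
        (V ++ [h])

theorem shiftedGrowthEquiv_move_down (hV : (z :: V).Pairwise (· > ·)) (hz : z < b) (hb : h < b) :
    ShiftedGrowthEquiv (z :: (V ++ [b, h])) (z :: b :: (V ++ [h])) := by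
  induction V generalizing z with
  | nil => exact .refl _
  | cons q V ih =>
    obtain ⟨hqz, hVq⟩ := List.pairwise_cons.1 hV
    have hq := hqz q (by simp)
    have htail : ShiftedGrowthEquiv (z :: q :: (V ++ [b, h])) (z :: q :: b :: (V ++ [h])) :=
      (ih hVq (hq.trans hz)).cons z
    refine htail.trans ?_
    cases V with
    | nil => exact shiftedGrowthEquiv_swap_down hq hz hb
    | cons q' V =>
      have hq' : q' < b := by grind
      simpa using (shiftedGrowthEquiv_swap_down hq hz hq').append_right (V ++ [h])

theorem shiftedGrowthEquiv_move_first (hV : (V ++ [b]).Pairwise (· > ·)) (hz : z < b)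
    (hb : h < b) : ShiftedGrowthEquiv (V ++ [z, b, h]) (z :: (V ++ [b, h])) := by
  induction V with
  | nil => exact .refl _
  | cons e V ih =>
    obtain ⟨he, hVb⟩ := List.pairwise_cons.1 hV
    refine ((ih hVb).cons e).trans ?_
    match V, hVb, he with
    | [], _, he => exact shiftedGrowthEquiv_swap_first hz (he b (by simp)) hb
    | [e'], hVb, he =>
      have hbe : b < e' := by simpa using hVb
      exact (shiftedGrowthEquiv_swap_first (hz.trans hbe) (he e' (by simp)) hbe).append_right [h]
    | e' :: e'' :: V, _, he =>
      have hbe : b < e' ∧ e'' < e' := by grind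
      simpa using (shiftedGrowthEquiv_swap_first (hz.trans hbe.1) (he e' (by simp))
        hbe.2).append_right (V ++ [b, h])

theorem shiftedGrowthEquiv_bump_up (hU : (f :: (U₁ ++ b :: U₂)).Pairwise (· < ·))
    (hx : ∀ u ∈ U₁, u < x) (hxb : x < b) :
    ShiftedGrowthEquiv (f :: (U₁ ++ b :: U₂) ++ [x]) (f :: b :: (U₁ ++ x :: U₂)) := by
  have hlast : ShiftedGrowthEquiv (f :: (U₁ ++ b :: U₂) ++ [x]) (f :: (U₁ ++ b :: x :: U₂)) := by
    obtain ⟨W, g, hW⟩ := List.eq_nil_or_concat' (f :: U₁) |>.resolve_left (List.cons_ne_nil _ _)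
    rw [← List.cons_append, hW] at hU ⊢
    rw [← List.cons_append, hW]
    simp only [List.append_assoc, List.cons_append, List.nil_append] at hU ⊢
    exact (shiftedGrowthEquiv_move_last (List.pairwise_append.1 hU).2.1 hxb).append_left W
  have hU₁ : (f :: U₁).Pairwise (· < ·) := hU.sublist (by simp)
  have hup := (shiftedGrowthEquiv_move_up hU₁ hx hxb).append_right U₂
  exact hlast.trans (by simpa using hup)

theorem shiftedGrowthEquiv_bump_down (hD : (D₁ ++ z :: D₂).Pairwise (· > ·))
    (hb : ∀ d ∈ D₁, b < d) (hz : z < b) (hh : h < b) :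
    ShiftedGrowthEquiv (D₁ ++ z :: (D₂ ++ [b, h])) (z :: (D₁ ++ b :: (D₂ ++ [h]))) := by
  obtain ⟨hD₁, hD₂, -⟩ := List.pairwise_append.1 hD
  have hdown := (shiftedGrowthEquiv_move_down hD₂ hz hh).append_left D₁
  refine hdown.trans ?_
  have hDb : (D₁ ++ [b]).Pairwise (· > ·) :=
    List.pairwise_append.2 ⟨hD₁, by simp, by simpa using hb⟩
  cases D₂ with
  | nil => exact shiftedGrowthEquiv_move_first hDb hz hh
  | cons q D₂ =>
    have hq : q < b := by grind
    simpa using (shiftedGrowthEquiv_move_first hDb hz hq).append_right (D₂ ++ [h])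

theorem shiftedGrowthEquiv_bump (hD : (D₁ ++ z :: D₂).Pairwise (· > ·))
    (hf : D₁ ++ z :: D₂ = D₀ ++ [f]) (hU : (f :: (U₁ ++ b :: U₂)).Pairwise (· < ·))
    (hb : ∀ d ∈ D₁, b < d) (hz : z < b) (hx : ∀ u ∈ U₁, u < x) (hxb : x < b) :
    ShiftedGrowthEquiv (D₁ ++ z :: D₂ ++ (U₁ ++ b :: U₂) ++ [x])
      (z :: (D₁ ++ b :: D₂ ++ (U₁ ++ x :: U₂))) := by
  have hup : ShiftedGrowthEquiv (D₁ ++ z :: D₂ ++ (U₁ ++ b :: U₂) ++ [x])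
      (D₁ ++ z :: D₂ ++ b :: (U₁ ++ x :: U₂)) := by
    rw [hf]
    simpa using (shiftedGrowthEquiv_bump_up hU hx hxb).append_left D₀
  refine hup.trans ?_
  obtain ⟨h, T, hT, hh⟩ : ∃ h T, U₁ ++ x :: U₂ = h :: T ∧ h < b := by
    cases U₁ with
    | nil => exact ⟨x, U₂, rfl, hxb⟩
    | cons g U₁ => exact ⟨g, U₁ ++ x :: U₂, rfl, (hx g (by simp)).trans hxb⟩
  rw [hT]
  simpa using (shiftedGrowthEquiv_bump_down hD hb hz hh).append_right T

end HookWords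

/-! ### Mixed insertion and hook words -/

theorem lt_of_letter_lt {a b : Letter ×ₗ ℕ} (h : letter a < letter b) : a < b :=
  Prod.Lex.lt_iff.2 (.inl h)

theorem lt_iff_letter_le {a b : Letter ×ₗ ℕ}
    (hi : letter a = letter b → (ofLex a).2 < (ofLex b).2) : a < b ↔ letter a ≤ letter b := by
  rw [Prod.Lex.lt_iff, le_iff_lt_or_eq]
  exact or_congr_right ⟨And.left, fun h => ⟨h, hi h⟩⟩

theorem gt_iff_letter_lt {a b : Letter ×ₗ ℕ}
    (hi : letter a = letter b → (ofLex a).2 < (ofLex b).2) : b < a ↔ letter b < letter a := by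
  rw [Prod.Lex.lt_iff, or_iff_left_iff_imp]
  exact fun h => absurd (hi h.1.symm) h.2.asymm

theorem IsIndexed.pairwise_lt {W : List (Letter ×ₗ ℕ)} (hi : IsIndexed W)
    (h : (W.map letter).Pairwise (· ≤ ·)) : W.Pairwise (· < ·) :=
  (hi.and (List.pairwise_map.1 h)).imp fun hab => (lt_iff_letter_le hab.1).2 hab.2

/-- The standardization of a word: each letter carries its position, which breaks ties between
equal letters. -/
def indexed (w : List Letter) : List (Letter ×ₗ ℕ) :=
  w.zipIdx.map toLex

theorem map_letter_indexed (w : List Letter) : (indexed w).map letter = w := by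
  rw [indexed, List.map_map]
  exact List.zipIdx_map_fst 0 w

theorem isIndexed_indexed (w : List Letter) : IsIndexed (indexed w) := by
  have hlt : (w.zipIdx.map Prod.snd).Pairwise (· < ·) := by
    rw [List.zipIdx_map_snd]
    exact List.pairwise_lt_range'
  refine List.pairwise_map.2 ((List.pairwise_map.1 hlt).imp ?_)
  exact fun h _ => h

theorem exists_indexed_growth (w : List Letter) : ∃ W : List ((Letter ×ₗ ℕ) × Cell),
    (W.map fun e => letter e.1) = w ∧ IsIndexed (W.map Prod.fst) ∧
      Growth .shifted (fun _ => true) W := by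
  obtain ⟨W, hW, hg⟩ := exists_shifted_growth (isIndexed_indexed w).nodup
  refine ⟨W, ?_, hW ▸ isIndexed_indexed w, hg⟩
  rw [← map_letter_indexed w, ← hW, List.map_map]
  rfl

theorem Growth.shape_mixTableau {W : List ((Letter ×ₗ ℕ) × Cell)}
    (hg : Growth .shifted (fun _ => true) W) (hi : IsIndexed (W.map Prod.fst)) :
    ((mixTableau (W.map fun e => letter e.1)).shape : Set Cell) = addCells ∅ W := by
  rw [mixTableau, (hg.mixRun hi).shape_eq]
  simp [Filling.empty]

/-- Mixed insertion of `v` and of `w` leads to tableaux of the same shape, in any context. -/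
def MixEquiv (v w : List Letter) : Prop :=
  ∀ P S, (mixTableau (P ++ v ++ S)).shape = (mixTableau (P ++ w ++ S)).shape

namespace MixEquiv

variable {u v w : List Letter}

theorem refl (v : List Letter) : MixEquiv v v := fun _ _ => rfl

theorem trans (h : MixEquiv u v) (h' : MixEquiv v w) : MixEquiv u w :=
  fun P S => (h P S).trans (h' P S)

theorem append_left (h : MixEquiv v w) (P : List Letter) : MixEquiv (P ++ v) (P ++ w) :=
  fun P' S' => by simpa using h (P' ++ P) S'

theorem append_right (h : MixEquiv v w) (S : List Letter) : MixEquiv (v ++ S) (w ++ S) :=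
  fun P' S' => by simpa using h P' (S ++ S')

theorem shape_eq (h : MixEquiv v w) : (mixTableau v).shape = (mixTableau w).shape := by
  simpa using h [] []

end MixEquiv

theorem IsIndexed.congr_mid {P S V V' : List (Letter ×ₗ ℕ)} (hi : IsIndexed (P ++ V ++ S))
    (hp : V.Perm V') (hV' : IsIndexed V') : IsIndexed (P ++ V' ++ S) := by
  simp only [IsIndexed, List.pairwise_append, List.mem_append, hp.mem_iff] at hi ⊢
  exact ⟨⟨hi.1.1, hV', hi.1.2.2⟩, hi.2⟩

theorem ShiftedGrowthEquiv.shape_mixTableau {V V' : List (Letter ×ₗ ℕ)}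
    (h : ShiftedGrowthEquiv V V') (hV : IsIndexed V) (hV' : IsIndexed V') :
    (mixTableau (V.map letter)).shape = (mixTableau (V'.map letter)).shape := by
  obtain ⟨W, hW, hg⟩ := exists_shifted_growth hV.nodup
  obtain ⟨W', hW', hg', hadd⟩ := h (P := []) (S := []) (by simpa using hW) hg
  obtain rfl : W'.map Prod.fst = V' := by simpa using hW'
  subst hW
  have hshape := hg.shape_mixTableau hV
  have hshape' := hg'.shape_mixTableau hV'
  rw [← Finset.coe_inj, List.map_map, List.map_map]
  exact hshape.trans (hadd.symm.trans hshape'.symm)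

theorem mixEquiv_of_shiftedGrowthEquiv {v w : List Letter}
    (h : ∀ V, V.map letter = v → IsIndexed V →
      ∃ V', V'.map letter = w ∧ IsIndexed V' ∧ V.Perm V' ∧ ShiftedGrowthEquiv V V') :
    MixEquiv v w := by
  intro P S
  have hi := isIndexed_indexed (P ++ v ++ S)
  obtain ⟨PV, S', hPV, hPv, hS'⟩ := List.map_eq_append_iff.1 (map_letter_indexed (P ++ v ++ S))
  obtain ⟨P', V, rfl, hP', hV⟩ := List.map_eq_append_iff.1 hPv
  rw [hPV] at hi
  obtain ⟨V', hV', hi', hp, hg⟩ := h V hV (hi.sublist (by simp))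
  have hcontext : ShiftedGrowthEquiv (P' ++ V ++ S') (P' ++ V' ++ S') :=
    (hg.append_left P').append_right S'
  simpa [hP', hV, hS', hV'] using hcontext.shape_mixTableau hi (hi.congr_mid hp hi')

/-- The situation in which the insertion of `x` into a hook word with decreasing part
`D₁ ++ z :: D₂` and increasing part `U₁ ++ b :: U₂` replaces `b` by `x` and `z` by `b`. -/
structure IsBump (D₁ D₂ U₁ U₂ : List Letter) (z b x : Letter) : Prop where
  down : (D₁ ++ z :: D₂).Pairwise (· > ·)
  up : ∃ f ∈ (D₁ ++ z :: D₂).getLast?, (f :: (U₁ ++ b :: U₂)).Pairwise (· ≤ ·)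
  lt_of_mem_down : ∀ d ∈ D₁, b < d
  le : z ≤ b
  le_of_mem_up : ∀ u ∈ U₁, u ≤ x
  lt : x < b

section IsBump

variable {D₁ D₂ U₁ U₂ : List (Letter ×ₗ ℕ)} {z b x : Letter ×ₗ ℕ}

theorem IsBump.isIndexed
    (h : IsBump (D₁.map letter) (D₂.map letter) (U₁.map letter) (U₂.map letter)
      (letter z) (letter b) (letter x))
    (hi : IsIndexed (D₁ ++ z :: D₂ ++ (U₁ ++ b :: U₂) ++ [x])) :
    IsIndexed (z :: (D₁ ++ b :: D₂ ++ (U₁ ++ x :: U₂))) := by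
  have hdown : (∀ d ∈ D₁, letter z < letter d) ∧ ∀ d ∈ D₂, letter d < letter z := by
    have hpart := h.down
    simp only [List.pairwise_append, List.pairwise_cons, List.forall_mem_map,
      List.mem_cons] at hpart
    exact ⟨fun d hd => hpart.2.2 d hd _ (.inl rfl), hpart.2.1.1⟩
  have hup : ∀ u ∈ U₂, letter b ≤ letter u := by
    obtain ⟨f, -, hf⟩ := h.up
    have hpart := (List.pairwise_cons.1 hf).2
    simp only [List.pairwise_append, List.pairwise_cons, List.forall_mem_map] at hpart
    exact hpart.2.1.1
  have hb : ∀ d ∈ D₁, letter b < letter d := List.forall_mem_map.1 h.lt_of_mem_down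
  have hx : ∀ u ∈ U₁, letter u ≤ letter x := List.forall_mem_map.1 h.le_of_mem_up
  have hzb := h.le
  have hxb := h.lt
  clear h
  simp only [IsIndexed, List.pairwise_append, List.pairwise_cons, List.mem_append, List.mem_cons,
    List.not_mem_nil, or_false] at hi ⊢
  grind

theorem IsBump.shiftedGrowthEquiv
    (h : IsBump (D₁.map letter) (D₂.map letter) (U₁.map letter) (U₂.map letter)
      (letter z) (letter b) (letter x))
    (hi : IsIndexed (D₁ ++ z :: D₂ ++ (U₁ ++ b :: U₂) ++ [x])) :
    ShiftedGrowthEquiv (D₁ ++ z :: D₂ ++ (U₁ ++ b :: U₂) ++ [x])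
      (z :: (D₁ ++ b :: D₂ ++ (U₁ ++ x :: U₂))) := by
  obtain ⟨D₀, f, hf⟩ := (List.eq_nil_or_concat' (D₁ ++ z :: D₂)).resolve_left (by simp)
  obtain ⟨l, hl, hup⟩ := h.up
  obtain rfl : letter f = l := by
    rw [← List.map_cons, ← List.map_append, hf] at hl
    simpa using hl
  have hdown : ((D₁ ++ z :: D₂).map letter).Pairwise (· > ·) := by simpa using h.down
  have hup : ((f :: (U₁ ++ b :: U₂)).map letter).Pairwise (· ≤ ·) := by simpa using hup
  have hD : (D₁ ++ z :: D₂).Pairwise (· > ·) := (List.pairwise_map.1 hdown).imp lt_of_letter_lt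
  have hU : (f :: (U₁ ++ b :: U₂)).Pairwise (· < ·) := by
    refine IsIndexed.pairwise_lt (List.Pairwise.sublist ?_ hi) hup
    rw [hf]
    simp
  obtain ⟨hi, -, hix⟩ := List.pairwise_append.1 hi
  have hzb : z < b := (lt_iff_letter_le
    ((List.pairwise_append.1 hi).2.2 z (by simp) b (by simp))).2 h.le
  have hux : ∀ u ∈ U₁, u < x := fun u hu => (lt_iff_letter_le
    (hix u (by simp [hu]) x (by simp))).2 (h.le_of_mem_up _ (List.mem_map_of_mem hu))
  exact shiftedGrowthEquiv_bump hD hf hU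
    (fun d hd => lt_of_letter_lt (h.lt_of_mem_down _ (List.mem_map_of_mem hd))) hzb hux
    (lt_of_letter_lt h.lt)

end IsBump

theorem IsBump.mixEquiv {D₁ D₂ U₁ U₂ : List Letter} {z b x : Letter}
    (h : IsBump D₁ D₂ U₁ U₂ z b x) :
    MixEquiv (D₁ ++ z :: D₂ ++ (U₁ ++ b :: U₂) ++ [x])
      (z :: (D₁ ++ b :: D₂ ++ (U₁ ++ x :: U₂))) := by
  refine mixEquiv_of_shiftedGrowthEquiv fun V hV hi => ?_
  simp only [List.map_eq_append_iff, List.map_eq_cons_iff, List.map_eq_nil_iff] at hV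
  obtain ⟨-, -, rfl, ⟨-, -, rfl, ⟨D₁, -, rfl, rfl, z, D₂, rfl, rfl, rfl⟩, U₁, -, rfl, rfl,
    b, U₂, rfl, rfl, rfl⟩, x, -, rfl, rfl, rfl⟩ := hV
  refine ⟨_, ?_, h.isIndexed hi, ?_, h.shiftedGrowthEquiv hi⟩
  · simp
  · classical
    refine List.perm_iff_count.2 fun a => ?_
    simp only [List.count_append, List.count_cons, List.count_nil]
    lia

/-! ### SK insertion into a hook word -/

theorem isHookWord_append_cons {D U : List Letter} {f : Letter}
    (hD : (D ++ [f]).Pairwise (· > ·)) (hU : (f :: U).Pairwise (· ≤ ·)) :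
    IsHookWord (D ++ f :: U) := by
  refine ⟨D.length + 1, by simp, ?_, by simpa using hU⟩
  simpa [List.take_append, List.take_of_length_le] using hD

theorem isHookWord_append {D U : List Letter} (hne : D ++ U ≠ []) (hD : D.Pairwise (· > ·))
    (hU : U.Pairwise (· ≤ ·)) : IsHookWord (D ++ U) := by
  rcases List.eq_nil_or_concat' D with rfl | ⟨D, d, rfl⟩ <;> rcases U with - | ⟨v, U⟩
  · exact absurd rfl hne
  · exact isHookWord_append_cons (D := []) (by simp) hU
  · simpa using isHookWord_append_cons hD (List.pairwise_singleton _ d)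
  rcases le_or_gt d v with h | h
  · simpa using isHookWord_append_cons (U := v :: U) hD (by grind)
  · exact isHookWord_append_cons (by grind) hU

theorem IsHookWord.downPart_append_upPart {u : List Letter} (hu : IsHookWord u) :
    downPart u ++ upPart u = u := by
  obtain ⟨k, hk, hdown, hup⟩ := hu
  obtain ⟨hD, hU⟩ := parts_eq hk hdown hup
  rw [hD, hU, List.take_append_drop]

theorem IsHookWord.pairwise_downPart {u : List Letter} (hu : IsHookWord u) :
    (downPart u).Pairwise (· > ·) := by
  obtain ⟨k, hk, hdown, hup⟩ := hu
  rwa [(parts_eq hk hdown hup).1]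

theorem IsHookWord.pairwise_upPart {u : List Letter} (hu : IsHookWord u) :
    ∃ f ∈ (downPart u).getLast?, (f :: upPart u).Pairwise (· ≤ ·) := by
  obtain ⟨k, hk, hdown, hup⟩ := hu
  obtain ⟨hD, hU⟩ := parts_eq hk hdown hup
  obtain ⟨hk₁, hk₂⟩ := Finset.mem_Icc.1 hk
  have hlt : k - 1 < u.length := by lia
  refine ⟨u[k - 1], ?_, ?_⟩
  · rw [hD, List.getLast?_take]
    simp [hlt, Nat.one_le_iff_ne_zero.1 hk₁]
  · rw [hU]
    rw [List.drop_eq_getElem_cons hlt, Nat.sub_add_cancel hk₁] at hup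
    exact hup

theorem IsHookWord.ne_nil {u : List Letter} (hu : IsHookWord u) : u ≠ [] := by
  rintro rfl
  obtain ⟨k, hk, -⟩ := hu
  simp at hk

theorem IsHookWord.not_peak {l r : List Letter} {x y z : Letter}
    (hu : IsHookWord (l ++ [x, y, z] ++ r)) : ¬ (x ≤ y ∧ z < y) := by
  rintro ⟨hxy, hzy⟩
  obtain ⟨k, -, hdown, hup⟩ := hu
  rcases le_or_gt (l.length + 2) k with hk | hk
  · have hprefix : (l ++ [x, y]) <+: (l ++ [x, y, z] ++ r).take k :=
      List.prefix_take_iff.2 ⟨by simp, by simpa using hk⟩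
    exact hxy.not_gt (by simpa using (List.pairwise_append.1 (hdown.sublist hprefix.sublist)).2.1)
  · rw [List.append_assoc, List.drop_append_of_le_length (by lia)] at hup
    have hyz : y ≤ z := by grind
    exact hyz.not_gt hzy

theorem IsHookWord.exists_isBump {u : List Letter} {x : Letter} (hu : IsHookWord u)
    (hx : ¬ IsHookWord (u ++ [x])) : ∃ D₁ D₂ U₁ U₂ z b,
      downPart u = D₁ ++ z :: D₂ ∧ upPart u = U₁ ++ b :: U₂ ∧ IsBump D₁ D₂ U₁ U₂ z b x := by
  have hD := hu.pairwise_downPart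
  obtain ⟨f, hf, hfU⟩ := hu.pairwise_upPart
  have hex : ∃ y ∈ upPart u, x < y := by
    by_contra! hle
    rw [← hu.downPart_append_upPart, List.append_assoc] at hx
    refine hx (isHookWord_append (by simp) hD (List.pairwise_append.2 ?_))
    exact ⟨(List.pairwise_cons.1 hfU).2, List.pairwise_singleton _ _, by simpa using hle⟩
  obtain ⟨b, hb⟩ := Option.isSome_iff_exists.1
    ((List.find?_isSome (p := fun y => decide (x < y))).2 (by simpa using hex))
  obtain ⟨hxb, U₁, U₂, hU, hU₁⟩ := List.find?_eq_some_iff_append.1 hb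
  have hfb : f ≤ b := (List.pairwise_cons.1 hfU).1 b (by simp [hU])
  obtain ⟨z, hz⟩ := Option.isSome_iff_exists.1
    ((List.find?_isSome (p := fun z => decide (z ≤ b))).2
      ⟨f, List.mem_of_getLast? hf, by simpa using hfb⟩)
  obtain ⟨hzb, D₁, D₂, hD', hD₁⟩ := List.find?_eq_some_iff_append.1 hz
  refine ⟨D₁, D₂, U₁, U₂, z, b, hD', hU, hD' ▸ hD, ⟨f, hD' ▸ hf, hU ▸ hfU⟩, ?_, ?_, ?_, ?_⟩
  · simpa using hD₁
  · simpa using hzb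
  · simpa using hU₁
  · simpa using hxb

theorem set_findIdx_append {α : Type*} {p : α → Bool} {l₁ l₂ : List α} {a : α} (ha : p a)
    (h : ∀ b ∈ l₁, ¬ p b) (c : α) :
    (l₁ ++ a :: l₂).set ((l₁ ++ a :: l₂).findIdx p) c = l₁ ++ c :: l₂ := by
  have hidx : (l₁ ++ a :: l₂).findIdx p = l₁.length := by
    induction l₁ with
    | nil => simp [List.findIdx_cons, ha]
    | cons b l₁ ih => simp_all [List.findIdx_cons]
  simp [hidx]

section IsBump

variable {D₁ D₂ U₁ U₂ : List Letter} {z b x : Letter}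

theorem IsBump.skRowInsert {u : List Letter} (h : IsBump D₁ D₂ U₁ U₂ z b x)
    (hx : ¬ IsHookWord (u ++ [x])) (hD : downPart u = D₁ ++ z :: D₂)
    (hU : upPart u = U₁ ++ b :: U₂) :
    skRowInsert u x = (D₁ ++ b :: D₂ ++ (U₁ ++ x :: U₂), some z) := by
  have hb : (U₁ ++ b :: U₂).find? (fun y => x < y) = some b :=
    List.find?_eq_some_iff_append.2
      ⟨by simpa using h.lt, U₁, U₂, rfl, by simpa using h.le_of_mem_up⟩
  have hz : (D₁ ++ z :: D₂).find? (fun y => y ≤ b) = some z :=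
    List.find?_eq_some_iff_append.2
      ⟨by simpa using h.le, D₁, D₂, rfl, by simpa using h.lt_of_mem_down⟩
  rw [ShiftedInsertion.skRowInsert, if_neg hx, hU, hD, hb]
  dsimp only
  rw [hz]
  dsimp only
  rw [set_findIdx_append (by simpa using h.le), set_findIdx_append (by simpa using h.lt)]
  · simpa using h.le_of_mem_up
  · simpa using h.lt_of_mem_down

theorem IsBump.isHookWord (h : IsBump D₁ D₂ U₁ U₂ z b x) :
    IsHookWord (D₁ ++ b :: D₂ ++ (U₁ ++ x :: U₂)) := by
  obtain ⟨hdown, ⟨f, -, hup⟩, hb, hzb, hx, hxb⟩ := h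
  have hU := (List.pairwise_cons.1 hup).2
  refine isHookWord_append (by simp) ?_ ?_
  · simp only [List.pairwise_append, List.pairwise_cons, List.mem_cons] at hdown ⊢
    refine ⟨hdown.1, ⟨fun d hd => (hdown.2.1.1 d hd).trans_le hzb, hdown.2.1.2⟩, ?_⟩
    rintro d hd d' (rfl | hd')
    · exact hb d hd
    · exact hdown.2.2 d hd d' (.inr hd')
  · simp only [List.pairwise_append, List.pairwise_cons, List.mem_cons] at hU ⊢
    refine ⟨hU.1, ⟨fun u hu => hxb.le.trans (hU.2.1.1 u hu), hU.2.1.2⟩, ?_⟩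
    rintro u hu u' (rfl | hu')
    · exact hx u hu
    · exact hU.2.2 u hu u' (.inr hu')

theorem IsBump.exists_last_pair (h : IsBump D₁ D₂ U₁ U₂ z b x) :
    ∃ v y' y, D₁ ++ z :: D₂ ++ (U₁ ++ b :: U₂) = v ++ [y', y] ∧ y' ≤ y ∧ x < y := by
  obtain ⟨f, hf, hup⟩ := h.up
  obtain ⟨D₀, hD₀⟩ := List.getLast?_eq_some_iff.1 hf
  obtain ⟨U, y, hy⟩ := (List.eq_nil_or_concat' (U₁ ++ b :: U₂)).resolve_left (by simp)
  obtain ⟨V, y', hy'⟩ := (List.eq_nil_or_concat' (f :: U)).resolve_left (by simp)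
  have hV : f :: (U₁ ++ b :: U₂) = V ++ [y', y] := by
    rw [hy, ← List.cons_append, hy', List.append_assoc, List.singleton_append]
  refine ⟨D₀ ++ V, y', y, ?_, ?_, ?_⟩
  · rw [hD₀, List.append_assoc, List.append_assoc, ← hV, List.singleton_append]
  · rw [hV] at hup
    simpa using (List.pairwise_append.1 hup).2.1
  · have hby : ∀ u ∈ b :: U₂, x < u := by
      have hb := (List.pairwise_cons.1 (List.pairwise_append.1 (List.pairwise_cons.1 hup).2).2.1).1
      exact List.forall_mem_cons.2 ⟨h.lt, fun u hu => h.lt.trans_le (hb u hu)⟩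
    refine hby y (List.mem_of_getLast? ?_)
    rw [← List.getLast?_append_of_ne_nil U₁ (List.cons_ne_nil b U₂), hy, List.getLast?_concat]

end IsBump

theorem skRowInsert_cases {u : List Letter} (hu : IsHookWord u) (x : Letter) :
    IsHookWord (u ++ [x]) ∧ skRowInsert u x = (u ++ [x], none) ∨
    ∃ u' z v y' y, skRowInsert u x = (u', some z) ∧ IsHookWord u' ∧ u'.length = u.length ∧
      MixEquiv (u ++ [x]) (z :: u') ∧ u = v ++ [y', y] ∧ y' ≤ y ∧ x < y := by
  by_cases hx : IsHookWord (u ++ [x])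
  · exact .inl ⟨hx, by rw [skRowInsert, if_pos hx]⟩
  obtain ⟨D₁, D₂, U₁, U₂, z, b, hD, hU, hbump⟩ := hu.exists_isBump hx
  have hparts : D₁ ++ z :: D₂ ++ (U₁ ++ b :: U₂) = u := by
    rw [← hD, ← hU, hu.downPart_append_upPart]
  obtain ⟨v, y', y, hlast, hy, hxy⟩ := hbump.exists_last_pair
  refine .inr ⟨_, z, v, y', y, hbump.skRowInsert hx hD hU, hbump.isHookWord, ?_, ?_,
    hparts.symm.trans hlast, hy, hxy⟩
  · rw [← hparts]
    simp
  · rw [← hparts]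
    exact hbump.mixEquiv

/-! ### The diagonals of a path without peaks -/

section Paths

variable {β : Type*} {A : Set Cell} {W : List (β × Cell)} {e e' : β × Cell} {r c : ℕ}

theorem IsPath.ncard {P : Cell → Prop} (h : IsPath P A W) (hA : A.Finite) :
    (addCells A W).ncard = A.ncard + W.length := by
  induction W generalizing A with
  | nil => simp
  | cons e W ih =>
    rw [addCells_cons, ih h.2 (hA.insert _), Set.ncard_insert_of_notMem h.1.notMem hA,
      List.length_cons, Nat.add_right_comm, Nat.add_assoc]

/-- No cell of a path lies to the right of the previous one and strictly above the next one. -/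
def PeakFree (W : List (β × Cell)) : Prop :=
  ∀ x y z, [x, y, z] <:+: W → ¬ (x.2.2 < y.2.2 ∧ y.2.1 < z.2.1)

theorem PeakFree.of_cons (h : PeakFree (e :: W)) : PeakFree W :=
  fun x y z hW => h x y z (hW.trans (List.suffix_cons _ _).isInfix)

theorem IsPath.isChain_col (hpath : IsPath BumpRule.shifted.region A (e :: e' :: W))
    (hpeak : PeakFree (e :: e' :: W)) (hcol : e.2.2 < e'.2.2) :
    (e :: e' :: W).IsChain (fun x y => x.2.2 < y.2.2) := by
  induction W generalizing A e e' with
  | nil => simpa using hcol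
  | cons e'' W ih =>
    have hrow : ¬ e'.2.1 < e''.2.1 := fun hrow =>
      hpeak e e' e'' (List.prefix_append [e, e', e''] W).isInfix ⟨hcol, hrow⟩
    rw [hpath.2.1.fst_lt_iff_of_shifted hpath.2.2.1, not_le] at hrow
    exact (ih hpath.2 hpeak.of_cons hrow).cons_cons hcol

theorem IsPath.exists_append_isChain (hpath : IsPath BumpRule.shifted.region A W)
    (hpeak : PeakFree W) : ∃ D U, W = D ++ U ∧ D.IsChain (fun x y => x.2.1 < y.2.1) ∧
      U.IsChain (fun x y => x.2.2 < y.2.2) := by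
  induction W generalizing A with
  | nil => exact ⟨[], [], by simp⟩
  | cons e W ih =>
    obtain ⟨D, U, rfl, hD, hU⟩ := ih hpath.2 hpeak.of_cons
    rcases D with - | ⟨e', D⟩
    · exact ⟨[e], U, rfl, by simp, hU⟩
    by_cases hrow : e.2.1 < e'.2.1
    · exact ⟨e :: e' :: D, U, rfl, hD.cons_cons hrow, hU⟩
    · rw [hpath.1.fst_lt_iff_of_shifted hpath.2.1, not_le] at hrow
      exact ⟨[], _, rfl, by simp, hpath.isChain_col hpeak hrow⟩

theorem eq_of_isChain_lt {g : Cell → ℕ} (hW : W.IsChain (fun x y => g x.2 < g y.2)) {p q : Cell}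
    (hp : p ∈ W.map Prod.snd) (hq : q ∈ W.map Prod.snd) (hpq : g p = g q) : p = q := by
  have hmap : ((W.map Prod.snd).map g).IsChain (· < ·) := by
    rw [List.map_map, List.isChain_map]
    exact hW
  exact List.inj_on_of_nodup_map (hmap.pairwise.imp LT.lt.ne) hp hq hpq

theorem IsPath.mem_of_diag_mem (hpath : IsPath BumpRule.shifted.region A W)
    (hA : IsRelLowerSet A BumpRule.shifted.region) (hpeak : PeakFree W)
    (hrc : (r + 1, c + 1) ∈ addCells A W) : (r, c) ∈ A := by
  obtain ⟨D, U, rfl, hD, hU⟩ := hpath.exists_append_isChain hpeak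
  rw [isPath_append] at hpath
  have hAD := hpath.1.isRelLowerSet hA
  have hADU := hpath.2.isRelLowerSet hAD
  rw [addCells_append] at hrc
  have hle : r ≤ c := Nat.le_of_succ_le_succ (hADU.prop_of_mem hrc)
  by_contra hnot
  have hD' : (r, c + 1) ∉ addCells A D := fun hmem => by
    have hmem' : (r, c) ∈ addCells A D := hAD.mem_of_le hmem (by simp [Prod.le_def]) hle
    have hnot' : (r, c + 1) ∉ A := fun h => hnot (hA.mem_of_le h (by simp [Prod.le_def]) hle)
    have heq := eq_of_isChain_lt (g := Prod.fst) hD (hmem.resolve_left hnot')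
      (hmem'.resolve_left hnot) rfl
    simp at heq
  have hD'' : (r + 1, c + 1) ∉ addCells A D := fun hmem =>
    hD' (hAD.mem_of_le hmem (by simp [Prod.le_def]) (Nat.le_succ_of_le hle))
  have hmem : (r, c + 1) ∈ addCells (addCells A D) U :=
    hADU.mem_of_le hrc (by simp [Prod.le_def]) (Nat.le_succ_of_le hle)
  have heq := eq_of_isChain_lt (g := Prod.snd) hU (hrc.resolve_left hD'')
    (hmem.resolve_left hD') rfl
  simp at heq

end Paths

/-! ### Shapes of mixed insertion and SK insertion tableaux -/

section Growth

variable {P S U V : List ((Letter ×ₗ ℕ) × Cell)} {x y z : (Letter ×ₗ ℕ) × Cell}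

theorem Growth.peak_iff_letter (hg : Growth .shifted (fun _ => true) (P ++ [x, y, z] ++ S))
    (hi : IsIndexed ((P ++ [x, y, z] ++ S).map Prod.fst)) :
    letter x.1 ≤ letter y.1 ∧ letter z.1 < letter y.1 ↔ x.2.2 < y.2.2 ∧ y.2.1 < z.2.1 := by
  have hwindow : IsIndexed [x.1, y.1, z.1] := List.Pairwise.sublist (by simp) hi
  simp only [IsIndexed, List.pairwise_cons, List.mem_cons, forall_eq_or_imp] at hwindow
  rw [← hg.peak_iff, lt_iff_letter_le hwindow.1.1, gt_iff_letter_lt hwindow.2.1.1]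

theorem Growth.shape_mixTableau_left (hg : Growth .shifted (fun _ => true) (V ++ U))
    (hi : IsIndexed ((V ++ U).map Prod.fst)) :
    ((mixTableau (V.map fun e => letter e.1)).shape : Set Cell) = addCells ∅ V := by
  rw [mixTableau, (mixRun_append.1 (hg.mixRun hi)).1.shape_eq]
  simp [Filling.empty]

end Growth

theorem card_shape_mixTableau (w : List Letter) : (mixTableau w).shape.card = w.length := by
  obtain ⟨W, rfl, hi, hg⟩ := exists_indexed_growth w
  rw [← Set.ncard_coe_finset, hg.shape_mixTableau hi, hg.isPath.ncard Set.finite_empty]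
  simp

theorem isRelLowerSet_shape_mixTableau (w : List Letter) :
    IsRelLowerSet ((mixTableau w).shape : Set Cell) BumpRule.shifted.region := by
  obtain ⟨W, rfl, hi, hg⟩ := exists_indexed_growth w
  rw [hg.shape_mixTableau hi]
  exact hg.isRelLowerSet

theorem mem_of_diag_mem_mixTableau {v u : List Letter} (hu : IsHookWord u) {r c : ℕ}
    (h : (r + 1, c + 1) ∈ (mixTableau (v ++ u)).shape) : (r, c) ∈ (mixTableau v).shape := by
  obtain ⟨W, hW, hi, hg⟩ := exists_indexed_growth (v ++ u)
  obtain ⟨V, U, rfl, rfl, rfl⟩ := List.map_eq_append_iff.1 hW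
  have hV := isRelLowerSet_shape_mixTableau (V.map fun e => letter e.1)
  rw [hg.shape_mixTableau_left hi] at hV
  rw [← List.map_append, ← Finset.mem_coe, hg.shape_mixTableau hi, addCells_append] at h
  rw [← Finset.mem_coe, hg.shape_mixTableau_left hi]
  refine hg.isPath_right.mem_of_diag_mem hV ?_ h
  rintro x y z ⟨P, S, rfl⟩ hpeak
  have hassoc : V ++ (P ++ [x, y, z] ++ S) = V ++ P ++ [x, y, z] ++ S := by
    simp only [List.append_assoc]
  rw [hassoc] at hi hg
  simp only [List.map_append, List.map_cons, List.map_nil] at hu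
  exact hu.not_peak ((hg.peak_iff_letter hi).2 hpeak)

theorem mem_row_zero_of_succ_mem {w : List Letter} {x : Letter} {j : ℕ}
    (hj : (0, j + 1) ∈ (mixTableau (w ++ [x])).shape) : (0, j) ∈ (mixTableau w).shape := by
  obtain ⟨W, hW, hi, hg⟩ := exists_indexed_growth (w ++ [x])
  simp only [List.map_eq_append_iff, List.map_eq_cons_iff, List.map_eq_nil_iff] at hW
  obtain ⟨V, -, rfl, rfl, e, -, rfl, rfl, rfl⟩ := hW
  have hshape := hg.shape_mixTableau hi
  simp only [List.map_append, List.map_cons, List.map_nil, addCells_append, addCells_cons,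
    addCells_nil] at hshape
  rw [← Finset.mem_coe, hshape] at hj
  rw [← Finset.mem_coe, hg.shape_mixTableau_left hi]
  have hadd := hg.isPath_right.1
  have hlt : ((0, j) : Cell) < (0, j + 1) := Prod.mk_lt_mk_of_le_of_lt le_rfl (Nat.lt_succ_self j)
  rcases hj with hj | hj
  · exact hadd.mem_of_lt (Nat.zero_le j) (hj ▸ hlt)
  · exact hadd.isRelLowerSet.mem_of_le hj hlt.le (Nat.zero_le j)

theorem mem_row_zero_of_peak {w : List Letter} {x y z : Letter} (hxy : x ≤ y) (hzy : z < y)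
    {j : ℕ} (hj : (0, j) ∈ (mixTableau (w ++ [x, y, z])).shape) :
    (0, j) ∈ (mixTableau (w ++ [x, y])).shape := by
  obtain ⟨W, hW, hi, hg⟩ := exists_indexed_growth (w ++ [x, y, z])
  simp only [List.map_eq_append_iff, List.map_eq_cons_iff, List.map_eq_nil_iff] at hW
  obtain ⟨V, -, rfl, rfl, e₁, -, rfl, rfl, e₂, -, rfl, rfl, e₃, -, rfl, rfl, rfl⟩ := hW
  have hpeak := (Growth.peak_iff_letter (S := []) (by simpa using hg) (by simpa using hi)).1
    ⟨hxy, hzy⟩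
  have hassoc : V ++ [e₁, e₂, e₃] = V ++ [e₁, e₂] ++ [e₃] := by simp
  have hshape := hg.shape_mixTableau hi
  rw [hassoc] at hi hg
  have hleft := hg.shape_mixTableau_left hi
  rw [hassoc, addCells_append _ (V ++ [e₁, e₂]), ← hleft, ← hassoc] at hshape
  simp only [List.map_append, List.map_cons, List.map_nil, addCells_cons, addCells_nil] at hshape
  rw [← Finset.mem_coe, hshape] at hj
  exact hj.resolve_left fun h => Nat.not_lt_zero _ (h ▸ hpeak.2)

theorem skRows_append_singleton (w : List Letter) (x : Letter) :
    skRows (w ++ [x]) = skInsert (skRows w) x := by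
  simp [skRows]

/-- `u` is the first row of the SK insertion tableau of `w`, and `v` is the word of the letters
bumped out of the first row, in the order in which they are bumped. -/
structure IsFirstRow (w u v : List Letter) : Prop where
  isHookWord : IsHookWord u
  skRows_eq : skRows w = u :: skRows v
  mixEquiv : MixEquiv w (v ++ u)

namespace IsFirstRow

variable {w u v : List Letter}

theorem length_add_length (h : IsFirstRow w u v) : v.length + u.length = w.length := by
  rw [← List.length_append, ← card_shape_mixTableau, ← card_shape_mixTableau, h.mixEquiv.shape_eq]

theorem length_pos (h : IsFirstRow w u v) : 0 < u.length :=
  List.length_pos_iff.2 h.isHookWord.ne_nil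

theorem row_unique {u' v' : List Letter} (h : IsFirstRow w u v) (h' : IsFirstRow w u' v') :
    u = u' :=
  (List.cons.inj (h.skRows_eq.symm.trans h'.skRows_eq)).1

theorem singleton (x : Letter) : IsFirstRow [x] [x] [] where
  isHookWord :=
    isHookWord_append_cons (D := []) (List.pairwise_singleton _ x) (List.pairwise_singleton _ x)
  skRows_eq := rfl
  mixEquiv := .refl _

theorem append_singleton (h : IsFirstRow w u v) (x : Letter) :
    IsFirstRow (w ++ [x]) (skRowInsert u x).1 (v ++ (skRowInsert u x).2.toList) := by
  have hequiv : MixEquiv (w ++ [x]) (v ++ (u ++ [x])) := by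
    rw [← List.append_assoc]
    exact h.mixEquiv.append_right [x]
  rcases skRowInsert_cases h.isHookWord x with
    ⟨hux, hins⟩ | ⟨u', z, -, -, -, hins, hu', -, hbump, -⟩
  · rw [hins]
    refine ⟨hux, ?_, by simpa using hequiv⟩
    simp [skRows_append_singleton, h.skRows_eq, skInsert, hins]
  · rw [hins]
    refine ⟨hu', ?_, hequiv.trans ?_⟩
    · simp [skRows_append_singleton, h.skRows_eq, skInsert, hins]
    · simpa using hbump.append_left v

end IsFirstRow

theorem exists_isFirstRow {w : List Letter} (hw : w ≠ []) : ∃ u v, IsFirstRow w u v := by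
  induction w using List.reverseRecOn with
  | nil => exact absurd rfl hw
  | append_singleton w x ih =>
    rcases eq_or_ne w [] with rfl | hw
    · exact ⟨[x], [], .singleton x⟩
    · obtain ⟨u, v, h⟩ := ih hw
      exact ⟨_, _, h.append_singleton x⟩

theorem Filling.mem_ofRows {α : Type} {R : List (List α)} {p : Cell} :
    p ∈ (Filling.ofRows R).shape ↔ p.1 ≤ p.2 ∧ p.2 - p.1 < (R.getD p.1 []).length := by
  rw [(Filling.ofRows R).mem_shape]
  by_cases h : p.1 ≤ p.2 <;> simp [Filling.ofRows, h]

/-- Puts a row of length `n` on top of the diagram `A`, moved one step along the diagonal. -/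
def addTopRow (n : ℕ) (A : Finset Cell) : Finset Cell :=
  (Finset.range n).image (fun j => (0, j)) ∪ A.image fun q => (q.1 + 1, q.2 + 1)

theorem card_addTopRow_le (n : ℕ) (A : Finset Cell) : (addTopRow n A).card ≤ A.card + n := by
  rw [Nat.add_comm]
  exact (Finset.card_union_le _ _).trans
    (Nat.add_le_add (Finset.card_image_le.trans (Finset.card_range n).le) Finset.card_image_le)

theorem Filling.shape_ofRows_cons {α : Type} (u : List α) (R : List (List α)) :
    (Filling.ofRows (u :: R)).shape = addTopRow u.length (Filling.ofRows R).shape := by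
  ext ⟨r, c⟩
  rcases r with - | r <;> rcases c with - | c <;> simp [addTopRow, mem_ofRows]

namespace IsFirstRow

variable {w u v : List Letter} {j : ℕ}

theorem lt_length_append_singleton {x : Letter} (h : IsFirstRow w u v)
    (hw : ∀ i, (0, i) ∈ (mixTableau w).shape → i < u.length)
    (hj : (0, j) ∈ (mixTableau (w ++ [x])).shape) : j < (skRowInsert u x).1.length := by
  rcases skRowInsert_cases h.isHookWord x with
    ⟨-, hins⟩ | ⟨u', z, l, y', y, hins, -, hlen, -, rfl, hy, hxy⟩
  · rw [hins, List.length_append, List.length_singleton]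
    rcases j with - | j
    · exact Nat.succ_pos _
    · exact Nat.succ_lt_succ (hw j (mem_row_zero_of_succ_mem hj))
  · rw [hins, hlen]
    refine hw j ?_
    rw [h.mixEquiv.shape_eq, ← List.append_assoc]
    rw [(h.mixEquiv.append_right [x]).shape_eq] at hj
    exact mem_row_zero_of_peak hy hxy (by simpa using hj)

theorem lt_length (h : IsFirstRow w u v)
    (hj : (0, j) ∈ (mixTableau w).shape) : j < u.length := by
  induction w using List.reverseRecOn generalizing u v j with
  | nil => simp [mixTableau, Filling.empty] at hj
  | append_singleton w x ih =>
    rcases eq_or_ne w [] with rfl | hw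
    · rcases j with - | j
      · exact h.length_pos
      · simpa [mixTableau, Filling.empty] using mem_row_zero_of_succ_mem hj
    · obtain ⟨u₀, v₀, h₀⟩ := exists_isFirstRow hw
      rw [h.row_unique (h₀.append_singleton x)]
      exact h₀.lt_length_append_singleton (fun _ => ih h₀) hj

theorem shape_mixTableau (h : IsFirstRow w u v) :
    (mixTableau w).shape = addTopRow u.length (mixTableau v).shape := by
  have hsub : (mixTableau w).shape ⊆ addTopRow u.length (mixTableau v).shape := by
    rintro ⟨r, c⟩ hrc
    rcases r with - | r
    · simpa [addTopRow] using h.lt_length hrc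
    · have hle : r + 1 ≤ c := (isRelLowerSet_shape_mixTableau w).prop_of_mem hrc
      obtain ⟨c, rfl⟩ := Nat.exists_eq_add_of_le' (Nat.one_le_of_lt hle)
      rw [h.mixEquiv.shape_eq] at hrc
      simpa [addTopRow] using mem_of_diag_mem_mixTableau h.isHookWord hrc
  refine Finset.eq_of_subset_of_card_le hsub ((card_addTopRow_le _ _).trans ?_)
  rw [card_shape_mixTableau, card_shape_mixTableau, h.length_add_length]

end IsFirstRow

theorem shape_mixTableau (w : List Letter) : (mixTableau w).shape = (skTableau w).shape := by
  induction hn : w.length using Nat.strong_induction_on generalizing w with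
  | _ n ih =>
    rcases eq_or_ne w [] with rfl | hw
    · simp [mixTableau, skTableau, skRows, Filling.empty, Filling.ofRows]
    · obtain ⟨u, v, h⟩ := exists_isFirstRow hw
      have hlt : v.length < n := hn ▸ h.length_add_length ▸ Nat.lt_add_of_pos_right h.length_pos
      rw [h.shape_mixTableau, ih _ hlt v rfl, skTableau, skTableau, h.skRows_eq,
        Filling.shape_ofRows_cons]

end ShiftedInsertion

theorem mainTheorem11 (w : List ShiftedInsertion.Letter) :
    ShiftedInsertion.mixRecording w = ShiftedInsertion.skRecording w := by
  simp only [ShiftedInsertion.mixRecording, ShiftedInsertion.skRecording,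
    ShiftedInsertion.shape_mixTableau]
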